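/- Let $C$ be a small category with a terminal object $t$. The category $\Theta C$ has objects $[m](c_1,\dots,c_m)$ with $m\ge 0$ and $c_i\in C$; a morphism $[m](c_1,\dots,c_m)\to[l](d_1,\dots,d_l)$ consists of a map $\varphi\colon[m]\to[l]$ of $\Delta$ and of morphisms $c_i\to d_j$ of $C$ for all $1\le i\le m$ and $\varphi(i-1)<j\le\varphi(i)$, with the evident composition. For a small category $D$, let $\mathrm{sPsh}(D)$ be the category of functors from $D^{\mathrm{op}}$ to simplicial sets, let $F\colon D\to\mathrm{sPsh}(D)$ be the Yoneda embedding with discrete values, and let $\mathrm{Map}(X,Y)_p=\mathrm{Hom}(X\times\Delta[p],Y)$. Weak equivalences of simplicial sets are those of the Kan--Quillen model structure. An object $W$ of $\mathrm{sPsh}(D)$ is injective fibrant if every map $A\to W$ extends along every monomorphism $A\to B$ that is a levelwise weak equivalence. For a set $S$ of morphisms of $\mathrm{sPsh}(D)$, an object $W$ is $S$-fibrant if it is injective fibrant and $f^*\colon\mathrm{Map}(Y,W)\to\mathrm{Map}(X,W)$ is a weak equivalence for every $f\colon X\to Y$ in $S$; a morphism $g\colon X\to Y$ is an $S$-local equivalence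 if $g^*\colon\mathrm{Map}(Y,W)\to\mathrm{Map}(X,W)$ is a weak equivalence for every $S$-fibrant $W$. Let $S$ be a set of morphisms of $\mathrm{sPsh}(C)$ such that the $S$-local model structure (with the monomorphisms as cofibrations and the $S$-local equivalences as weak equivalences) is Cartesian, that is, for all monomorphisms $A\to B$ and $A'\to B'$ the map $A\times B'\amalg_{A\times A'}B\times A'\to B\times B'$ is a monomorphism, and it is an $S$-local equivalence if one of the two given maps is. Let $V[1]\colon\mathrm{sPsh}(C)\to\mathrm{sPsh}(\Theta C)$ be the suspension functor $$V[1](X)_{[m](c_1,\dots,c_m)}=\coprod_{\delta\colon[m]\to[1]}\ \prod_{1\le i\le m,\ \delta(i-1)<\delta(i)}X_{c_i},$$ and let $\mathrm{se}(S)$ be the set of morphisms of $\mathrm{sPsh}(\Theta C)$ consisting of the Segal maps $$F([1](c_1))\amalg_{F[0]}\cdots\amalg_{F[0]}F([1](c_m))\to F([m](c_1,\dots,c_m))$$ for all $m\ge 0$ and $c_1,\dots,c_m\in C$, and of the maps $V[1](f)$ for $f\in S$. Let $\pi^*E\in\mathrm{sPsh}(\Theta C)$ be given by $(\pi^*E)_{[m](c_1,\dots,c_m),p}=\mathrm{Hom}_{\mathrm{Cat}}([m],I)$,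 where $I$ is the category with two objects $0,1$ and a unique morphism between any two objects, and let $j_0,j_1\colon F[0]\to\pi^*E$ be the two points. Two maps $f,g\colon U\to V$ of $\mathrm{sPsh}(\Theta C)$ are categorically homotopic if there is $H\colon U\times\pi^*E\to V$ that restricts to $f$ along $j_0$ and to $g$ along $j_1$. A map $f\colon U\to V$ is a categorical equivalence (a $\pi^*E$-homotopy equivalence) if there are maps $h,h'\colon V\to U$ such that $hf$ is categorically homotopic to $\mathrm{id}_U$ and $fh'$ is categorically homotopic to $\mathrm{id}_V$. Let $W$ be an $\mathrm{se}(S)$-fibrant object of $\mathrm{sPsh}(\Theta C)$. For $x,y\in W_{[0],0}$, the mapping object $\mathrm{map}_W(x,y)\in\mathrm{sPsh}(C)$ has as its value at $c$ the fiber over $(x,y)$ of the map $W_{[1](c)}\to W_{[0]}\times W_{[0]}$ induced by the source and the target $[0]\to[1](c)$. The homotopy category $\mathrm{ho}(W)$ has the objects $W_{[0],0}$ and the morphisms $\mathrm{Hom}(x,y)=\pi_0(\mathrm{map}_W(x,y)_t)$; the composite of the classes of $f$ and $g$ is the class of the long edge of any element of $W_{[2](t,t),0}$ with the edges $f$ and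 $g$, and the identities are the classes of the degenerate edges. A map $f\colon U\to V$ of $\mathrm{se}(S)$-fibrant objects is a DK-equivalence if the induced functor $\mathrm{ho}(f)\colon\mathrm{ho}(U)\to\mathrm{ho}(V)$ is an equivalence of categories and, for all $x,y\in U_{[0],0}$, the map $\mathrm{map}_U(x,y)\to\mathrm{map}_V(f(x),f(y))$ is a levelwise weak equivalence. Then every categorical equivalence $f\colon U\to V$ between $\mathrm{se}(S)$-fibrant objects $U,V$ of $\mathrm{sPsh}(\Theta C)$ is a DK-equivalence. -/

import Mathlib

open CategoryTheory Simplicial Opposite MonoidalCategory Limits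

universe u

noncomputable section

/-- An object `[m](c₁, …, c_m)` of the category `Θ C`; the label `c_i` (`1 ≤ i ≤ m`) is
`obj (i - 1)`. -/
structure Theta (C : Type u) where
  /-- The length `m`. -/
  len : ℕ
  /-- The labels. -/
  obj : Fin len → C

namespace Theta

/-- For `i : Fin m`, standing for `i + 1 ∈ {1, …, m}`, and `j : Fin l`, standing for
`j + 1 ∈ {1, …, l}`: the condition `φ(i' - 1) < j' ≤ φ(i')` on `i' = i + 1`, `j' = j + 1`. -/
def Covers {m l : ℕ} (φ : Fin (m + 1) →o Fin (l + 1)) (i : Fin m) (j : Fin l) : Prop :=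
  φ i.castSucc < j.succ ∧ j.succ ≤ φ i.succ

lemma Covers.unique {m l : ℕ} {φ : Fin (m + 1) →o Fin (l + 1)} {i i' : Fin m} {j : Fin l}
    (h : Covers φ i j) (h' : Covers φ i' j) : i = i' := by
  rcases lt_trichotomy i i' with hl | hl | hl
  · have : φ i.succ ≤ φ i'.castSucc := φ.monotone (Fin.mk_le_mk.2 (Nat.succ_le_of_lt hl))
    exact absurd (h.2.trans this) (not_le.2 h'.1)
  · exact hl
  · have : φ i'.succ ≤ φ i.castSucc := φ.monotone (Fin.mk_le_mk.2 (Nat.succ_le_of_lt hl))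
    exact absurd (h'.2.trans this) (not_le.2 h.1)

lemma Covers.id_eq {m : ℕ} {i j : Fin m} (h : Covers OrderHom.id i j) : i = j := by
  obtain ⟨h1, h2⟩ := h
  rw [OrderHom.id_coe, id, Fin.lt_def, Fin.val_castSucc, Fin.val_succ] at h1
  rw [OrderHom.id_coe, id, Fin.le_def, Fin.val_succ, Fin.val_succ] at h2
  ext; omega

lemma Covers.id_self {m : ℕ} (i : Fin m) : Covers OrderHom.id i i :=
  ⟨Fin.castSucc_lt_succ, le_rfl⟩

lemma Covers.comp {m l k : ℕ} {φ : Fin (m + 1) →o Fin (l + 1)} {ψ : Fin (l + 1) →o Fin (k + 1)}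
    {i : Fin m} {j : Fin l} {p : Fin k} (h : Covers φ i j) (h' : Covers ψ j p) :
    Covers (ψ.comp φ) i p := by
  refine ⟨lt_of_le_of_lt (ψ.monotone ?_) h'.1, h'.2.trans (ψ.monotone h.2)⟩
  have := h.1
  rw [Fin.lt_def, Fin.val_succ] at this
  rw [Fin.le_def, Fin.val_castSucc]
  omega

lemma Covers.exists_mid {m l k : ℕ} {φ : Fin (m + 1) →o Fin (l + 1)}
    {ψ : Fin (l + 1) →o Fin (k + 1)} {i : Fin m} {p : Fin k} (h : Covers (ψ.comp φ) i p) :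
    ∃ j, Covers φ i j ∧ Covers ψ j p := by
  classical
  obtain ⟨h1, h2⟩ := h
  have hex : ∃ v : ℕ, ∃ hv : v < l + 1, p.succ ≤ ψ ⟨v, hv⟩ := ⟨_, (φ i.succ).2, h2⟩
  obtain ⟨hv, hp⟩ := Nat.find_spec hex
  have hmin : ∀ w (hw : w < l + 1), w < Nat.find hex → ψ ⟨w, hw⟩ < p.succ := fun w hw hlt ↦
    not_le.1 fun hle ↦ Nat.find_min hex hlt ⟨hw, hle⟩
  have hle : Nat.find hex ≤ φ i.succ := Nat.find_min' hex ⟨(φ i.succ).2, h2⟩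
  have hlt : (φ i.castSucc : ℕ) < Nat.find hex := by
    by_contra hc
    have : ψ ⟨Nat.find hex, hv⟩ ≤ ψ (φ i.castSucc) :=
      ψ.monotone (by simpa [Fin.le_def] using not_lt.1 hc)
    exact absurd (hp.trans this) (not_le.2 h1)
  generalize Nat.find hex = v at *
  obtain _ | v := v
  · omega
  exact ⟨⟨v, by omega⟩, ⟨by simpa [Fin.lt_def] using hlt, by simpa [Fin.le_def] using hle⟩,
    ⟨hmin v (by omega) (by omega), hp⟩⟩

lemma Covers.mid_unique {m l k : ℕ} {φ : Fin (m + 1) →o Fin (l + 1)}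
    {ψ : Fin (l + 1) →o Fin (k + 1)} {i : Fin m} {p : Fin k} {j j' : Fin l}
    (_ : Covers φ i j) (h : Covers ψ j p) (_ : Covers φ i j') (h' : Covers ψ j' p) : j = j' :=
  h.unique h'

variable {C : Type u} [SmallCategory C]

/-- A morphism `[m](c₁, …, c_m) ⟶ [l](d₁, …, d_l)` of `Θ C`. -/
structure Hom (a b : Theta C) where
  /-- The underlying morphism `φ : [m] ⟶ [l]` of `Δ`. -/
  base : Fin (a.len + 1) →o Fin (b.len + 1)
  /-- The morphisms `f_{ij} : c_i ⟶ d_j` for `φ(i - 1) < j ≤ φ(i)`. -/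
  comp : ∀ (i : Fin a.len) (j : Fin b.len), Covers base i j → (a.obj i ⟶ b.obj j)

lemma Hom.ext' {a b : Theta C} {f g : Hom a b} (h : f.base = g.base)
    (h' : ∀ i j (hf : Covers f.base i j) (hg : Covers g.base i j),
      f.comp i j hf = g.comp i j hg) : f = g := by
  obtain ⟨fb, fc⟩ := f
  obtain ⟨gb, gc⟩ := g
  obtain rfl : fb = gb := h
  congr
  funext i j hij
  exact h' i j hij hij

instance : CategoryStruct (Theta C) where
  Hom := Hom
  id a :=
    { base := OrderHom.id
      comp := fun _ _ h ↦ eqToHom (congrArg a.obj h.id_eq) }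
  comp f g :=
    { base := g.base.comp f.base
      comp := fun i p h ↦
        f.comp i h.exists_mid.choose h.exists_mid.choose_spec.1 ≫
          g.comp h.exists_mid.choose p h.exists_mid.choose_spec.2 }

@[simp] lemma id_base (a : Theta C) : Hom.base (𝟙 a) = OrderHom.id := rfl

@[simp] lemma comp_base {a b c : Theta C} (f : a ⟶ b) (g : b ⟶ c) :
    Hom.base (f ≫ g) = g.base.comp f.base := rfl

lemma id_comp_self (a : Theta C) (i : Fin a.len) (h : Covers (Hom.base (𝟙 a)) i i) :
    Hom.comp (𝟙 a) i i h = 𝟙 _ := rfl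

lemma comp_comp {a b c : Theta C} (f : a ⟶ b) (g : b ⟶ c) {i : Fin a.len} {j : Fin b.len}
    {p : Fin c.len} (hf : Covers f.base i j) (hg : Covers g.base j p)
    (h : Covers (Hom.base (f ≫ g)) i p) :
    Hom.comp (f ≫ g) i p h = f.comp i j hf ≫ g.comp j p hg := by
  have key : ∀ j' (hf' : Covers f.base i j') (hg' : Covers g.base j' p),
      f.comp i j' hf' ≫ g.comp j' p hg' = f.comp i j hf ≫ g.comp j p hg := by
    intro j' hf' hg'
    obtain rfl := hg'.unique hg
    rfl
  exact key _ _ _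

/-- The category `Θ C`. -/
instance : SmallCategory (Theta C) where
  id_comp {a b} f := by
    refine Hom.ext' rfl fun i j h h' ↦ ?_
    rw [comp_comp (𝟙 a) f (j := i) (Covers.id_self i) h']
    exact Category.id_comp _
  comp_id {a b} f := by
    refine Hom.ext' rfl fun i j h h' ↦ ?_
    rw [comp_comp f (𝟙 b) h' (j := j) (Covers.id_self j)]
    exact Category.comp_id _
  assoc {a b c d} f g k := by
    refine Hom.ext' rfl fun i p h h' ↦ ?_
    obtain ⟨j, hj, hj'⟩ := Covers.exists_mid (φ := (f ≫ g).base) (ψ := k.base) h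
    obtain ⟨l, hl, hl'⟩ := Covers.exists_mid (φ := f.base) (ψ := g.base) hj
    rw [comp_comp (f ≫ g) k hj hj', comp_comp f g hl hl',
      comp_comp f (g ≫ k) hl (Covers.comp hl' hj'), comp_comp g k hl' hj', Category.assoc]

/-- The object `[0]` of `Θ C`. -/
def pt : Theta C := ⟨0, Fin.elim0⟩

/-- The object `[1](c)` of `Θ C`. -/
def one (c : C) : Theta C := ⟨1, fun _ ↦ c⟩

/-- The inclusion `[0] ⟶ [m](c₁, …, c_m)` at the vertex `v ∈ {0, …, m}`. -/
def vertex (a : Theta C) (v : Fin (a.len + 1)) : pt ⟶ a where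
  base := ⟨fun _ ↦ v, fun _ _ _ ↦ le_rfl⟩
  comp i := i.elim0

/-- The inclusion `[1](c_i) ⟶ [m](c₁, …, c_m)` at the vertices `i - 1` and `i`
(with `i` numbered from `0` here, as an element of `Fin m`). -/
def edge (a : Theta C) (i : Fin a.len) : one (a.obj i) ⟶ a where
  base := ⟨![i.castSucc, i.succ], by
    refine (Fin.monotone_iff_le_succ (n := 1)).2 fun k ↦ ?_
    obtain rfl : k = 0 := Subsingleton.elim _ _
    exact Fin.castSucc_lt_succ.le⟩
  comp k j h := eqToHom (congrArg a.obj (by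
    have hk : k = (0 : Fin 1) := Subsingleton.elim (α := Fin 1) _ _
    rw [hk] at h
    exact Covers.id_eq (i := i) h))

lemma pt_hom_ext {a : Theta C} {f g : pt ⟶ a} (h : f.base 0 = g.base 0) : f = g := by
  refine Hom.ext' ?_ (fun i ↦ i.elim0)
  ext x
  obtain rfl : x = 0 := Subsingleton.elim (α := Fin 1) _ _
  rw [h]

/-- The functor `c ↦ [1](c)`. -/
def oneFunctor : C ⥤ Theta C where
  obj := one
  map f :=
    { base := OrderHom.id
      comp := fun _ _ _ ↦ f }
  map_id c := Hom.ext' rfl fun i j _ _ ↦ by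
    obtain rfl : i = j := Subsingleton.elim (α := Fin 1) _ _
    rfl
  map_comp _ _ := rfl

/-- The source `[0] ⟶ [1](c)`. -/
def src (c : C) : pt ⟶ one c := vertex (one c) (0 : Fin 2)

/-- The target `[0] ⟶ [1](c)`. -/
def tgt (c : C) : pt ⟶ one c := vertex (one c) (1 : Fin 2)

lemma src_comp {c d : C} (f : c ⟶ d) : src c ≫ oneFunctor.map f = src d := pt_hom_ext rfl

lemma tgt_comp {c d : C} (f : c ⟶ d) : tgt c ≫ oneFunctor.map f = tgt d := pt_hom_ext rfl

/-- The functor `π : Θ C ⥤ Δ`, `[m](c₁, …, c_m) ↦ [m]`. -/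
def proj : Theta C ⥤ SimplexCategory where
  obj a := ⦋a.len⦌
  map f := SimplexCategory.Hom.mk f.base
  map_id _ := rfl
  map_comp _ _ := rfl

end Theta

/-- Simplicial presheaves on a small category `D`. -/
abbrev SPsh (D : Type u) [SmallCategory D] : Type (u + 1) := Dᵒᵖ ⥤ SSet.{u}

namespace SPsh

/-- Weak equivalences of the Kan–Quillen model structure on simplicial sets. This is the model
structure in which the cofibrations are the monomorphisms and the fibrations are the Kan
fibrations; its acyclic cofibrations are the anodyne extensions, its acyclic fibrations are the
maps with the right lifting property against monomorphisms, and its weak equivalences are the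
composites of the former followed by the latter. -/
def IsWeakEquiv {X Y : SSet.{u}} (f : X ⟶ Y) : Prop :=
  ∃ (Z : SSet.{u}) (i : X ⟶ Z) (q : Z ⟶ Y),
    SSet.anodyneExtensions i ∧ (MorphismProperty.monomorphisms SSet.{u}).rlp q ∧ i ≫ q = f

section

variable {D : Type u} [SmallCategory D]

/-- Levelwise weak equivalences. -/
def IsLevelwiseWeakEquiv {X Y : SPsh D} (f : X ⟶ Y) : Prop :=
  ∀ d : Dᵒᵖ, IsWeakEquiv (f.app d)

/-- Fibrant objects of the injective model structure. -/
def IsInjectiveFibrant (W : SPsh D) : Prop :=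
  ∀ ⦃A B : SPsh D⦄ (i : A ⟶ B), Mono i → IsLevelwiseWeakEquiv i →
    ∀ a : A ⟶ W, ∃ b : B ⟶ W, i ≫ b = a

/-- A simplicial set as a constant simplicial presheaf. -/
abbrev constant (D : Type u) [SmallCategory D] : SSet.{u} ⥤ SPsh D := Functor.const Dᵒᵖ

/-- The constant simplicial presheaves `Δ[p]`. -/
def simplex (D : Type u) [SmallCategory D] : SimplexCategory ⥤ SPsh D :=
  SSet.stdSimplex.{u} ⋙ constant D

/-- The mapping space, `Map(X, Y)_p = Hom(X × Δ[p], Y)`. -/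
def mapSpace (X Y : SPsh D) : SSet.{u} where
  obj p := X ⊗ (simplex D).obj p.unop ⟶ Y
  map α := ↾fun h ↦ X ◁ (simplex D).map α.unop ≫ h
  map_id p := by
    refine ConcreteCategory.hom_ext _ _ fun h ↦ ?_
    change X ◁ (simplex D).map (𝟙 p.unop) ≫ h = h
    simp
  map_comp {p q r} α β := by
    refine ConcreteCategory.hom_ext _ _ fun h ↦ ?_
    change X ◁ (simplex D).map (β.unop ≫ α.unop) ≫ h =
      X ◁ (simplex D).map β.unop ≫
        X ◁ (simplex D).map α.unop ≫ h
    simp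

/-- The map `f^* : Map(Y, W) ⟶ Map(X, W)`. -/
def mapSpacePre {X Y : SPsh D} (f : X ⟶ Y) (W : SPsh D) : mapSpace Y W ⟶ mapSpace X W where
  app p := ↾fun h ↦ f ▷ (simplex D).obj p.unop ≫ h
  naturality _ _ α := by
    refine ConcreteCategory.hom_ext _ _ fun h ↦ ?_
    change f ▷ _ ≫ Y ◁ (simplex D).map α.unop ≫ h =
      X ◁ (simplex D).map α.unop ≫ f ▷ _ ≫ h
    exact (whisker_exchange_assoc f ((simplex D).map α.unop) h).symm

/-- `S`-local objects. -/
def IsLocal (S : MorphismProperty (SPsh D)) (W : SPsh D) : Prop :=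
  ∀ ⦃X Y : SPsh D⦄ (f : X ⟶ Y), S f → IsWeakEquiv (mapSpacePre f W)

/-- `S`-fibrant objects: the injective fibrant objects that are `S`-local. -/
structure IsFibrant (S : MorphismProperty (SPsh D)) (W : SPsh D) : Prop where
  isLocal : IsLocal S W
  isInjectiveFibrant : IsInjectiveFibrant W

/-- `S`-local equivalences. -/
def IsLocalEquiv (S : MorphismProperty (SPsh D)) {X Y : SPsh D} (g : X ⟶ Y) : Prop :=
  ∀ W : SPsh D, IsFibrant S W → IsWeakEquiv (mapSpacePre g W)

/-- The `S`-local model structure (cofibrations: monomorphisms, weak equivalences: `S`-local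
equivalences) is Cartesian: the pushout-product `A × B' ⨿_{A × A'} B × A' ⟶ B × B'` of two
cofibrations is a cofibration, which is acyclic if one of the two is. -/
def IsCartesian (S : MorphismProperty (SPsh D)) : Prop :=
  ∀ ⦃A B A' B' : SPsh D⦄ (f : A ⟶ B) (g : A' ⟶ B'), Mono f → Mono g →
    Mono (pushout.desc (f ▷ B') (B ◁ g) (whisker_exchange f g)) ∧
      (IsLocalEquiv S f ∨ IsLocalEquiv S g →
        IsLocalEquiv S (pushout.desc (f ▷ B') (B ◁ g) (whisker_exchange f g)))

/-- The discrete Yoneda embedding. -/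
def discreteYoneda : D ⥤ SPsh D :=
  yoneda ⋙ (Functor.whiskeringRight _ _ _).obj (SimplicialObject.const (Type u))

end

section

variable {C : Type u} [SmallCategory C]

/-- The `p`-simplices at level `[m](c₁, …, c_m)` of `V[n](X₁, …, X_n)`, that is, the elements of
`∐_{δ : [m] ⟶ [n]} ∏_{1 ≤ i ≤ m} ∏_{δ(i - 1) < j ≤ δ(i)} (X_j)_{c_i, p}`. -/
structure VElt {n : ℕ} (X : Fin n → SPsh C) (a : Theta C) (p : SimplexCategoryᵒᵖ) where
  /-- The index of the summand. -/
  base : Fin (a.len + 1) →o Fin (n + 1)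
  /-- The components of the tuple. -/
  comp : ∀ (i : Fin a.len) (j : Fin n), Theta.Covers base i j →
    ((X j).obj (op (a.obj i))).obj p

namespace VElt

variable {n : ℕ} {X Y : Fin n → SPsh C}

lemma ext' {a : Theta C} {p : SimplexCategoryᵒᵖ} {x y : VElt X a p} (h : x.base = y.base)
    (h' : ∀ i j (hx : Theta.Covers x.base i j) (hy : Theta.Covers y.base i j),
      x.comp i j hx = y.comp i j hy) : x = y := by
  obtain ⟨xb, xc⟩ := x
  obtain ⟨yb, yc⟩ := y
  obtain rfl : xb = yb := h
  congr
  funext i j hij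
  exact h' i j hij hij

/-- Functoriality in the simplicial direction. -/
def opr {a : Theta C} {p q : SimplexCategoryᵒᵖ} (α : p ⟶ q) (x : VElt X a p) : VElt X a q where
  base := x.base
  comp i j h := ((X j).obj (op (a.obj i))).map α (x.comp i j h)

/-- Functoriality in `Θ C`: the same rule as for the composition of morphisms of `Θ C`. -/
def pull {a b : Theta C} {p : SimplexCategoryᵒᵖ} (f : a ⟶ b) (x : VElt X b p) :
    VElt X a p where
  base := x.base.comp f.base
  comp i j h := ((X j).map (f.comp i h.exists_mid.choose h.exists_mid.choose_spec.1).op).app p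
    (x.comp h.exists_mid.choose j h.exists_mid.choose_spec.2)

/-- Functoriality in the presheaves. -/
def push (φ : ∀ j, X j ⟶ Y j) {a : Theta C} {p : SimplexCategoryᵒᵖ} (x : VElt X a p) :
    VElt Y a p where
  base := x.base
  comp i j h := ((φ j).app (op (a.obj i))).app p (x.comp i j h)

lemma pull_comp {a b : Theta C} {p : SimplexCategoryᵒᵖ} (f : a ⟶ b) (x : VElt X b p)
    {i : Fin a.len} {k : Fin b.len} {j : Fin n} (hf : Theta.Covers f.base i k)
    (hx : Theta.Covers x.base k j) (h : Theta.Covers (pull f x).base i j) :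
    (pull f x).comp i j h = ((X j).map (f.comp i k hf).op).app p (x.comp k j hx) := by
  have key : ∀ k' (hf' : Theta.Covers f.base i k') (hx' : Theta.Covers x.base k' j),
      ((X j).map (f.comp i k' hf').op).app p (x.comp k' j hx') =
        ((X j).map (f.comp i k hf).op).app p (x.comp k j hx) := by
    intro k' hf' hx'
    obtain rfl := hx'.unique hx
    rfl
  exact key _ _ _

lemma pull_opr {a b : Theta C} {p q : SimplexCategoryᵒᵖ} (f : a ⟶ b) (α : p ⟶ q)
    (x : VElt X b p) : pull f (opr α x) = opr α (pull f x) := by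
  refine ext' rfl fun i j h h' ↦ ?_
  obtain ⟨k, hk, hk'⟩ := Theta.Covers.exists_mid (φ := f.base) (ψ := x.base) h
  exact (pull_comp f (opr α x) hk hk' h).trans
    ((NatTrans.naturality_apply ((X j).map (f.comp i k hk).op) α (x.comp k j hk')).trans
      (congrArg (((X j).obj (op (a.obj i))).map α) (pull_comp f x hk hk' h').symm))

lemma pull_push (φ : ∀ j, X j ⟶ Y j) {a b : Theta C} {p : SimplexCategoryᵒᵖ} (f : a ⟶ b)
    (x : VElt X b p) : pull f (push φ x) = push φ (pull f x) := by
  refine ext' rfl fun i j h h' ↦ ?_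
  obtain ⟨k, hk, hk'⟩ := Theta.Covers.exists_mid (φ := f.base) (ψ := x.base) h
  exact (pull_comp f (push φ x) hk hk' h).trans
    ((ConcreteCategory.congr_hom (congr_app ((φ j).naturality (f.comp i k hk).op) p)
      (x.comp k j hk')).symm.trans
        (congrArg (((φ j).app (op (a.obj i))).app p) (pull_comp f x hk hk' h').symm))

lemma opr_push (φ : ∀ j, X j ⟶ Y j) {a : Theta C} {p q : SimplexCategoryᵒᵖ} (α : p ⟶ q)
    (x : VElt X a p) : push φ (opr α x) = opr α (push φ x) :=
  ext' rfl fun i j h _ ↦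
    NatTrans.naturality_apply ((φ j).app (op (a.obj i))) α (x.comp i j h)

lemma pull_id (a : Theta C) {p : SimplexCategoryᵒᵖ} (x : VElt X a p) : pull (𝟙 a) x = x := by
  refine ext' rfl fun i j h h' ↦ ?_
  exact (pull_comp (𝟙 a) x (Theta.Covers.id_self i) h' h).trans
    (ConcreteCategory.congr_hom (congr_app ((X j).map_id (op (a.obj i))) p) (x.comp i j h'))

lemma pull_pull {a b c : Theta C} {p : SimplexCategoryᵒᵖ} (f : a ⟶ b) (g : b ⟶ c)
    (x : VElt X c p) : pull (f ≫ g) x = pull f (pull g x) := by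
  refine ext' rfl fun i j h h' ↦ ?_
  obtain ⟨k, hk, hk'⟩ := Theta.Covers.exists_mid (φ := (f ≫ g).base) (ψ := x.base) h
  obtain ⟨l, hl, hl'⟩ := Theta.Covers.exists_mid (φ := f.base) (ψ := g.base) hk
  have e : (f ≫ g).comp i k hk = f.comp i l hl ≫ g.comp l k hl' :=
    Theta.comp_comp f g hl hl' hk
  have e' := ConcreteCategory.congr_hom (congr_app
    ((X j).map_comp (g.comp l k hl').op (f.comp i l hl).op) p) (x.comp k j hk')
  have hg : Theta.Covers (pull g x).base l j := Theta.Covers.comp hl' hk'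
  refine (pull_comp (f ≫ g) x hk hk' h).trans ?_
  rw [e]
  exact e'.trans ((congrArg (((X j).map (f.comp i l hl).op).app p)
    (pull_comp g x hl' hk' hg).symm).trans (pull_comp f (pull g x) hl hg h').symm)

lemma opr_id {a : Theta C} {p : SimplexCategoryᵒᵖ} (x : VElt X a p) : opr (𝟙 p) x = x :=
  ext' rfl fun i j h _ ↦
    ConcreteCategory.congr_hom (((X j).obj (op (a.obj i))).map_id p) (x.comp i j h)

lemma opr_opr {a : Theta C} {p q r : SimplexCategoryᵒᵖ} (α : p ⟶ q) (β : q ⟶ r)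
    (x : VElt X a p) : opr (α ≫ β) x = opr β (opr α x) :=
  ext' rfl fun i j h _ ↦
    ConcreteCategory.congr_hom (((X j).obj (op (a.obj i))).map_comp α β) (x.comp i j h)

end VElt

/-- The simplicial set `V[n](X₁, …, X_n)` at a level. -/
def VLevel {n : ℕ} (X : Fin n → SPsh C) (a : Theta C) : SSet.{u} where
  obj := VElt X a
  map α := ↾VElt.opr α
  map_id _ := ConcreteCategory.hom_ext _ _ fun x ↦ VElt.opr_id x
  map_comp α β := ConcreteCategory.hom_ext _ _ fun x ↦ VElt.opr_opr α β x

/-- The intertwining functor on objects: `V[n](X₁, …, X_n)`. -/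
def V {n : ℕ} (X : Fin n → SPsh C) : SPsh (Theta C) where
  obj a := VLevel X a.unop
  map f :=
    { app _ := ↾VElt.pull f.unop
      naturality _ _ α := ConcreteCategory.hom_ext _ _ fun x ↦ VElt.pull_opr f.unop α x }
  map_id a := SSet.hom_ext fun _ ↦ ConcreteCategory.hom_ext _ _ fun x ↦ VElt.pull_id a.unop x
  map_comp f g := SSet.hom_ext fun _ ↦ ConcreteCategory.hom_ext _ _ fun x ↦
    VElt.pull_pull g.unop f.unop x

/-- The suspension functor `V[1]`. -/
def susp : SPsh C ⥤ SPsh (Theta C) where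
  obj X := V fun _ : Fin 1 ↦ X
  map φ :=
    { app _ :=
        { app _ := ↾VElt.push fun _ ↦ φ
          naturality _ _ α := ConcreteCategory.hom_ext _ _ fun x ↦
            VElt.opr_push (fun _ ↦ φ) α x }
      naturality _ _ f := SSet.hom_ext fun _ ↦ ConcreteCategory.hom_ext _ _ fun x ↦
        (VElt.pull_push (fun _ ↦ φ) f.unop x).symm }
  map_id _ := rfl
  map_comp _ _ := rfl

/-- The shape of the diagram whose colimit is the spine of `[m](c₁, …, c_m)`: the `m + 1` vertices
and the `m` edges, with the two endpoints of each edge glued to the corresponding vertices. -/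
@[simps]
def spineShape (m : ℕ) : MultispanShape where
  L := Fin m × Bool
  R := Fin (m + 1) ⊕ Fin m
  fst l := .inl (if l.2 then l.1.succ else l.1.castSucc)
  snd l := .inr l.1

/-- The diagram whose colimit is the spine of `[m](c₁, …, c_m)`. -/
@[simps]
def spineIndex (a : Theta C) : MultispanIndex (spineShape a.len) (SPsh (Theta C)) where
  left _ := discreteYoneda.obj Theta.pt
  right := Sum.elim (fun _ ↦ discreteYoneda.obj Theta.pt)
    (fun i ↦ discreteYoneda.obj (Theta.one (a.obj i)))
  fst _ := 𝟙 _
  snd l := discreteYoneda.map (if l.2 then Theta.tgt (a.obj l.1) else Theta.src (a.obj l.1))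

/-- `F([1](c₁)) ⨿_{F[0]} ⋯ ⨿_{F[0]} F([1](c_m))` (which is `F[0]` for `m = 0`). -/
noncomputable def spine (a : Theta C) : SPsh (Theta C) := multicoequalizer (spineIndex a)

/-- The maps from the vertices and the edges to `F([m](c₁, …, c_m))`. -/
def segalLeg (a : Theta C) :
    ∀ r : (spineShape a.len).R, (spineIndex a).right r ⟶ discreteYoneda.obj a :=
  fun r ↦ match r with
    | .inl v => discreteYoneda.map (Theta.vertex a v)
    | .inr i => discreteYoneda.map (Theta.edge a i)

lemma segalLeg_condition (a : Theta C) (l : (spineShape a.len).L) :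
    (spineIndex a).fst l ≫ segalLeg a ((spineShape a.len).fst l) =
      (spineIndex a).snd l ≫ segalLeg a ((spineShape a.len).snd l) := by
  obtain ⟨i, b⟩ := l
  have e : Theta.vertex a (if b then i.succ else i.castSucc) =
      (if b then Theta.tgt (a.obj i) else Theta.src (a.obj i)) ≫ Theta.edge a i := by
    apply Theta.pt_hom_ext
    cases b <;> rfl
  refine (Category.id_comp _).trans ((congrArg discreteYoneda.map e).trans ?_)
  exact discreteYoneda.map_comp _ _

/-- The Segal map `F([1](c₁)) ⨿_{F[0]} ⋯ ⨿_{F[0]} F([1](c_m)) ⟶ F([m](c₁, …, c_m))`. -/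
noncomputable def segalMap (a : Theta C) : spine a ⟶ discreteYoneda.obj a :=
  Multicoequalizer.desc (spineIndex a) _ (segalLeg a) (segalLeg_condition a)

/-- The set `Se(S) = Se_C ∪ V[1](S)`. -/
def Se (S : MorphismProperty (SPsh C)) : MorphismProperty (SPsh (Theta C)) :=
  MorphismProperty.ofHoms (fun a : Theta C ↦ segalMap a) ⊔
    MorphismProperty.ofHoms (fun f : S.toSet ↦ susp.map f.1.hom)

/-- `π^* E`, for `E` the discrete nerve of the walking isomorphism. -/
def piE (C : Type u) [SmallCategory C] : SPsh (Theta C) :=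
  Theta.proj.op ⋙ nerve WalkingIso.{u} ⋙ SimplicialObject.const (Type u)

/-- The point of `π^* E` given by an object of the walking isomorphism. -/
def piEPoint (C : Type u) [SmallCategory C] (x : WalkingIso.{u}) : 𝟙_ (SPsh (Theta C)) ⟶ piE C where
  app _ := { app _ := ↾fun _ ↦ (Functor.const _).obj x }

/-- Categorical homotopy, that is, `π^* E`-homotopy: there is `H : U × π^* E ⟶ V` restricting to
`f` and to `g` at the two points of `π^* E`. -/
def CategoricallyHomotopic {U V : SPsh (Theta C)} (f g : U ⟶ V) : Prop :=
  ∃ H : U ⊗ piE C ⟶ V,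
    CartesianMonoidalCategory.lift (𝟙 U)
      (CartesianMonoidalCategory.toUnit U ≫ piEPoint C WalkingIso.zero) ≫ H = f ∧
    CartesianMonoidalCategory.lift (𝟙 U)
      (CartesianMonoidalCategory.toUnit U ≫ piEPoint C WalkingIso.one) ≫ H = g

/-- Categorical equivalences, that is, `π^* E`-homotopy equivalences. -/
def IsCategoricalEquiv {U V : SPsh (Theta C)} (f : U ⟶ V) : Prop :=
  ∃ h h' : V ⟶ U, CategoricallyHomotopic (f ≫ h) (𝟙 U) ∧ CategoricallyHomotopic (h' ≫ f) (𝟙 V)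

/-- The set `W_{a, p}` of `p`-simplices of `W` at level `a`. -/
abbrev Lev (W : SPsh (Theta C)) (a : Theta C) (p : SimplexCategoryᵒᵖ) : Type u :=
  (W.obj (op a)).obj p

/-- The action on `W` of a morphism of `Θ C`. -/
def res {W : SPsh (Theta C)} {a b : Theta C} (f : a ⟶ b) {p : SimplexCategoryᵒᵖ}
    (w : Lev W b p) : Lev W a p := (W.map f.op).app p w

/-- The action on `W` of a simplicial operator. -/
def act {W : SPsh (Theta C)} {a : Theta C} {p q : SimplexCategoryᵒᵖ} (α : p ⟶ q)
    (w : Lev W a p) : Lev W a q := (W.obj (op a)).map α w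

/-- The action on simplices of a morphism of simplicial presheaves. -/
def on {U V : SPsh (Theta C)} (f : U ⟶ V) {a : Theta C} {p : SimplexCategoryᵒᵖ}
    (w : Lev U a p) : Lev V a p := (f.app (op a)).app p w

/-- The set `W_{[0],0}`. -/
abbrev Pt (W : SPsh (Theta C)) : Type u := Lev W Theta.pt (op ⦋0⦌)

/-- The simplex of `W_{[0]}` that is constant at a point. -/
def cst {W : SPsh (Theta C)} (x : Pt W) (p : SimplexCategoryᵒᵖ) : Lev W Theta.pt p :=
  act (SimplexCategory.const p.unop ⦋0⦌ 0).op x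

section

variable {U V W : SPsh (Theta C)} {a b c : Theta C} {p q r : SimplexCategoryᵒᵖ}

lemma res_id (w : Lev W a p) : res (𝟙 a) w = w :=
  ConcreteCategory.congr_hom (congr_app (W.map_id (op a)) p) w

lemma res_res (f : a ⟶ b) (g : b ⟶ c) (w : Lev W c p) : res f (res g w) = res (f ≫ g) w :=
  (ConcreteCategory.congr_hom (congr_app (W.map_comp g.op f.op) p) w).symm

lemma act_id (w : Lev W a p) : act (𝟙 p) w = w :=
  ConcreteCategory.congr_hom ((W.obj (op a)).map_id p) w

lemma act_act (α : p ⟶ q) (β : q ⟶ r) (w : Lev W a p) : act β (act α w) = act (α ≫ β) w :=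
  (ConcreteCategory.congr_hom ((W.obj (op a)).map_comp α β) w).symm

lemma res_act (f : a ⟶ b) (α : p ⟶ q) (w : Lev W b p) : res f (act α w) = act α (res f w) :=
  NatTrans.naturality_apply (W.map f.op) α w

lemma act_cst (α : p ⟶ q) (x : Pt W) : act α (cst x p) = cst x q := act_act _ _ x

lemma cst_zero (x : Pt W) : cst x (op ⦋0⦌) = x := by
  have : (SimplexCategory.const ⦋0⦌ ⦋0⦌ 0) = 𝟙 _ := SimplexCategory.const_eq_id
  exact (congrArg (fun t : ⦋0⦌ ⟶ ⦋0⦌ ↦ act t.op x) this).trans (act_id x)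

lemma on_res (f : U ⟶ V) (g : a ⟶ b) (w : Lev U b p) : on f (res g w) = res g (on f w) :=
  ConcreteCategory.congr_hom (congr_app (f.naturality g.op) p) w

lemma on_act (f : U ⟶ V) (α : p ⟶ q) (w : Lev U a p) : on f (act α w) = act α (on f w) :=
  NatTrans.naturality_apply (f.app (op a)) α w

lemma on_cst (f : U ⟶ V) (x : Pt U) (p : SimplexCategoryᵒᵖ) : on f (cst x p) = cst (on f x) p :=
  on_act f _ x

lemma on_id (w : Lev W a p) : on (𝟙 W) w = w := rfl

lemma on_comp (f : U ⟶ V) (g : V ⟶ W) (w : Lev U a p) : on (f ≫ g) w = on g (on f w) := rfl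

end

/-- The `p`-simplices of the fiber over `(x, y)` of `(d₁, d₀) : W_{[1](c)} ⟶ W_{[0]} × W_{[0]}`,
the restriction along the source and the target `[0] ⟶ [1](c)`. -/
abbrev FiberElt (W : SPsh (Theta C)) (x y : Pt W) (c : C) (p : SimplexCategoryᵒᵖ) : Type u :=
  { w : Lev W (Theta.one c) p //
    res (Theta.src c) w = cst x p ∧ res (Theta.tgt c) w = cst y p }

/-- The value at `c` of the mapping object: the fiber over `(x, y)` of
`(d₁, d₀) : W_{[1](c)} ⟶ W_{[0]} × W_{[0]}`. -/
def mapFiber (W : SPsh (Theta C)) (x y : Pt W) (c : C) : SSet.{u} where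
  obj := FiberElt W x y c
  map {p q} α := ↾fun (w : FiberElt W x y c p) ↦ (⟨act α w.1, by
    rw [res_act, w.2.1, act_cst], by rw [res_act, w.2.2, act_cst]⟩ : FiberElt W x y c q)
  map_id _ := ConcreteCategory.hom_ext _ _ fun w ↦ Subtype.ext (act_id w.1)
  map_comp α β := ConcreteCategory.hom_ext _ _ fun w ↦ Subtype.ext (act_act α β w.1).symm

/-- The mapping object `map_W(x, y)`. -/
def mapObj (W : SPsh (Theta C)) (x y : Pt W) : SPsh C where
  obj c := mapFiber W x y c.unop
  map {c d} f :=
    { app p := ↾fun (w : FiberElt W x y c.unop p) ↦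
        (⟨res (Theta.oneFunctor.map f.unop) w.1, (res_res _ _ w.1).trans
            ((congrArg (fun g ↦ res g w.1) (Theta.src_comp f.unop)).trans w.2.1),
          (res_res _ _ w.1).trans
            ((congrArg (fun g ↦ res g w.1) (Theta.tgt_comp f.unop)).trans w.2.2)⟩ :
          FiberElt W x y d.unop p)
      naturality _ _ α := ConcreteCategory.hom_ext _ _ fun w ↦ Subtype.ext (res_act _ α w.1) }
  map_id c := SSet.hom_ext fun _ ↦ ConcreteCategory.hom_ext _ _ fun w ↦ Subtype.ext <|
    (congrArg (fun g ↦ res g w.1) (Theta.oneFunctor.map_id c.unop)).trans (res_id w.1)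
  map_comp f g := SSet.hom_ext fun _ ↦ ConcreteCategory.hom_ext _ _ fun w ↦ Subtype.ext <|
    (congrArg (fun g ↦ res g w.1) (Theta.oneFunctor.map_comp g.unop f.unop)).trans
      (res_res _ _ w.1).symm

/-- The map `map_U(x, y) ⟶ map_V(f(x), f(y))` induced by `f : U ⟶ V`. -/
def mapObjMap {U V : SPsh (Theta C)} (f : U ⟶ V) (x y : Pt U) :
    mapObj U x y ⟶ mapObj V (on f x) (on f y) where
  app c :=
    { app p := ↾fun (w : FiberElt U x y c.unop p) ↦ (⟨on f w.1, by rw [← on_res, w.2.1, on_cst],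
        by rw [← on_res, w.2.2, on_cst]⟩ : FiberElt V (on f x) (on f y) c.unop p)
      naturality _ _ α := ConcreteCategory.hom_ext _ _ fun w ↦ Subtype.ext (on_act f α w.1) }
  naturality _ _ g := SSet.hom_ext fun _ ↦ ConcreteCategory.hom_ext _ _ fun w ↦
    Subtype.ext (on_res f (Theta.oneFunctor.map g.unop) w.1)


lemma mono_of_anodyne {X Y : SSet.{u}} {i : X ⟶ Y} (hi : SSet.anodyneExtensions i) : Mono i := by
  rw [SSet.anodyneExtensions_eq_retracts_transfiniteCompositionsOfShape] at hi
  refine (?_ : _ ≤ MorphismProperty.monomorphisms SSet.{u}) _ hi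
  refine MorphismProperty.retracts_le_iff.2 ((MorphismProperty.transfiniteCompositionsOfShape_monotone ℕ
    (MorphismProperty.pushouts_le_iff.2 (MorphismProperty.coproducts_le_iff.2 ?_))).trans
      (MorphismProperty.transfiniteCompositionsOfShape_le _ _))
  exact SSet.modelCategoryQuillen.J_le_monomorphisms

lemma isWeakEquiv_of_anodyne {X Y : SSet.{u}} {i : X ⟶ Y} (hi : SSet.anodyneExtensions i) :
    IsWeakEquiv i :=
  ⟨Y, i, 𝟙 Y, hi, MorphismProperty.of_isIso _ _, Category.comp_id i⟩

lemma exists_extension {D : Type u} [SmallCategory D] {W : SPsh D} (hW : IsInjectiveFibrant W)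
    {A F : SPsh D} (j : A ⟶ F) [Mono j] {X Z : SSet.{u}} {i : X ⟶ Z}
    (hi : SSet.anodyneExtensions i) (a : F ⊗ (constant D).obj X ⟶ W)
    (b : A ⊗ (constant D).obj Z ⟶ W)
    (h : j ▷ (constant D).obj X ≫ a = A ◁ (constant D).map i ≫ b) :
    ∃ w : F ⊗ (constant D).obj Z ⟶ W,
      F ◁ (constant D).map i ≫ w = a ∧ j ▷ (constant D).obj Z ≫ w = b := by
  let ι : pushout (j ▷ (constant D).obj X) (A ◁ (constant D).map i) ⟶ F ⊗ (constant D).obj Z :=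
    pushout.desc (F ◁ (constant D).map i) (j ▷ (constant D).obj Z)
      (whisker_exchange j ((constant D).map i)).symm
  have hl : pushout.inl (j ▷ (constant D).obj X) (A ◁ (constant D).map i) ≫ ι = _ :=
    pushout.inl_desc _ _ _
  have hr : pushout.inr (j ▷ (constant D).obj X) (A ◁ (constant D).map i) ≫ ι = _ :=
    pushout.inr_desc _ _ _
  have key (d : Dᵒᵖ) : SSet.anodyneExtensions (ι.app d) := by
    let sq : (curriedTensor SSet.{u}).PushoutObjObj (j.app d) i :=
      { pt := (pushout (j ▷ (constant D).obj X) (A ◁ (constant D).map i)).obj d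
        inl := (pushout.inl (j ▷ (constant D).obj X) (A ◁ (constant D).map i)).app d
        inr := (pushout.inr (j ▷ (constant D).obj X) (A ◁ (constant D).map i)).app d
        isPushout := (IsPushout.of_hasPushout (j ▷ (constant D).obj X)
          (A ◁ (constant D).map i)).map ((evaluation _ _).obj d)
        ι := ι.app d
        inl_ι := congr_app hl d
        inr_ι := congr_app hr d }
    exact SSet.anodyneExtensions_pushoutObjObjι sq hi
  have : ∀ d, Mono (ι.app d) := fun d ↦ mono_of_anodyne (key d)
  obtain ⟨w, hw⟩ := hW ι (NatTrans.mono_of_mono_app ι) (fun d ↦ isWeakEquiv_of_anodyne (key d))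
    (pushout.desc a b h)
  refine ⟨w, ?_, ?_⟩
  · exact ((pushout.inl_desc_assoc _ _ _ w).symm.trans (congrArg _ hw)).trans
      (pushout.inl_desc _ _ _)
  · exact ((pushout.inr_desc_assoc _ _ _ w).symm.trans (congrArg _ hw)).trans
      (pushout.inr_desc _ _ _)

/-- The morphism to `[0]`. -/
def toPt (a : Theta C) : a ⟶ Theta.pt where
  base := ⟨fun _ ↦ 0, fun _ _ _ ↦ le_rfl⟩
  comp _ j := j.elim0

lemma toPt_unique {a : Theta C} (f g : a ⟶ Theta.pt) : f = g :=
  Theta.Hom.ext' (OrderHom.ext _ _ (funext fun _ ↦ Subsingleton.elim (α := Fin 1) _ _))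
    fun _ j ↦ j.elim0

lemma base_eq_const {a b : Theta C} {f : a ⟶ b} {v : Fin (b.len + 1)} (h : ∀ x, f.base x = v) :
    f = toPt a ≫ Theta.vertex b v :=
  Theta.Hom.ext' (OrderHom.ext _ _ (funext h)) fun i j hf _ ↦ by
    obtain ⟨h1, h2⟩ := hf
    rw [h] at h1 h2
    exact absurd h2 (not_le.2 h1)

lemma hom_one_cases {b : Theta C} {c : C} (y : b ⟶ Theta.one c) :
    y = toPt b ≫ Theta.src c ∨ y = toPt b ≫ Theta.tgt c ∨
      (y.base 0 = (0 : Fin 2) ∧ y.base (Fin.last _) = (1 : Fin 2)) := by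
  have h2 : ∀ v : Fin 2, v = 0 ∨ v = 1 := by decide
  rcases h2 (y.base 0) with h0 | h0
  · rcases h2 (y.base (Fin.last _)) with h1 | h1
    · refine .inl (base_eq_const fun x ↦ le_antisymm ?_ (Fin.zero_le _))
      exact (y.base.monotone (Fin.le_last x)).trans_eq h1
    · exact .inr (.inr ⟨h0, h1⟩)
  · refine .inr (.inl (base_eq_const fun x ↦ le_antisymm (Fin.le_last (n := 1) _) ?_))
    exact h0.symm.trans_le (y.base.monotone (Fin.zero_le x))

lemma edge_injective {a b : Theta C} {i : Fin a.len} {y y' : b ⟶ Theta.one (a.obj i)}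
    (h : y ≫ Theta.edge a i = y' ≫ Theta.edge a i) : y = y' := by
  have hb : y.base = y'.base := by
    refine OrderHom.ext _ _ (funext fun x ↦ ?_)
    have hx : (Theta.edge a i).base (y.base x) = (Theta.edge a i).base (y'.base x) :=
      congrArg (fun f : b ⟶ a ↦ f.base x) h
    have h2 : ∀ v w : Fin 2, ![i.castSucc, i.succ] v = ![i.castSucc, i.succ] w → v = w := by
      intro v w
      fin_cases v <;> fin_cases w <;> simp [Fin.ext_iff]
    exact h2 _ _ hx
  refine Theta.Hom.ext' hb fun k j hk hk' ↦ ?_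
  obtain rfl : j = (0 : Fin 1) := Subsingleton.elim (α := Fin 1) _ _
  have hc : Theta.Covers (Theta.edge a i).base (0 : Fin 1) i := Theta.Covers.id_self i
  have e (z : b ⟶ Theta.one (a.obj i)) (hz : Theta.Covers z.base k (0 : Fin 1))
      (hz' : Theta.Covers (Theta.Hom.base (z ≫ Theta.edge a i)) k i) :
      (z ≫ Theta.edge a i).comp k i hz' = z.comp k (0 : Fin 1) hz :=
    (Theta.comp_comp z (Theta.edge a i) hz hc hz').trans (Category.comp_id _)
  have e2 : ∀ (z z' : b ⟶ a) (_ : z = z') (h1 : Theta.Covers z.base k i)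
    (h2 : Theta.Covers z'.base k i), z.comp k i h1 = z'.comp k i h2 := by
    rintro z _ rfl _ _
    rfl
  exact (e y hk (hk.comp hc)).symm.trans ((e2 _ _ h _ _).trans (e y' hk' (hk'.comp hc)))

lemma spine_surj {a b : Theta C} {p : SimplexCategoryᵒᵖ} (x : Lev (spine a) b p) :
    ∃ (r : (spineShape a.len).R) (y : Lev ((spineIndex a).right r) b p),
      on (Multicoequalizer.π (spineIndex a) r) y = x := by
  let E : SPsh (Theta C) ⥤ Type u := (evaluation _ _).obj (op b) ⋙ (evaluation _ _).obj p
  obtain ⟨j, y, hy⟩ := Types.jointly_surjective_of_isColimit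
    (isColimitOfPreserves E (colimit.isColimit (spineIndex a).multispan)) x
  rcases j with l | r
  · refine ⟨_, on ((spineIndex a).fst l) y, Eq.trans ?_ hy⟩
    exact ConcreteCategory.congr_hom (congrArg E.map
      (colimit.w (spineIndex a).multispan (WalkingMultispan.Hom.fst l))) y
  · exact ⟨r, y, hy⟩

lemma spine_glue {a b : Theta C} {p : SimplexCategoryᵒᵖ} (l : (spineShape a.len).L)
    (y : b ⟶ Theta.pt) :
    on (p := p) (Multicoequalizer.π (spineIndex a) (.inl (if l.2 then l.1.succ else l.1.castSucc)))
      y = on (p := p) (Multicoequalizer.π (spineIndex a) (.inr l.1))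
        (y ≫ if l.2 then Theta.tgt (a.obj l.1) else Theta.src (a.obj l.1)) :=
  ConcreteCategory.congr_hom (congr_app (congr_app
    (Multicoequalizer.condition (spineIndex a) l) (op b)) p) y

lemma on_segalMap {a b : Theta C} {p : SimplexCategoryᵒᵖ} (r : (spineShape a.len).R)
    (y : Lev ((spineIndex a).right r) b p) :
    on (segalMap a) (on (Multicoequalizer.π (spineIndex a) r) y) = on (segalLeg a r) y :=
  ConcreteCategory.congr_hom (congr_app (congr_app
    (Multicoequalizer.π_desc (spineIndex a) _ (segalLeg a) (segalLeg_condition a) r) (op b)) p) y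

lemma spine_cases {a b : Theta C} {p : SimplexCategoryᵒᵖ} (x : Lev (spine a) b p) :
    (∃ v : Fin (a.len + 1), on (p := p) (Multicoequalizer.π (spineIndex a) (.inl v)) (toPt b) = x) ∨
      ∃ (i : Fin a.len) (y : b ⟶ Theta.one (a.obj i)), y.base 0 = (0 : Fin 2) ∧
        y.base (Fin.last _) = (1 : Fin 2) ∧
        on (p := p) (Multicoequalizer.π (spineIndex a) (.inr i)) y = x := by
  obtain ⟨v | i, y, hy⟩ := spine_surj x
  · exact .inl ⟨v, (congrArg (on _) (toPt_unique _ _)).trans hy⟩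
  · rcases hom_one_cases (c := a.obj i) y with h | h | ⟨h, h'⟩
    · exact .inl ⟨i.castSucc, (spine_glue (i, false) (toPt b)).trans
        ((congrArg (on _) h.symm).trans hy)⟩
    · exact .inl ⟨i.succ, (spine_glue (i, true) (toPt b)).trans
        ((congrArg (on _) h.symm).trans hy)⟩
    · exact .inr ⟨i, y, h, h', hy⟩

lemma segalMap_injective {a b : Theta C} {p : SimplexCategoryᵒᵖ} {x x' : Lev (spine a) b p}
    (h : on (segalMap a) x = on (segalMap a) x') : x = x' := by
  have base_v (v : Fin (a.len + 1)) (k) : Theta.Hom.base (toPt b ≫ Theta.vertex a v) k = v := rfl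
  rcases spine_cases x with ⟨v, rfl⟩ | ⟨i, y, h0, h1, rfl⟩ <;>
    rcases spine_cases x' with ⟨v', rfl⟩ | ⟨i', y', h0', h1', rfl⟩
  · have e : toPt b ≫ Theta.vertex a v = toPt b ≫ Theta.vertex a v' :=
      (on_segalMap (p := p) (.inl v) (toPt b)).symm.trans (h.trans (on_segalMap _ _))
    obtain rfl : v = v' := congrArg (fun f : b ⟶ a ↦ f.base 0) e
    rfl
  · have e : toPt b ≫ Theta.vertex a v = y' ≫ Theta.edge a i' :=
      (on_segalMap (p := p) (.inl v) (toPt b)).symm.trans (h.trans (on_segalMap _ _))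
    have e0 : v = (Theta.edge a i').base (y'.base 0) := congrArg (fun f : b ⟶ a ↦ f.base 0) e
    have e1 : v = (Theta.edge a i').base (y'.base (Fin.last _)) :=
      congrArg (fun f : b ⟶ a ↦ f.base (Fin.last _)) e
    rw [h0'] at e0
    rw [h1'] at e1
    exact absurd (e0.symm.trans e1) Fin.castSucc_lt_succ.ne
  · have e : y ≫ Theta.edge a i = toPt b ≫ Theta.vertex a v' :=
      (on_segalMap (p := p) (.inr i) y).symm.trans (h.trans (on_segalMap _ _))
    have e0 : (Theta.edge a i).base (y.base 0) = v' := congrArg (fun f : b ⟶ a ↦ f.base 0) e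
    have e1 : (Theta.edge a i).base (y.base (Fin.last _)) = v' :=
      congrArg (fun f : b ⟶ a ↦ f.base (Fin.last _)) e
    rw [h0] at e0
    rw [h1] at e1
    exact absurd (e0.trans e1.symm) Fin.castSucc_lt_succ.ne
  · have e : y ≫ Theta.edge a i = y' ≫ Theta.edge a i' :=
      (on_segalMap (p := p) (.inr i) y).symm.trans (h.trans (on_segalMap _ _))
    have e0 : (Theta.edge a i).base (y.base 0) = (Theta.edge a i').base (y'.base 0) :=
      congrArg (fun f : b ⟶ a ↦ f.base 0) e
    rw [h0, h0'] at e0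
    obtain rfl : i = i' := Fin.castSucc_injective _ e0
    rw [edge_injective e]

instance segalMap_mono (a : Theta C) : Mono (segalMap a) := by
  have : ∀ b p, Mono (((segalMap a).app b).app p) := fun b p ↦
    (mono_iff_injective _).2 fun _ _ h ↦ segalMap_injective h
  have : ∀ b, Mono ((segalMap a).app b) := fun b ↦ NatTrans.mono_of_mono_app _
  exact NatTrans.mono_of_mono_app _

section

variable {D : Type u} [SmallCategory D]

/-- The tautological simplex of `Δ[p]`. -/
def idSimplex (n : SimplexCategory) : (SSet.stdSimplex.{u}.obj n).obj (op n) :=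
  SSet.stdSimplex.objEquiv.symm (𝟙 n)

lemma map_idSimplex {n m : SimplexCategory} (s : (SSet.stdSimplex.{u}.obj n).obj (op m)) :
    (SSet.stdSimplex.obj n).map (SSet.stdSimplex.objEquiv s).op (idSimplex n) = s := by
  apply SSet.stdSimplex.objEquiv.injective
  exact Category.comp_id (SSet.stdSimplex.objEquiv s)

lemma stdSimplex_map_idSimplex {n m : SimplexCategory} (α : m ⟶ n) :
    (SSet.stdSimplex.{u}.map α).app (op m) (idSimplex m) =
      (SSet.stdSimplex.obj n).map α.op (idSimplex n) := by
  apply SSet.stdSimplex.objEquiv.injective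
  exact (Category.id_comp α).trans (Category.comp_id α).symm

/-- The map from a standard simplex classifying a simplex. -/
def yon {Z : SSet.{u}} {p : SimplexCategoryᵒᵖ} (z : Z.obj p) : SSet.stdSimplex.obj p.unop ⟶ Z :=
  (SSet.yonedaEquiv (X := Z) (n := p.unop)).symm z

lemma yon_map {Z : SSet.{u}} {p q : SimplexCategoryᵒᵖ} (α : p ⟶ q) (z : Z.obj p) :
    yon (Z.map α z) = SSet.stdSimplex.map α.unop ≫ yon z :=
  (SSet.yonedaEquiv_symm_naturality_left (X := Z) α.unop z).symm

lemma yon_comp {Y Z : SSet.{u}} (f : Y ⟶ Z) {p : SimplexCategoryᵒᵖ} (y : Y.obj p) :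
    yon (f.app p y) = yon y ≫ f :=
  (SSet.yonedaEquiv_symm_comp (X := Y) (n := p.unop) y f).symm

/-- The simplicial set of maps is a right adjoint: the evaluation map. -/
def ev (X W : SPsh D) : X ⊗ (constant D).obj (mapSpace X W) ⟶ W where
  app d :=
    { app p := ↾fun (z : (X.obj d).obj p × (mapSpace X W).obj p) ↦
        (NatTrans.app (show X ⊗ (simplex D).obj p.unop ⟶ W from z.2) d).app p
          (z.1, idSimplex p.unop)
      naturality p q α := by
        refine ConcreteCategory.hom_ext _ _ fun z ↦ ?_
        obtain ⟨x, h⟩ := (z : (X.obj d).obj p × (mapSpace X W).obj p)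
        let h' : X ⊗ (simplex D).obj p.unop ⟶ W := h
        refine Eq.trans ?_ (NatTrans.naturality_apply (NatTrans.app h' d) α
          ((x, idSimplex p.unop) : (X.obj d).obj p × (SSet.stdSimplex.obj p.unop).obj p))
        exact congrArg (fun s ↦ (NatTrans.app h' d).app q
          (((X.obj d).map α x, s) : (X.obj d).obj q × (SSet.stdSimplex.obj p.unop).obj q))
          (stdSimplex_map_idSimplex α.unop) }
  naturality d e f := SSet.hom_ext fun p ↦ ConcreteCategory.hom_ext _ _ fun z ↦ by
    obtain ⟨x, h⟩ := (z : (X.obj d).obj p × (mapSpace X W).obj p)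
    let h' : X ⊗ (simplex D).obj p.unop ⟶ W := h
    exact ConcreteCategory.congr_hom (congr_app (h'.naturality f) p)
      ((x, idSimplex p.unop) : (X.obj d).obj p × (SSet.stdSimplex.obj p.unop).obj p)

lemma ev_simplex (X W : SPsh D) {p : SimplexCategoryᵒᵖ} (h : (mapSpace X W).obj p) :
    X ◁ (constant D).map (yon h) ≫ ev X W =
      (show X ⊗ (simplex D).obj p.unop ⟶ W from h) := by
  refine NatTrans.ext (funext fun d ↦ SSet.hom_ext fun q ↦ ConcreteCategory.hom_ext _ _ fun z ↦ ?_)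
  obtain ⟨x, s⟩ := (z : (X.obj d).obj q × (SSet.stdSimplex.obj p.unop).obj q)
  let h' : X ⊗ (simplex D).obj p.unop ⟶ W := h
  refine congrArg (fun s' ↦ (NatTrans.app h' d).app q
    ((x, s') : (X.obj d).obj q × (SSet.stdSimplex.obj p.unop).obj q)) ?_
  exact (stdSimplex_map_idSimplex (SSet.stdSimplex.objEquiv s)).trans (map_idSimplex s)

lemma ev_pre {A F : SPsh D} (j : A ⟶ F) (W : SPsh D) :
    j ▷ (constant D).obj (mapSpace F W) ≫ ev F W =
      A ◁ (constant D).map (mapSpacePre j W) ≫ ev A W := rfl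

lemma isTrivialFibration_mapSpacePre {A F : SPsh D} (j : A ⟶ F) [Mono j] {W : SPsh D}
    (hW : IsInjectiveFibrant W) (h : IsWeakEquiv (mapSpacePre j W)) :
    (MorphismProperty.monomorphisms SSet.{u}).rlp (mapSpacePre j W) := by
  obtain ⟨Z, i, q, hi, hq, fac⟩ := h
  obtain ⟨w, hw, hw'⟩ := exists_extension hW j hi (ev F W) (A ◁ (constant D).map q ≫ ev A W) (by
    rw [ev_pre, ← fac, Functor.map_comp, MonoidalCategory.whiskerLeft_comp, Category.assoc])
  let l : Z ⟶ mapSpace F W :=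
    { app p := ↾fun z ↦ F ◁ (constant D).map (yon z) ≫ w
      naturality p q α := ConcreteCategory.hom_ext _ _ fun z ↦ by
        change F ◁ (constant D).map (yon (Z.map α z)) ≫ w =
          F ◁ (constant D).map (SSet.stdSimplex.map α.unop) ≫ F ◁ (constant D).map (yon z) ≫ w
        rw [yon_map, Functor.map_comp, MonoidalCategory.whiskerLeft_comp, Category.assoc] }
  have hil : i ≫ l = 𝟙 _ := SSet.hom_ext fun p ↦ ConcreteCategory.hom_ext _ _ fun h ↦ by
    change F ◁ (constant D).map (yon (i.app p h)) ≫ w = h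
    rw [yon_comp, Functor.map_comp, MonoidalCategory.whiskerLeft_comp, Category.assoc, hw]
    exact ev_simplex F W h
  have hlp : l ≫ mapSpacePre j W = q := SSet.hom_ext fun p ↦ ConcreteCategory.hom_ext _ _ fun z ↦ by
    change j ▷ (constant D).obj (SSet.stdSimplex.obj p.unop) ≫ F ◁ (constant D).map (yon z) ≫ w =
      q.app p z
    rw [← whisker_exchange_assoc, hw', ← Category.assoc, ← MonoidalCategory.whiskerLeft_comp,
      ← Functor.map_comp, ← yon_comp]
    exact ev_simplex A W _
  refine MorphismProperty.of_retract (P := (MorphismProperty.monomorphisms SSet.{u}).rlp)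
    (g := q) ?_ hq
  exact
    { i := Arrow.homMk i (𝟙 _) (fac.trans (Category.comp_id _).symm)
      r := Arrow.homMk l (𝟙 _) (hlp.trans (Category.comp_id _).symm)
      retract := Arrow.hom_ext _ _ hil (Category.comp_id _) }

end

section

variable {E : Type*} [Category* E] [MonoidalCategory E] [BraidedCategory E] [MonoidalClosed E]

/-- Currying. -/
def cur {A K W : E} (h : A ⊗ K ⟶ W) : A ⟶ (ihom K).obj W :=
  MonoidalClosed.curry ((β_ A K).inv ≫ h)

/-- Uncurrying. -/
def uncur {A K W : E} (g : A ⟶ (ihom K).obj W) : A ⊗ K ⟶ W :=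
  (β_ A K).hom ≫ MonoidalClosed.uncurry g

lemma uncur_cur {A K W : E} (h : A ⊗ K ⟶ W) : uncur (cur h) = h := by
  simp [uncur, cur]

lemma uncur_left {A B K W : E} (f : A ⟶ B) (g : B ⟶ (ihom K).obj W) :
    f ▷ K ≫ uncur g = uncur (f ≫ g) := by
  simp [uncur, MonoidalClosed.uncurry_natural_left]

lemma uncur_right {A K W W' : E} (g : A ⟶ (ihom K).obj W) (k : W ⟶ W') :
    uncur g ≫ k = uncur (g ≫ (ihom K).map k) := by
  simp [uncur, MonoidalClosed.uncurry_natural_right]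

lemma cur_left {A B K W : E} (f : A ⟶ B) (h : B ⊗ K ⟶ W) :
    f ≫ cur h = cur (f ▷ K ≫ h) := by
  rw [cur, cur, ← MonoidalClosed.curry_natural_left,
    ← BraidedCategory.braiding_inv_naturality_right_assoc]

lemma cur_right {A K W W' : E} (h : A ⊗ K ⟶ W) (k : W ⟶ W') :
    cur h ≫ (ihom K).map k = cur (h ≫ k) := by
  rw [cur, cur, ← MonoidalClosed.curry_natural_right, Category.assoc]

end

section

variable {D : Type u} [SmallCategory D]

/-- The cotensor of a simplicial presheaf by a simplicial set. -/
def cotensor (K : SSet.{u}) (W : SPsh D) : SPsh D := W ⋙ ihom K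

/-- The map `A × K ⟶ W` corresponding to `A ⟶ W^K`. -/
def ofCotensor {A W : SPsh D} {K : SSet.{u}} (g : A ⟶ cotensor K W) :
    A ⊗ (constant D).obj K ⟶ W where
  app d := uncur (A := A.obj d) (K := K) (W := W.obj d) (g.app d)
  naturality d e f := (uncur_left (K := K) (W := W.obj e) (A.map f) (g.app e)).trans
    ((congrArg (uncur (A := A.obj d) (K := K) (W := W.obj e)) (g.naturality f)).trans
      (uncur_right (A := A.obj d) (K := K) (W := W.obj d) (g.app d) (W.map f)).symm)

/-- The map `A ⟶ W^K` corresponding to `A × K ⟶ W`. -/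
def toCotensor {A W : SPsh D} {K : SSet.{u}} (h : A ⊗ (constant D).obj K ⟶ W) :
    A ⟶ cotensor K W where
  app d := cur (A := A.obj d) (K := K) (W := W.obj d) (h.app d)
  naturality d e f := (cur_left (K := K) (W := W.obj e) (A.map f) (h.app e)).trans
    ((congrArg (cur (A := A.obj d) (K := K) (W := W.obj e)) (h.naturality f)).trans
      (cur_right (A := A.obj d) (K := K) (W := W.obj d) (h.app d) (W.map f)).symm)

lemma ofCotensor_toCotensor {A W : SPsh D} {K : SSet.{u}} (h : A ⊗ (constant D).obj K ⟶ W) :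
    ofCotensor (toCotensor h) = h :=
  NatTrans.ext (funext fun d ↦ uncur_cur (A := A.obj d) (K := K) (W := W.obj d) (h.app d))

lemma toCotensor_injective {A W : SPsh D} {K : SSet.{u}} {h h' : A ⊗ (constant D).obj K ⟶ W}
    (e : toCotensor h = toCotensor h') : h = h' := by
  rw [← ofCotensor_toCotensor h, e, ofCotensor_toCotensor]

lemma whisker_ofCotensor {A B W : SPsh D} {K : SSet.{u}} (f : A ⟶ B) (g : B ⟶ cotensor K W) :
    f ▷ (constant D).obj K ≫ ofCotensor g = ofCotensor (f ≫ g) :=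
  NatTrans.ext (funext fun d ↦ uncur_left (K := K) (W := W.obj d) (f.app d) (g.app d))

lemma comp_toCotensor {A B W : SPsh D} {K : SSet.{u}} (f : A ⟶ B)
    (h : B ⊗ (constant D).obj K ⟶ W) :
    f ≫ toCotensor h = toCotensor (f ▷ (constant D).obj K ≫ h) :=
  NatTrans.ext (funext fun d ↦ cur_left (K := K) (W := W.obj d) (f.app d) (h.app d))

lemma exists_desc {J : MultispanShape.{0, 0}} (I : MultispanIndex J (SPsh D)) {K : SSet.{u}}
    {W : SPsh D} (h : ∀ r, I.right r ⊗ (constant D).obj K ⟶ W)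
    (hc : ∀ l, I.fst l ▷ (constant D).obj K ≫ h (J.fst l) =
      I.snd l ▷ (constant D).obj K ≫ h (J.snd l)) :
    ∃ d : multicoequalizer I ⊗ (constant D).obj K ⟶ W,
      ∀ r, Multicoequalizer.π I r ▷ (constant D).obj K ≫ d = h r := by
  refine ⟨ofCotensor (Multicoequalizer.desc I _ (fun r ↦ toCotensor (h r)) fun l ↦ ?_), fun r ↦ ?_⟩
  · rw [comp_toCotensor, comp_toCotensor, hc]
  · rw [whisker_ofCotensor, Multicoequalizer.π_desc, ofCotensor_toCotensor]

lemma desc_ext {J : MultispanShape.{0, 0}} (I : MultispanIndex J (SPsh D)) {K : SSet.{u}}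
    {W : SPsh D} {h h' : multicoequalizer I ⊗ (constant D).obj K ⟶ W}
    (H : ∀ r, Multicoequalizer.π I r ▷ (constant D).obj K ≫ h =
      Multicoequalizer.π I r ▷ (constant D).obj K ≫ h') : h = h' :=
  toCotensor_injective (Multicoequalizer.hom_ext I _ _ fun r ↦ by
    rw [comp_toCotensor, comp_toCotensor, H])

end

/-- The map `F(a) × Δ[p] ⟶ W` classifying a simplex of `W` at level `a`. -/
def ofLev {W : SPsh (Theta C)} {a : Theta C} {p : SimplexCategoryᵒᵖ} (w : Lev W a p) :
    discreteYoneda.obj a ⊗ (simplex (Theta C)).obj p.unop ⟶ W where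
  app b :=
    { app q := ↾fun (z : (b.unop ⟶ a) × (SSet.stdSimplex.{u}.obj p.unop).obj q) ↦
        (act (SSet.stdSimplex.objEquiv z.2).op (res z.1 w) : Lev W b.unop q)
      naturality q r α := ConcreteCategory.hom_ext _ _ fun z ↦
        (act_act (W := W) (SSet.stdSimplex.objEquiv z.2).op α (res z.1 w)).symm }
  naturality b c f := SSet.hom_ext fun q ↦ ConcreteCategory.hom_ext _ _ fun z ↦ by
    refine Eq.trans ?_ (res_act (W := W) f.unop (SSet.stdSimplex.objEquiv z.2).op (res z.1 w)).symm
    exact congrArg (act (W := W) (SSet.stdSimplex.objEquiv z.2).op)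
      (res_res (W := W) f.unop z.1 w).symm

/-- The simplex classified by a map `F(a) × Δ[p] ⟶ W`. -/
def toLev {W : SPsh (Theta C)} {a : Theta C} {p : SimplexCategoryᵒᵖ}
    (h : discreteYoneda.obj a ⊗ (simplex (Theta C)).obj p.unop ⟶ W) : Lev W a p :=
  (h.app (op a)).app p
    ((𝟙 a, idSimplex p.unop) : (a ⟶ a) × (SSet.stdSimplex.{u}.obj p.unop).obj p)

section

variable {W : SPsh (Theta C)} {a b : Theta C} {p q : SimplexCategoryᵒᵖ}

lemma toLev_ofLev (w : Lev W a p) : toLev (ofLev w) = w := by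
  refine Eq.trans ?_ ((act_id (res (𝟙 a) w)).trans (res_id w))
  exact congrArg (fun t : p.unop ⟶ p.unop ↦ act t.op (res (𝟙 a) w))
    (Equiv.apply_symm_apply SSet.stdSimplex.objEquiv.{u} (𝟙 p.unop))

lemma ofLev_toLev (h : discreteYoneda.obj a ⊗ (simplex (Theta C)).obj p.unop ⟶ W) :
    ofLev (toLev h) = h := by
  refine NatTrans.ext (funext fun b ↦ SSet.hom_ext fun q ↦ ConcreteCategory.hom_ext _ _ fun z ↦ ?_)
  obtain ⟨f, s⟩ := (z : (b.unop ⟶ a) × (SSet.stdSimplex.{u}.obj p.unop).obj q)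
  let z₀ : (a ⟶ a) × (SSet.stdSimplex.{u}.obj p.unop).obj p := (𝟙 a, idSimplex p.unop)
  have h1 := ConcreteCategory.congr_hom (congr_app (h.naturality f.op) p) z₀
  have h2 := NatTrans.naturality_apply (h.app b) (SSet.stdSimplex.objEquiv s).op
    ((f ≫ 𝟙 a, idSimplex p.unop) : (b.unop ⟶ a) × (SSet.stdSimplex.{u}.obj p.unop).obj p)
  refine (congrArg (act (W := W) (SSet.stdSimplex.objEquiv s).op) h1.symm).trans (h2.symm.trans ?_)
  exact congrArg (fun t : (b.unop ⟶ a) × (SSet.stdSimplex.{u}.obj p.unop).obj q ↦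
    (h.app b).app q t) (Prod.ext (Category.comp_id f) (map_idSimplex s))

lemma ofLev_injective {w w' : Lev W a p} (h : ofLev w = ofLev w') : w = w' := by
  rw [← toLev_ofLev w, h, toLev_ofLev]

lemma map_ofLev (f : b ⟶ a) (w : Lev W a p) :
    discreteYoneda.map f ▷ (simplex (Theta C)).obj p.unop ≫ ofLev w = ofLev (res f w) := by
  refine NatTrans.ext (funext fun c ↦ SSet.hom_ext fun q ↦ ConcreteCategory.hom_ext _ _ fun z ↦ ?_)
  obtain ⟨g, s⟩ := (z : (c.unop ⟶ b) × (SSet.stdSimplex.{u}.obj p.unop).obj q)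
  exact congrArg (act (W := W) (SSet.stdSimplex.objEquiv s).op) (res_res g f w).symm

lemma simplex_map_ofLev (α : p ⟶ q) (w : Lev W a p) :
    discreteYoneda.obj a ◁ (simplex (Theta C)).map α.unop ≫ ofLev w = ofLev (act α w) := by
  refine NatTrans.ext (funext fun c ↦ SSet.hom_ext fun r ↦ ConcreteCategory.hom_ext _ _ fun z ↦ ?_)
  obtain ⟨g, s⟩ := (z : (c.unop ⟶ a) × (SSet.stdSimplex.{u}.obj q.unop).obj r)
  refine Eq.trans ?_ ((congrArg (act (W := W) (SSet.stdSimplex.objEquiv s).op)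
    (res_act g α w)).trans (act_act _ _ (res g w))).symm
  rfl

end

/-- A tuple of matching edges in `W`. -/
structure SpineData (W : SPsh (Theta C)) (a : Theta C) (p : SimplexCategoryᵒᵖ) where
  /-- The vertices. -/
  v : Fin (a.len + 1) → Lev W Theta.pt p
  /-- The edges. -/
  e : ∀ i : Fin a.len, Lev W (Theta.one (a.obj i)) p
  src_e : ∀ i, res (Theta.src _) (e i) = v i.castSucc
  tgt_e : ∀ i, res (Theta.tgt _) (e i) = v i.succ

namespace SpineData

variable {W : SPsh (Theta C)} {a : Theta C} {p q : SimplexCategoryᵒᵖ}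

/-- The maps on the vertices and the edges. -/
def leg (s : SpineData W a p) (r : (spineShape a.len).R) :
    (spineIndex a).right r ⊗ (simplex (Theta C)).obj p.unop ⟶ W :=
  match r with
    | .inl v => ofLev (s.v v)
    | .inr i => ofLev (s.e i)

lemma exists_desc (s : SpineData W a p) :
    ∃ d : spine a ⊗ (simplex (Theta C)).obj p.unop ⟶ W,
      ∀ r, Multicoequalizer.π (spineIndex a) r ▷ (simplex (Theta C)).obj p.unop ≫ d = s.leg r :=
  SPsh.exists_desc (spineIndex a) s.leg fun l ↦ by
    obtain ⟨i, b⟩ := l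
    refine Eq.trans (b := ofLev (s.v (if b then i.succ else i.castSucc))) ?_ ?_
    · exact (congrArg (· ≫ _) (MonoidalCategory.id_whiskerRight _ _)).trans (Category.id_comp _)
    refine Eq.trans ?_ (map_ofLev _ (s.e i)).symm
    cases b
    · exact congrArg ofLev (s.src_e i).symm
    · exact congrArg ofLev (s.tgt_e i).symm

/-- The map out of the spine. -/
def desc (s : SpineData W a p) : spine a ⊗ (simplex (Theta C)).obj p.unop ⟶ W :=
  s.exists_desc.choose

lemma leg_desc (s : SpineData W a p) (r : (spineShape a.len).R) :
    Multicoequalizer.π (spineIndex a) r ▷ (simplex (Theta C)).obj p.unop ≫ s.desc = s.leg r :=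
  s.exists_desc.choose_spec r

lemma spine_hom_ext {h h' : spine a ⊗ (simplex (Theta C)).obj p.unop ⟶ W}
    (H : ∀ r, Multicoequalizer.π (spineIndex a) r ▷ (simplex (Theta C)).obj p.unop ≫ h =
      Multicoequalizer.π (spineIndex a) r ▷ (simplex (Theta C)).obj p.unop ≫ h') : h = h' :=
  desc_ext (spineIndex a) H

/-- The edges of a simplex. -/
def IsSpineOf (s : SpineData W a p) (σ : Lev W a p) : Prop :=
  (∀ v, res (Theta.vertex a v) σ = s.v v) ∧ ∀ i, res (Theta.edge a i) σ = s.e i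

lemma π_segalMap (r : (spineShape a.len).R) 
    (h : discreteYoneda.obj a ⊗ (simplex (Theta C)).obj p.unop ⟶ W) :
    Multicoequalizer.π (spineIndex a) r ▷ (simplex (Theta C)).obj p.unop ≫
      segalMap a ▷ (simplex (Theta C)).obj p.unop ≫ h =
        segalLeg a r ▷ (simplex (Theta C)).obj p.unop ≫ h := by
  have e : Multicoequalizer.π (spineIndex a) r ≫ segalMap a = segalLeg a r :=
    Multicoequalizer.π_desc _ _ _ _ r
  exact (Category.assoc _ _ _).symm.trans (congrArg (· ≫ h)
    ((MonoidalCategory.comp_whiskerRight _ _ _).symm.trans (congrArg (· ▷ _) e)))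

lemma isSpineOf_iff (s : SpineData W a p) (σ : Lev W a p) :
    s.IsSpineOf σ ↔ segalMap a ▷ (simplex (Theta C)).obj p.unop ≫ ofLev σ = s.desc := by
  constructor
  · rintro ⟨h, h'⟩
    refine spine_hom_ext fun r ↦ ((π_segalMap r _).trans ?_).trans (s.leg_desc r).symm
    rcases r with v | i
    · exact (map_ofLev _ σ).trans (congrArg ofLev (h v))
    · exact (map_ofLev _ σ).trans (congrArg ofLev (h' i))
  · intro h
    have key (r) : segalLeg a r ▷ (simplex (Theta C)).obj p.unop ≫ ofLev σ = s.leg r :=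
      (π_segalMap r _).symm.trans ((congrArg _ h).trans (s.leg_desc r))
    exact ⟨fun v ↦ ofLev_injective ((map_ofLev _ σ).symm.trans (key (.inl v))),
      fun i ↦ ofLev_injective ((map_ofLev _ σ).symm.trans (key (.inr i)))⟩

/-- Functoriality. -/
def map (α : p ⟶ q) (s : SpineData W a p) : SpineData W a q where
  v i := act α (s.v i)
  e i := act α (s.e i)
  src_e i := (res_act _ _ _).trans (congrArg (act α) (s.src_e i))
  tgt_e i := (res_act _ _ _).trans (congrArg (act α) (s.tgt_e i))

lemma map_desc (α : p ⟶ q) (s : SpineData W a p) :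
    spine a ◁ (simplex (Theta C)).map α.unop ≫ s.desc = (s.map α).desc := by
  refine spine_hom_ext fun r ↦ Eq.trans ?_ ((s.map α).leg_desc r).symm
  refine ((whisker_exchange_assoc _ _ _).symm.trans (congrArg _ (s.leg_desc r))).trans ?_
  rcases r with v | i
  · exact simplex_map_ofLev α (s.v v)
  · exact simplex_map_ofLev α (s.e i)

end SpineData

/-- A constant simplicial set with two points. -/
def twoPoints : SSet.{u} := (Functor.const _).obj (ULift.{u} Bool)

/-- The map from two points classifying two vertices. -/
def twoPointsDesc {X : SSet.{u}} (x : Bool → X.obj (op ⦋0⦌)) : twoPoints.{u} ⟶ X where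
  app p := ↾fun (b : ULift.{u} Bool) ↦ X.map (SimplexCategory.const p.unop ⦋0⦌ 0).op (x b.down)
  naturality p _ α := ConcreteCategory.hom_ext _ _ fun b ↦
    ConcreteCategory.congr_hom (X.map_comp (SimplexCategory.const p.unop ⦋0⦌ 0).op α)
      (x (b : ULift.{u} Bool).down)

/-- The two vertices of `Δ[1]`. -/
def endpoint (b : Bool) : ⦋0⦌ ⟶ ⦋1⦌ := SimplexCategory.const ⦋0⦌ ⦋1⦌ (if b then 1 else 0)

lemma twoPoints_mono : Mono (twoPointsDesc (X := SSet.stdSimplex.{u}.obj ⦋1⦌)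
    fun b ↦ SSet.stdSimplex.objEquiv.symm (endpoint b)) := by
  have (p : SimplexCategoryᵒᵖ) : Mono ((twoPointsDesc (X := SSet.stdSimplex.{u}.obj ⦋1⦌)
      fun b ↦ SSet.stdSimplex.objEquiv.symm (endpoint b)).app p) := by
    refine (mono_iff_injective _).2 fun b b' h ↦ ?_
    have h2 := congrArg (fun s ↦ (SSet.stdSimplex.objEquiv (n := ⦋1⦌) (m := p) s).toOrderHom 0) h
    change (if (b : ULift.{u} Bool).down then (1 : Fin 2) else 0) =
      (if (b' : ULift.{u} Bool).down then (1 : Fin 2) else 0) at h2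
    obtain ⟨b⟩ := (b : ULift.{u} Bool)
    obtain ⟨b'⟩ := (b' : ULift.{u} Bool)
    rcases b <;> rcases b'
    · rfl
    · exact absurd h2 (by decide)
    · exact absurd h2 (by decide)
    · rfl
  exact NatTrans.mono_of_mono_app _

lemma yon_idSimplex {Z : SSet.{u}} {p : SimplexCategoryᵒᵖ} (z : Z.obj p) :
    (yon z).app p (idSimplex p.unop) = z :=
  ConcreteCategory.congr_hom (Z.map_id p) z

lemma exists_lift_of_mono {X Y K L : SSet.{u}} {q : X ⟶ Y}
    (hq : (MorphismProperty.monomorphisms SSet.{u}).rlp q) (i : K ⟶ L) [Mono i] (f : K ⟶ X)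
    (g : L ⟶ Y) (h : f ≫ q = i ≫ g) : ∃ l : L ⟶ X, i ≫ l = f ∧ l ≫ q = g := by
  have sq : CommSq f i q g := ⟨h⟩
  have := hq i (MorphismProperty.monomorphisms.infer_property i)
  exact ⟨sq.lift, sq.fac_left, sq.fac_right⟩

lemma surjective_of_rlp {X Y : SSet.{u}} {q : X ⟶ Y}
    (hq : (MorphismProperty.monomorphisms SSet.{u}).rlp q) {p : SimplexCategoryᵒᵖ} (y : Y.obj p) :
    ∃ x, q.app p x = y := by
  let K : SSet.{u} := (Functor.const _).obj PEmpty.{u + 1}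
  let i : K ⟶ SSet.stdSimplex.obj p.unop := { app _ := ↾fun z : PEmpty.{u + 1} ↦ z.elim }
  let f : K ⟶ X := { app _ := ↾fun z : PEmpty.{u + 1} ↦ z.elim }
  have : ∀ r, Mono (i.app r) := fun r ↦
    (mono_iff_injective _).2 fun z ↦ PEmpty.elim (z : PEmpty.{u + 1})
  have : Mono i := NatTrans.mono_of_mono_app _
  obtain ⟨l, -, hl⟩ := exists_lift_of_mono hq i f (yon y)
    (SSet.hom_ext fun r ↦ ConcreteCategory.hom_ext _ _ fun z ↦ PEmpty.elim (z : PEmpty.{u + 1}))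
  refine ⟨l.app p (idSimplex p.unop), ?_⟩
  exact (ConcreteCategory.congr_hom (congr_app hl p) (idSimplex p.unop)).trans (yon_idSimplex y)

lemma path_lift_of_rlp {X Y : SSet.{u}} {q : X ⟶ Y}
    (hq : (MorphismProperty.monomorphisms SSet.{u}).rlp q) (y : Y.obj (op ⦋1⦌))
    (x : Bool → X.obj (op ⦋0⦌)) (h : ∀ b, q.app _ (x b) = Y.map (endpoint b).op y) :
    ∃ z : X.obj (op ⦋1⦌), q.app _ z = y ∧ ∀ b, X.map (endpoint b).op z = x b := by
  have := twoPoints_mono.{u}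
  obtain ⟨l, hl, hl'⟩ := exists_lift_of_mono hq (twoPointsDesc (X := SSet.stdSimplex.{u}.obj ⦋1⦌)
    fun b ↦ SSet.stdSimplex.objEquiv.symm (endpoint b)) (twoPointsDesc x) (yon y)
    (SSet.hom_ext fun p ↦ ConcreteCategory.hom_ext _ _ fun b ↦
      (NatTrans.naturality_apply q (SimplexCategory.const p.unop ⦋0⦌ 0).op
        (x (b : ULift.{u} Bool).down)).trans
      ((congrArg (Y.map (SimplexCategory.const p.unop ⦋0⦌ 0).op)
        (h (b : ULift.{u} Bool).down)).trans (ConcreteCategory.congr_hom (Y.map_comp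
          (endpoint (b : ULift.{u} Bool).down).op (SimplexCategory.const p.unop ⦋0⦌ 0).op)
            y).symm))
  refine ⟨l.app _ (idSimplex ⦋1⦌), (ConcreteCategory.congr_hom (congr_app hl' _)
    (idSimplex ⦋1⦌)).trans (yon_idSimplex y), fun b ↦ ?_⟩
  have e : SimplexCategory.const ⦋0⦌ ⦋0⦌ 0 = 𝟙 _ := SimplexCategory.const_eq_id
  have e' (Z : SSet.{u}) (z : Z.obj (op ⦋0⦌)) :
      Z.map (SimplexCategory.const ⦋0⦌ ⦋0⦌ 0).op z = z :=
    (congrArg (fun t : ⦋0⦌ ⟶ ⦋0⦌ ↦ Z.map t.op z) e).trans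
      (ConcreteCategory.congr_hom (Z.map_id _) z)
  let b' : ULift.{u} Bool := ⟨b⟩
  have h1 := ConcreteCategory.congr_hom (congr_app hl (op ⦋0⦌)) b'
  refine Eq.trans ?_ (h1.trans (e' X (x b)))
  refine (NatTrans.naturality_apply l (endpoint b).op (idSimplex ⦋1⦌)).symm.trans
    (congrArg (l.app (op ⦋0⦌)) ?_)
  refine Eq.trans ?_ (e' _ (SSet.stdSimplex.objEquiv.symm (endpoint b))).symm
  apply SSet.stdSimplex.objEquiv.injective
  exact Category.comp_id (endpoint b)

/-- The restriction of a simplex along a vertex of `Δ[1]`. -/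
abbrev endAt {W : SPsh (Theta C)} {a : Theta C} (b : Bool) (w : Lev W a (op ⦋1⦌)) :
    Lev W a (op ⦋0⦌) := act (endpoint b).op w

section

variable {S : MorphismProperty (SPsh C)} {W : SPsh (Theta C)} {a : Theta C}

lemma segal_rlp (hW : IsFibrant (Se S) W) (a : Theta C) :
    (MorphismProperty.monomorphisms SSet.{u}).rlp (mapSpacePre (segalMap a) W) :=
  isTrivialFibration_mapSpacePre (segalMap a) hW.isInjectiveFibrant
    (hW.isLocal (segalMap a) (Or.inl ⟨a⟩))

lemma exists_filler (hW : IsFibrant (Se S) W) {p : SimplexCategoryᵒᵖ} (s : SpineData W a p) :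
    ∃ σ : Lev W a p, s.IsSpineOf σ := by
  obtain ⟨h, hh⟩ := surjective_of_rlp (segal_rlp hW a) (p := p) s.desc
  exact ⟨toLev h, (s.isSpineOf_iff _).2 ((congrArg _ (ofLev_toLev h)).trans hh)⟩

lemma exists_path_filler (hW : IsFibrant (Se S) W) (s : SpineData W a (op ⦋1⦌))
    (σ : Bool → Lev W a (op ⦋0⦌)) (h : ∀ b, (s.map (endpoint b).op).IsSpineOf (σ b)) :
    ∃ τ : Lev W a (op ⦋1⦌), s.IsSpineOf τ ∧ ∀ b, endAt b τ = σ b := by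
  obtain ⟨z, hz, hz'⟩ := path_lift_of_rlp (segal_rlp hW a) s.desc (fun b ↦ ofLev (σ b))
    fun b ↦ (((s.map (endpoint b).op).isSpineOf_iff (σ b)).1 (h b)).trans
      (s.map_desc (endpoint b).op).symm
  refine ⟨toLev z, (s.isSpineOf_iff _).2 ((congrArg _ (ofLev_toLev z)).trans hz), fun b ↦ ?_⟩
  refine ofLev_injective ((simplex_map_ofLev (endpoint b).op (toLev z)).symm.trans ?_)
  exact (congrArg (_ ≫ ·) (ofLev_toLev z)).trans (hz' b)

end

lemma eq_zero_or_one (k : Fin 2) : k = 0 ∨ k = 1 := by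
  revert k
  decide

/-- The object `[n](t, …, t)`. -/
abbrev tau (t : C) (n : ℕ) : Theta C := ⟨n, fun _ ↦ t⟩

/-- The morphism to `[n](t, …, t)` with a given underlying morphism of `Δ`. -/
def toTau {t : C} (ht : IsTerminal t) {a : Theta C} {n : ℕ} (φ : Fin (a.len + 1) →o Fin (n + 1)) : a ⟶ tau t n where
  base := φ
  comp _ _ _ := ht.from _

lemma tau_hom_ext {t : C} (ht : IsTerminal t) {a : Theta C} {n : ℕ} {f g : a ⟶ tau t n} (h : f.base = g.base) : f = g :=
  Theta.Hom.ext' h fun _ _ _ _ ↦ ht.hom_ext _ _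

section

variable {t : C} (ht : IsTerminal t) {W : SPsh (Theta C)} {p q : SimplexCategoryᵒᵖ}

/-- The order preserving map `[1] ⟶ [n]` with values `i ≤ j`. -/
def pair {n : ℕ} {i j : Fin (n + 1)} (h : i ≤ j) : Fin 2 →o Fin (n + 1) :=
  ⟨![i, j], by
    refine (Fin.monotone_iff_le_succ (n := 1)).2 fun k ↦ ?_
    obtain rfl : k = 0 := Subsingleton.elim _ _
    exact h⟩

/-- The order preserving map `[2] ⟶ [n]` with values `i ≤ j ≤ k`. -/
def triple {n : ℕ} {i j k : Fin (n + 1)} (h : i ≤ j) (h' : j ≤ k) : Fin 3 →o Fin (n + 1) :=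
  ⟨![i, j, k], by
    refine (Fin.monotone_iff_le_succ (n := 2)).2 fun l ↦ ?_
    fin_cases l
    · exact h
    · exact h'⟩

/-- The edge from `i` to `j` of a simplex. -/
def ed {n : ℕ} (σ : Lev W (tau t n) p) {i j : Fin (n + 1)} (h : i ≤ j) :
    Lev W (Theta.one t) p :=
  res (toTau ht (a := Theta.one t) (pair h)) σ

/-- The vertex `i` of a simplex. -/
def vtx {n : ℕ} (σ : Lev W (tau t n) p) (i : Fin (n + 1)) : Lev W Theta.pt p :=
  res (Theta.vertex (tau t n) i) σ

lemma src_ed {n : ℕ} (σ : Lev W (tau t n) p) {i j : Fin (n + 1)} (h : i ≤ j) :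
    res (Theta.src t) (ed ht σ h) = vtx σ i :=
  (res_res _ _ σ).trans (congrArg (fun f ↦ res f σ) (Theta.pt_hom_ext rfl))

lemma tgt_ed {n : ℕ} (σ : Lev W (tau t n) p) {i j : Fin (n + 1)} (h : i ≤ j) :
    res (Theta.tgt t) (ed ht σ h) = vtx σ j :=
  (res_res _ _ σ).trans (congrArg (fun f ↦ res f σ) (Theta.pt_hom_ext rfl))

lemma ed_self {n : ℕ} (σ : Lev W (tau t n) p) (i : Fin (n + 1)) :
    ed ht σ (le_refl i) = res (toPt (Theta.one t)) (vtx σ i) := by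
  refine Eq.trans ?_ (res_res _ _ σ).symm
  refine congrArg (fun f ↦ res f σ) (tau_hom_ext ht (OrderHom.ext _ _ (funext fun k ↦ ?_)))
  obtain rfl | rfl : k = (0 : Fin 2) ∨ k = (1 : Fin 2) := eq_zero_or_one k
  · rfl
  · rfl

lemma res_edge {n : ℕ} (σ : Lev W (tau t n) p) (i : Fin n) :
    res (Theta.edge (tau t n) i) σ = ed ht σ (Fin.castSucc_lt_succ (i := i)).le :=
  congrArg (fun f ↦ res f σ) (tau_hom_ext ht rfl)

/-- Restriction along a morphism with a given underlying morphism of `Δ`. -/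
def face {n m : ℕ} (φ : Fin (m + 1) →o Fin (n + 1)) (σ : Lev W (tau t n) p) :
    Lev W (tau t m) p :=
  res (toTau ht (a := tau t m) φ) σ

lemma ed_face {n m : ℕ} (φ : Fin (m + 1) →o Fin (n + 1)) (σ : Lev W (tau t n) p)
    {i j : Fin (m + 1)} (h : i ≤ j) : ed ht (face ht φ σ) h = ed ht σ (φ.monotone h) := by
  refine (res_res _ _ σ).trans ?_
  refine congrArg (fun f ↦ res f σ) (tau_hom_ext ht (OrderHom.ext _ _ (funext fun k ↦ ?_)))
  obtain rfl | rfl : k = (0 : Fin 2) ∨ k = (1 : Fin 2) := eq_zero_or_one k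
  · rfl
  · rfl

lemma vtx_face {n m : ℕ} (φ : Fin (m + 1) →o Fin (n + 1)) (σ : Lev W (tau t n) p)
    (i : Fin (m + 1)) : vtx (face ht φ σ) i = vtx σ (φ i) :=
  (res_res _ _ σ).trans (congrArg (fun f ↦ res f σ) (Theta.pt_hom_ext rfl))

lemma ed_one (w : Lev W (Theta.one t) p) :
    ed ht (n := 1) w (i := 0) (j := 1) (Fin.zero_le _) = w := by
  refine Eq.trans ?_ (res_id w)
  refine congrArg (fun f ↦ res f w) (tau_hom_ext ht (n := 1)
    (OrderHom.ext _ _ (funext fun k ↦ ?_)))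
  obtain rfl | rfl : k = (0 : Fin 2) ∨ k = (1 : Fin 2) := eq_zero_or_one k
  · rfl
  · rfl

lemma act_ed {n : ℕ} (α : p ⟶ q) (σ : Lev W (tau t n) p) {i j : Fin (n + 1)} (h : i ≤ j) :
    act α (ed ht σ h) = ed ht (act α σ) h := (res_act _ α σ).symm

lemma on_ed {U V : SPsh (Theta C)} (f : U ⟶ V) {n : ℕ} (σ : Lev U (tau t n) p)
    {i j : Fin (n + 1)} (h : i ≤ j) : on f (ed ht σ h) = ed ht (on f σ) h := on_res f _ σ

/-- `h` is a composite of `f` and `g` (first `f`, then `g`): the three of them are the edges of a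
`2`-simplex of `W`. -/
def IsComposite (f g h : Lev W (Theta.one t) p) : Prop :=
  ∃ σ : Lev W (tau t 2) p,
    ed ht (i := 0) (j := 1) σ (by decide) = f ∧ ed ht (i := 1) (j := 2) σ (by decide) = g ∧
      ed ht (i := 0) (j := 2) σ (by decide) = h

lemma isComposite_ed {n : ℕ} (σ : Lev W (tau t n) p) {i j k : Fin (n + 1)} (h : i ≤ j)
    (h' : j ≤ k) : IsComposite ht (ed ht σ h) (ed ht σ h') (ed ht σ (h.trans h')) :=
  ⟨face ht (triple h h') σ, ed_face ht (triple h h') σ _, ed_face ht (triple h h') σ _,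
    ed_face ht (triple h h') σ _⟩

lemma vtx_of_ed {x y z : Pt W} {f : FiberElt W x y t p} {g : FiberElt W y z t p}
    {σ : Lev W (tau t 2) p} (hf : ed ht (i := 0) (j := 1) σ (by decide) = f.1)
    (hg : ed ht (i := 1) (j := 2) σ (by decide) = g.1) (v : Fin 3) :
    vtx σ v = cst (![x, y, z] v) p := by
  fin_cases v
  · exact (src_ed ht σ (i := 0) (j := 1) (by decide)).symm.trans ((congrArg _ hf).trans f.2.1)
  · exact (tgt_ed ht σ (i := 0) (j := 1) (by decide)).symm.trans ((congrArg _ hf).trans f.2.2)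
  · exact (tgt_ed ht σ (i := 1) (j := 2) (by decide)).symm.trans ((congrArg _ hg).trans g.2.2)

/-- The long edge of a simplex with given other edges. -/
def longEdge {x y z : Pt W} {f : FiberElt W x y t p} {g : FiberElt W y z t p}
    (σ : Lev W (tau t 2) p) (hf : ed ht (i := 0) (j := 1) σ (by decide) = f.1)
    (hg : ed ht (i := 1) (j := 2) σ (by decide) = g.1) : FiberElt W x z t p :=
  ⟨ed ht (i := 0) (j := 2) σ (by decide),
    (src_ed ht σ _).trans (vtx_of_ed ht hf hg 0), (tgt_ed ht σ _).trans (vtx_of_ed ht hf hg 2)⟩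

/-- Two composable edges. -/
def spineOfPair {x y z : Pt W} (f : FiberElt W x y t p) (g : FiberElt W y z t p) :
    SpineData W (tau t 2) p where
  v v := cst (![x, y, z] v) p
  e := ![f.1, g.1]
  src_e i := by
    fin_cases i
    · exact f.2.1
    · exact g.2.1
  tgt_e i := by
    fin_cases i
    · exact f.2.2
    · exact g.2.2

variable {S : MorphismProperty (SPsh C)}

lemma exists_composite (hW : IsFibrant (Se S) W) {x y z : Pt W} (f : FiberElt W x y t p)
    (g : FiberElt W y z t p) : ∃ h : FiberElt W x z t p, IsComposite ht f.1 g.1 h.1 := by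
  obtain ⟨σ, -, hσ⟩ := exists_filler hW (spineOfPair f g)
  have h0 : ed ht (i := 0) (j := 1) σ (by decide) = f.1 := (res_edge ht σ 0).symm.trans (hσ 0)
  have h1 : ed ht (i := 1) (j := 2) σ (by decide) = g.1 := (res_edge ht σ 1).symm.trans (hσ 1)
  exact ⟨longEdge ht σ h0 h1, σ, h0, h1, rfl⟩

lemma exists_path_composite (hW : IsFibrant (Se S) W) {x y z : Pt W}
    (F : FiberElt W x y t (op ⦋1⦌)) (G : FiberElt W y z t (op ⦋1⦌))
    (h : Bool → Lev W (Theta.one t) (op ⦋0⦌))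
    (hh : ∀ b, IsComposite ht (endAt b F.1) (endAt b G.1) (h b)) :
    ∃ H : FiberElt W x z t (op ⦋1⦌), ∀ b, endAt b H.1 = h b := by
  choose σ hf hg hl using hh
  obtain ⟨τ, ⟨-, hτ⟩, hτ'⟩ := exists_path_filler hW (spineOfPair F G) σ fun b ↦ ⟨fun v ↦
    (vtx_of_ed ht (f := (mapFiber W x y t).map (endpoint b).op F)
      (g := (mapFiber W y z t).map (endpoint b).op G) (hf b) (hg b) v).trans
      (act_cst (endpoint b).op _).symm, fun i ↦ (res_edge ht (σ b) i).trans (by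
        fin_cases i
        · exact hf b
        · exact hg b)⟩
  have h0 : ed ht (i := 0) (j := 1) τ (by decide) = F.1 := (res_edge ht τ 0).symm.trans (hτ 0)
  have h1 : ed ht (i := 1) (j := 2) τ (by decide) = G.1 := (res_edge ht τ 1).symm.trans (hτ 1)
  refine ⟨longEdge ht τ h0 h1, fun b ↦ ?_⟩
  exact (act_ed ht _ τ _).trans ((congrArg (fun s ↦ ed ht (i := 0) (j := 2) s (by decide))
    (hτ' b)).trans (hl b))

end

lemma endpoint_false : endpoint false = SimplexCategory.δ (n := 0) 1 := by
  ext k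
  fin_cases k
  rfl

lemma endpoint_true : endpoint true = SimplexCategory.δ (n := 0) 0 := by
  ext k
  fin_cases k
  rfl

section

variable {t : C} {W : SPsh (Theta C)} {x y z : Pt W}

/-- The hom-sets of the homotopy category, `π₀(map_W(x, y)_t)`. -/
abbrev HoHom (W : SPsh (Theta C)) (t : C) (x y : Pt W) : Type u :=
  SSet.π₀ ((mapObj W x y).obj (op t))

/-- The class of a point of a mapping object. -/
def HoHom.mk (f : FiberElt W x y t (op ⦋0⦌)) : HoHom W t x y :=
  SSet.π₀.mk (X := (mapObj W x y).obj (op t)) f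

lemma HoHom.mk_surjective (f : HoHom W t x y) : ∃ f', HoHom.mk f' = f :=
  SSet.π₀.mk_surjective f

lemma HoHom.sound {f g : FiberElt W x y t (op ⦋0⦌)} (H : FiberElt W x y t (op ⦋1⦌))
    (hf : endAt false H.1 = f.1) (hg : endAt true H.1 = g.1) : HoHom.mk f = HoHom.mk g :=
  SSet.π₀.sound (X := (mapObj W x y).obj (op t)) (SSet.Edge.mk H
    (Subtype.ext ((congrArg (fun α : ⦋0⦌ ⟶ ⦋1⦌ ↦ act α.op H.1) endpoint_false.symm).trans hf))
    (Subtype.ext ((congrArg (fun α : ⦋0⦌ ⟶ ⦋1⦌ ↦ act α.op H.1) endpoint_true.symm).trans hg)))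

lemma exists_path (f g : FiberElt W x y t (op ⦋0⦌))
    (e : SSet.Edge (X := (mapObj W x y).obj (op t)) f g) :
    ∃ H : FiberElt W x y t (op ⦋1⦌), endAt false H.1 = f.1 ∧ endAt true H.1 = g.1 :=
  ⟨e.edge, (congrArg (fun α : ⦋0⦌ ⟶ ⦋1⦌ ↦ act α.op e.edge.1) endpoint_false).trans
      (congrArg Subtype.val e.src_eq),
    (congrArg (fun α : ⦋0⦌ ⟶ ⦋1⦌ ↦ act α.op e.edge.1) endpoint_true).trans
      (congrArg Subtype.val e.tgt_eq)⟩

/-- The constant path at a point of a mapping object. -/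
def constPath (f : FiberElt W x y t (op ⦋0⦌)) : FiberElt W x y t (op ⦋1⦌) :=
  (mapFiber W x y t).map (SimplexCategory.const ⦋1⦌ ⦋0⦌ 0).op f

lemma endAt_constPath (f : FiberElt W x y t (op ⦋0⦌)) (b : Bool) :
    endAt b (constPath f).1 = f.1 := by
  refine (act_act _ _ f.1).trans (Eq.trans ?_ (act_id f.1))
  refine congrArg (fun α : ⦋0⦌ ⟶ ⦋0⦌ ↦ act α.op f.1) ?_
  exact SimplexCategory.Hom.ext _ _ (OrderHom.ext _ _ (funext fun k ↦
    Subsingleton.elim (α := Fin 1) _ _))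

variable (ht : IsTerminal t) {S : MorphismProperty (SPsh C)}

lemma HoHom.mk_eq_of_isComposite (hW : IsFibrant (Se S) W) {f f' : FiberElt W x y t (op ⦋0⦌)}
    {g g' : FiberElt W y z t (op ⦋0⦌)} {h h' : FiberElt W x z t (op ⦋0⦌)}
    (F : FiberElt W x y t (op ⦋1⦌)) (G : FiberElt W y z t (op ⦋1⦌))
    (hF : endAt false F.1 = f.1 ∧ endAt true F.1 = f'.1)
    (hG : endAt false G.1 = g.1 ∧ endAt true G.1 = g'.1)
    (H : IsComposite ht f.1 g.1 h.1) (H' : IsComposite ht f'.1 g'.1 h'.1) :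
    HoHom.mk h = HoHom.mk h' := by
  obtain ⟨K, hK⟩ := exists_path_composite ht hW F G (fun b ↦ if b then h'.1 else h.1) fun b ↦ by
    cases b
    · rw [hF.1, hG.1]
      exact H
    · rw [hF.2, hG.2]
      exact H'
  exact HoHom.sound K (hK false) (hK true)

variable (hW : IsFibrant (Se S) W)

/-- A chosen composite. -/
def composite (f : FiberElt W x y t (op ⦋0⦌)) (g : FiberElt W y z t (op ⦋0⦌)) :
    FiberElt W x z t (op ⦋0⦌) :=
  (exists_composite ht hW f g).choose

lemma isComposite_composite (f : FiberElt W x y t (op ⦋0⦌)) (g : FiberElt W y z t (op ⦋0⦌)) :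
    IsComposite ht f.1 g.1 (composite ht hW f g).1 :=
  (exists_composite ht hW f g).choose_spec

/-- The composition in the homotopy category: `h` is a representative of the composite of the
classes of `f` and `g` if and only if `f`, `g` and some point in the component of `h` are the edges
of a `2`-simplex of `W`. -/
def HoHom.comp (f : HoHom W t x y) (g : HoHom W t y z) : HoHom W t x z :=
  SSet.π₀.lift (fun f : FiberElt W x y t (op ⦋0⦌) ↦
    SSet.π₀.lift (fun g : FiberElt W y z t (op ⦋0⦌) ↦ HoHom.mk (composite ht hW f g))
      (fun g g' e ↦ by
        obtain ⟨G, hG⟩ := exists_path g g' e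
        exact HoHom.mk_eq_of_isComposite ht hW (constPath f) G
          ⟨endAt_constPath f _, endAt_constPath f _⟩ hG (isComposite_composite ht hW f g)
          (isComposite_composite ht hW f g')) g)
    (fun f f' e ↦ by
      obtain ⟨F, hF⟩ := exists_path f f' e
      obtain ⟨g, rfl⟩ := g.mk_surjective
      exact HoHom.mk_eq_of_isComposite ht hW F (constPath g) hF
        ⟨endAt_constPath g _, endAt_constPath g _⟩ (isComposite_composite ht hW f g)
        (isComposite_composite ht hW f' g)) f

lemma HoHom.comp_mk {f : FiberElt W x y t (op ⦋0⦌)} {g : FiberElt W y z t (op ⦋0⦌)}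
    {h : FiberElt W x z t (op ⦋0⦌)} (H : IsComposite ht f.1 g.1 h.1) :
    HoHom.comp ht hW (HoHom.mk f) (HoHom.mk g) = HoHom.mk h :=
  HoHom.mk_eq_of_isComposite ht hW (constPath f) (constPath g)
    ⟨endAt_constPath f _, endAt_constPath f _⟩ ⟨endAt_constPath g _, endAt_constPath g _⟩
    (isComposite_composite ht hW f g) H

/-- The degenerate edge at a point. -/
def idEdge (t : C) (x : Pt W) : FiberElt W x x t (op ⦋0⦌) :=
  ⟨res (toPt (Theta.one t)) x,
    ((res_res _ _ x).trans ((congrArg (fun f ↦ res f x) (toPt_unique _ _)).trans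
      (res_id x))).trans (cst_zero x).symm,
    ((res_res _ _ x).trans ((congrArg (fun f ↦ res f x) (toPt_unique _ _)).trans
      (res_id x))).trans (cst_zero x).symm⟩

lemma isComposite_id (f : FiberElt W x y t (op ⦋0⦌)) :
    IsComposite ht (idEdge t x).1 f.1 f.1 ∧ IsComposite ht f.1 (idEdge t y).1 f.1 := by
  have h0 : ed ht (n := 1) f.1 (le_refl 0) = (idEdge t x).1 :=
    (ed_self ht (n := 1) f.1 0).trans (congrArg _ (f.2.1.trans (cst_zero x)))
  have h1 : ed ht (n := 1) f.1 (le_refl 1) = (idEdge t y).1 :=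
    (ed_self ht (n := 1) f.1 1).trans (congrArg _ (f.2.2.trans (cst_zero y)))
  have h2 := ed_one ht f.1
  constructor
  · have := isComposite_ed ht (n := 1) f.1 (i := 0) (j := 0) (k := 1) le_rfl (Fin.zero_le _)
    rwa [h0, h2] at this
  · have := isComposite_ed ht (n := 1) f.1 (i := 0) (j := 1) (k := 1) (Fin.zero_le _) le_rfl
    rwa [h1, h2] at this

/-- Three composable edges. -/
def spineOfTriple {w x y z : Pt W} (f : FiberElt W w x t (op ⦋0⦌)) (g : FiberElt W x y t (op ⦋0⦌))
    (h : FiberElt W y z t (op ⦋0⦌)) : SpineData W (tau t 3) (op ⦋0⦌) where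
  v v := cst (![w, x, y, z] v) _
  e := ![f.1, g.1, h.1]
  src_e i := by
    fin_cases i
    · exact f.2.1
    · exact g.2.1
    · exact h.2.1
  tgt_e i := by
    fin_cases i
    · exact f.2.2
    · exact g.2.2
    · exact h.2.2

lemma HoHom.assoc {w x y z : Pt W} (f : HoHom W t w x) (g : HoHom W t x y) (h : HoHom W t y z) :
    HoHom.comp ht hW (HoHom.comp ht hW f g) h = HoHom.comp ht hW f (HoHom.comp ht hW g h) := by
  obtain ⟨f, rfl⟩ := f.mk_surjective
  obtain ⟨g, rfl⟩ := g.mk_surjective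
  obtain ⟨h, rfl⟩ := h.mk_surjective
  obtain ⟨σ, hv, hσ⟩ := exists_filler hW (spineOfTriple f g h)
  have e0 : ed ht (i := 0) (j := 1) σ (by decide) = f.1 := (res_edge ht σ 0).symm.trans (hσ 0)
  have e1 : ed ht (i := 1) (j := 2) σ (by decide) = g.1 := (res_edge ht σ 1).symm.trans (hσ 1)
  have e2 : ed ht (i := 2) (j := 3) σ (by decide) = h.1 := (res_edge ht σ 2).symm.trans (hσ 2)
  let fg : FiberElt W w y t (op ⦋0⦌) := ⟨ed ht (i := 0) (j := 2) σ (by decide),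
    (src_ed ht σ _).trans (hv 0), (tgt_ed ht σ _).trans (hv 2)⟩
  let gh : FiberElt W x z t (op ⦋0⦌) := ⟨ed ht (i := 1) (j := 3) σ (by decide),
    (src_ed ht σ _).trans (hv 1), (tgt_ed ht σ _).trans (hv 3)⟩
  let fgh : FiberElt W w z t (op ⦋0⦌) := ⟨ed ht (i := 0) (j := 3) σ (by decide),
    (src_ed ht σ _).trans (hv 0), (tgt_ed ht σ _).trans (hv 3)⟩
  have h1 : IsComposite ht f.1 g.1 fg.1 := by
    have := isComposite_ed ht σ (i := 0) (j := 1) (k := 2) (by decide) (by decide)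
    rwa [e0, e1] at this
  have h2 : IsComposite ht g.1 h.1 gh.1 := by
    have := isComposite_ed ht σ (i := 1) (j := 2) (k := 3) (by decide) (by decide)
    rwa [e1, e2] at this
  have h3 : IsComposite ht fg.1 h.1 fgh.1 := by
    have := isComposite_ed ht σ (i := 0) (j := 2) (k := 3) (by decide) (by decide)
    rwa [e2] at this
  have h4 : IsComposite ht f.1 gh.1 fgh.1 := by
    have := isComposite_ed ht σ (i := 0) (j := 1) (k := 3) (by decide) (by decide)
    rwa [e0] at this
  rw [HoHom.comp_mk ht hW h1, HoHom.comp_mk ht hW h2, HoHom.comp_mk ht hW h3,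
    HoHom.comp_mk ht hW h4]

end

/-- The homotopy category of a `Se(S)`-fibrant object. -/
def Ho {t : C} (_ : IsTerminal t) {S : MorphismProperty (SPsh C)} {W : SPsh (Theta C)}
    (_ : IsFibrant (Se S) W) : Type u :=
  Pt W

section

variable {t : C} (ht : IsTerminal t) {S : MorphismProperty (SPsh C)}

instance {W : SPsh (Theta C)} (hW : IsFibrant (Se S) W) : SmallCategory (Ho ht hW) where
  Hom x y := HoHom W t x y
  id x := HoHom.mk (idEdge t x)
  comp f g := HoHom.comp ht hW f g
  id_comp f := by
    obtain ⟨f, rfl⟩ := HoHom.mk_surjective f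
    exact HoHom.comp_mk ht hW (isComposite_id ht f).1
  comp_id f := by
    obtain ⟨f, rfl⟩ := HoHom.mk_surjective f
    exact HoHom.comp_mk ht hW (isComposite_id ht f).2
  assoc f g h := HoHom.assoc ht hW f g h

/-- The functor induced by a morphism on homotopy categories. -/
def hoMap {U V : SPsh (Theta C)} (hU : IsFibrant (Se S) U) (hV : IsFibrant (Se S) V) (f : U ⟶ V) :
    Ho ht hU ⥤ Ho ht hV where
  obj x := on f (show Pt U from x)
  map {x y} g := SSet.mapπ₀ ((mapObjMap f x y).app (op t)) g
  map_id x := congrArg HoHom.mk (Subtype.ext (on_res f (toPt (Theta.one t)) x))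
  map_comp {x y z} g h := by
    obtain ⟨g, rfl⟩ := HoHom.mk_surjective g
    obtain ⟨h, rfl⟩ := HoHom.mk_surjective h
    obtain ⟨k, hk⟩ := exists_composite ht hU g h
    refine (congrArg (SSet.mapπ₀ ((mapObjMap f x z).app (op t)))
      (HoHom.comp_mk ht hU hk)).trans ?_
    obtain ⟨σ, hg, hh, hl⟩ := hk
    refine (HoHom.comp_mk ht hV
      (f := ((mapObjMap f x y).app (op t)).app _ g) (g := ((mapObjMap f y z).app (op t)).app _ h)
      (h := ((mapObjMap f x z).app (op t)).app _ k) ⟨on f σ, ?_, ?_, ?_⟩).symm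
    · exact (on_ed ht f σ _).symm.trans (congrArg (on f) hg)
    · exact (on_ed ht f σ _).symm.trans (congrArg (on f) hh)
    · exact (on_ed ht f σ _).symm.trans (congrArg (on f) hl)

/-- DK-equivalences. -/
structure IsDKEquiv {U V : SPsh (Theta C)} (hU : IsFibrant (Se S) U) (hV : IsFibrant (Se S) V)
    (f : U ⟶ V) : Prop where
  isEquivalence_hoMap : (hoMap ht hU hV f).IsEquivalence
  isLevelwiseWeakEquiv_mapObjMap (x y : Pt U) : IsLevelwiseWeakEquiv (mapObjMap f x y)

end
end

end SPsh

end

/-! Fix an object `c` of `C` and a simplicial set `K`. Along the diagonal `[n] ↦ [n](c, …, c)`, an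
object `W` gives the simplicial set `familyNerve W c K`, whose `n`-simplices are the maps from `K`
to `W_{[n](c, …, c)}`. If `W` is fibrant, restriction along the Segal maps is a trivial fibration of
mapping spaces. Families of edges between constant vertices therefore compose, uniquely up to
homotopy. This yields a category `FamilyHo c K` whose objects are the points of `W` and whose
morphisms `x ⟶ y` are the homotopy classes of maps from `K` to `map_W(x, y)_c`.

At `[n](c, …, c)` the values of `π^* E` are the `n`-simplices of the nerve of `I`, whatever `c` and
the space direction. A categorical homotopy `U × π^* E ⟶ V` thus induces `familyNerve U × N(I) ⟶
familyNerve V`. The isomorphism `0 ⟶ 1` of `I` goes to an isomorphism at each point, and its product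
with an edge goes to a commutative square: categorically homotopic maps induce isomorphic functors
on `FamilyHo c K` (`FamilyHo.nonempty_map_iso`). So a categorical equivalence induces an equivalence
of categories for all `c` and `K` (`FamilyHo.isEquivalence_map`).

A categorical homotopy may move the points `x` and `y`, so a homotopy inverse of `f` does not
directly give one on mapping objects. Full faithfulness for all `K` replaces it: composition with
`map_U(x, y)_c ⟶ map_V(f x, f y)_c` is bijective on homotopy classes of maps from every `K`, and by
the Yoneda lemma this map is a homotopy equivalence (`exists_homotopyInverse_mapObjMap`). Its source
and target are Kan complexes by injective fibrancy (`kanComplex_mapFiber`), and a homotopy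
equivalence of Kan complexes is a weak equivalence in the sense used here, an anodyne extension
followed by a trivial fibration (`isWeakEquiv_of_homotopyEquiv`).

On homotopy categories, full faithfulness is `π₀` of these homotopy equivalences at `t`. Essential
surjectivity comes from the isomorphism `f (h' y) ≅ y` given by the second categorical homotopy. -/

noncomputable section

namespace SPsh

open HomotopicalAlgebra CartesianMonoidalCategory SSet.modelCategoryQuillen

/-! ### Simplicial homotopies, Kan fibrations, and weak equivalences of Kan complexes. -/

section

variable {A B K L P Q X Y Z : SSet.{u}}

/-- For `i ≠ j` the horn of `Δ[1]` at `i` is just the face `j`, so lifting against this face is a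
horn filling problem with no compatibility condition. -/
lemma anodyne_δ (j : Fin 2) : SSet.anodyneExtensions (SSet.stdSimplex.{u}.δ (n := 0) j) := by
  intro E B p hp
  have : Fibration p := ⟨hp⟩
  refine ⟨fun {f g} sq ↦ ?_⟩
  obtain ⟨i, hi⟩ : ∃ i : Fin 2, ∀ k, k ≠ i → k = j :=
    ⟨j.rev, fun k hk ↦ by revert hk; fin_cases j <;> fin_cases k <;> decide⟩
  have hji : j ≠ i := by
    rintro rfl
    have := hi j.rev (by fin_cases j <;> decide)
    revert this
    fin_cases j <;> decide
  obtain ⟨φ, h, h'⟩ := SSet.horn.IsCompatible.exists_lift (i := i) (f := fun _ _ ↦ f)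
    (by simp) p g (fun k hk ↦ by
      obtain rfl := hi k hk
      exact sq.w)
  exact ⟨⟨⟨φ, h j hji, h'⟩⟩⟩

/-- The pushout-product of a monomorphism and an anodyne extension is anodyne. The maps `a` and `b`
are the two parts of a map out of its source. -/
lemma exists_pushoutProduct_lift {i : A ⟶ B} {j : P ⟶ Q} {q : Z ⟶ Y} [Fibration q]
    (h : (Mono i ∧ SSet.anodyneExtensions j) ∨ (SSet.anodyneExtensions i ∧ Mono j))
    (a : A ⊗ Q ⟶ Z) (b : B ⊗ P ⟶ Z) (c : B ⊗ Q ⟶ Y) (hab : i ▷ P ≫ b = A ◁ j ≫ a)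
    (ha : a ≫ q = i ▷ Q ≫ c) (hb : b ≫ q = B ◁ j ≫ c) :
    ∃ l : B ⊗ Q ⟶ Z, i ▷ Q ≫ l = a ∧ B ◁ j ≫ l = b ∧ l ≫ q = c := by
  let sq := Functor.PushoutObjObj.ofHasPushout (curriedTensor SSet.{u}) i j
  have hl : sq.inl ≫ sq.ι = B ◁ j := sq.inl_ι
  have hr : sq.inr ≫ sq.ι = i ▷ Q := sq.inr_ι
  have an : SSet.anodyneExtensions sq.ι := by
    rcases h with ⟨h, h'⟩ | ⟨h, h'⟩
    · exact SSet.anodyneExtensions_pushoutObjObjι sq h'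
    · exact SSet.anodyneExtensions_pushoutObjObjι' sq h
  have comm : CommSq (sq.isPushout.desc b a hab) sq.ι q c := ⟨by
    apply sq.isPushout.hom_ext
    · rw [IsPushout.inl_desc_assoc, ← Category.assoc, hl, hb]
    · rw [IsPushout.inr_desc_assoc, ← Category.assoc, hr, ha]⟩
  have := an q (HomotopicalAlgebra.mem_fibrations q)
  refine ⟨comm.lift, ?_, ?_, comm.fac_right⟩
  · rw [← hr, Category.assoc, comm.fac_left, IsPushout.inr_desc]
  · rw [← hl, Category.assoc, comm.fac_left, IsPushout.inl_desc]

lemma exists_pushoutProduct_extension [SSet.KanComplex Z] {i : A ⟶ B} {j : P ⟶ Q}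
    (h : (Mono i ∧ SSet.anodyneExtensions j) ∨ (SSet.anodyneExtensions i ∧ Mono j))
    (a : A ⊗ Q ⟶ Z) (b : B ⊗ P ⟶ Z) (hab : i ▷ P ≫ b = A ◁ j ≫ a) :
    ∃ l : B ⊗ Q ⟶ Z, i ▷ Q ≫ l = a ∧ B ◁ j ≫ l = b := by
  obtain ⟨l, h1, h2, -⟩ := exists_pushoutProduct_lift (q := terminal.from Z) h a b
    (terminal.from _) hab (by subsingleton) (by subsingleton)
  exact ⟨l, h1, h2⟩

lemma stdSimplex_one_ext {p : SimplexCategoryᵒᵖ} {s s' : (Δ[1] : SSet.{u}).obj p}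
    (h : ∀ k, (SSet.stdSimplex.objEquiv s).toOrderHom k =
      (SSet.stdSimplex.objEquiv s').toOrderHom k) : s = s' :=
  SSet.stdSimplex.objEquiv.injective (SimplexCategory.Hom.ext _ _ (OrderHom.ext _ _ (funext h)))

/-- The face `δ 1` omits the vertex `1`, so it is the end `ι₀`; the indices are swapped throughout.
-/
lemma whiskerLeft_δ_one (K : SSet.{u}) :
    K ◁ SSet.stdSimplex.δ (n := 0) 1 = fst K _ ≫ SSet.ι₀ := by
  refine SSet.hom_ext fun p ↦ ConcreteCategory.hom_ext _ _ fun z ↦ ?_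
  refine Prod.ext rfl (?_ : (_ : (Δ[1] : SSet.{u}).obj p) = _)
  refine stdSimplex_one_ext fun k ↦ ?_
  change (SimplexCategory.δ (n := 0) 1).toOrderHom
    ((SSet.stdSimplex.objEquiv (show K.obj p × (Δ[0] : SSet.{u}).obj p from z).2).toOrderHom k) = 0
  rw [Subsingleton.elim (α := Fin 1) ((SSet.stdSimplex.objEquiv _).toOrderHom k) 0]
  rfl

lemma whiskerLeft_δ_zero (K : SSet.{u}) :
    K ◁ SSet.stdSimplex.δ (n := 0) 0 = fst K _ ≫ SSet.ι₁ := by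
  refine SSet.hom_ext fun p ↦ ConcreteCategory.hom_ext _ _ fun z ↦ ?_
  refine Prod.ext rfl (?_ : (_ : (Δ[1] : SSet.{u}).obj p) = _)
  refine stdSimplex_one_ext fun k ↦ ?_
  change (SimplexCategory.δ (n := 0) 0).toOrderHom
    ((SSet.stdSimplex.objEquiv (show K.obj p × (Δ[0] : SSet.{u}).obj p from z).2).toOrderHom k) = 1
  rw [Subsingleton.elim (α := Fin 1) ((SSet.stdSimplex.objEquiv _).toOrderHom k) 0]
  rfl

/-- The projection is split by the map to `Δ[0]`. This removes the factor `Δ[0]` that remains when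
ends of a cylinder are written as faces. -/
lemma fst_injective {f g : K ⟶ X} (h : fst K Δ[0] ≫ f = fst K Δ[0] ≫ g) : f = g := by
  have : lift (𝟙 K) (SSet.stdSimplex.isTerminalObj₀.from K) ≫ fst K Δ[0] = 𝟙 K := lift_fst _ _
  rw [← Category.id_comp f, ← Category.id_comp g, ← this, Category.assoc, Category.assoc, h]

/-- The map from `K × {0, 1}` given by two maps. -/
def twoDesc (f : Bool → (K ⟶ X)) : K ⊗ twoPoints.{u} ⟶ X where
  app p := ↾fun (z : K.obj p × ULift.{u} Bool) ↦ (f z.2.down).app p z.1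
  naturality p _ α := ConcreteCategory.hom_ext _ _ fun z ↦
    NatTrans.naturality_apply (f (show K.obj p × ULift.{u} Bool from z).2.down) α
      (show K.obj p × ULift.{u} Bool from z).1

/-- The two inclusions in `K × {0, 1}`. -/
def twoIncl (b : Bool) : K ⟶ K ⊗ twoPoints.{u} where
  app p := ↾fun z ↦ ((z, ⟨b⟩) : K.obj p × ULift.{u} Bool)
  naturality _ _ _ := rfl

lemma twoPoints_hom_ext {f g : K ⊗ twoPoints.{u} ⟶ X} (h : ∀ b, twoIncl b ≫ f = twoIncl b ≫ g) :
    f = g := by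
  refine SSet.hom_ext fun p ↦ ConcreteCategory.hom_ext _ _ fun z ↦ ?_
  exact ConcreteCategory.congr_hom (congr_app (h (show K.obj p × ULift.{u} Bool from z).2.down) p)
    (show K.obj p × ULift.{u} Bool from z).1

/-- The inclusion of the two vertices of `Δ[1]`. -/
abbrev twoι : twoPoints.{u} ⟶ Δ[1] :=
  twoPointsDesc (X := SSet.stdSimplex.{u}.obj ⦋1⦌) fun b ↦ SSet.stdSimplex.objEquiv.symm (endpoint b)

lemma twoIncl_false_twoι : twoIncl false ≫ K ◁ twoι = SSet.ι₀ := by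
  refine SSet.hom_ext fun p ↦ ConcreteCategory.hom_ext _ _ fun z ↦ ?_
  refine Prod.ext rfl (?_ : (_ : (Δ[1] : SSet.{u}).obj p) = _)
  exact stdSimplex_one_ext fun _ ↦ rfl

lemma twoIncl_true_twoι : twoIncl true ≫ K ◁ twoι = SSet.ι₁ := by
  refine SSet.hom_ext fun p ↦ ConcreteCategory.hom_ext _ _ fun z ↦ ?_
  refine Prod.ext rfl (?_ : (_ : (Δ[1] : SSet.{u}).obj p) = _)
  exact stdSimplex_one_ext fun _ ↦ rfl

/-- The homotopy relation on maps of simplicial sets. -/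
def HomotopyRel (f g : K ⟶ X) : Prop := ∃ H : K ⊗ Δ[1] ⟶ X, SSet.ι₀ ≫ H = f ∧ SSet.ι₁ ≫ H = g

lemma HomotopyRel.comp_right {f g : K ⟶ X} (h : HomotopyRel f g) (k : X ⟶ Y) :
    HomotopyRel (f ≫ k) (g ≫ k) := by
  obtain ⟨H, rfl, rfl⟩ := h
  exact ⟨H ≫ k, by simp, by simp⟩

lemma HomotopyRel.comp_left {f g : K ⟶ X} (h : HomotopyRel f g) (k : L ⟶ K) :
    HomotopyRel (k ≫ f) (k ≫ g) := by
  obtain ⟨H, rfl, rfl⟩ := h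
  exact ⟨k ▷ _ ≫ H, by rw [SSet.ι₀_comp_assoc], by rw [SSet.ι₁_comp_assoc]⟩

lemma HomotopyRel.refl (f : K ⟶ X) : HomotopyRel f f :=
  ⟨fst _ _ ≫ f, by simp, by simp⟩

lemma curry_δ (H : K ⊗ Δ[1] ⟶ Z) (k : Fin 2) :
    SSet.stdSimplex.δ (n := 0) k ≫ MonoidalClosed.curry H =
      MonoidalClosed.curry (K ◁ SSet.stdSimplex.δ k ≫ H) :=
  (MonoidalClosed.curry_natural_left _ _).symm

/-- Two homotopies with a common start form a horn of `Δ[2]` at the vertex `0`, with `F` on the edge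
`01` and `G` on the edge `02`. After currying, the horn is filled along the Kan fibration that `q`
induces on internal homs; `H` is the edge `12` of the filler. -/
lemma exists_horn_filler {q : Z ⟶ Y} [Fibration q] (F G : K ⊗ Δ[1] ⟶ Z) (T : K ⊗ Δ[2] ⟶ Y)
    (h : SSet.ι₀ ≫ F = SSet.ι₀ ≫ G) (hF : K ◁ SSet.stdSimplex.δ 2 ≫ T = F ≫ q)
    (hG : K ◁ SSet.stdSimplex.δ 1 ≫ T = G ≫ q) :
    ∃ H : K ⊗ Δ[1] ⟶ Z, SSet.ι₀ ≫ H = SSet.ι₁ ≫ F ∧ SSet.ι₁ ≫ H = SSet.ι₁ ≫ G ∧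
      H ≫ q = K ◁ SSet.stdSimplex.δ 0 ≫ T := by
  -- Since `j ≠ 0`, the second branch is only the face `1`.
  let f : ∀ j : Fin 3, j ≠ 0 → (Δ[1] ⟶ (ihom K).obj Z) := fun j _ ↦
    if j = 2 then MonoidalClosed.curry F else MonoidalClosed.curry G
  have hf : SSet.horn.IsCompatible f := by
    rw [SSet.horn.isCompatible_iff]
    intro j k hj hk hjk
    obtain rfl : j = 1 := by lia
    obtain rfl : k = 2 := by lia
    change SSet.stdSimplex.δ (n := 0) 1 ≫ MonoidalClosed.curry G =
      SSet.stdSimplex.δ (n := 0) 1 ≫ MonoidalClosed.curry F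
    rw [curry_δ, curry_δ, whiskerLeft_δ_one, Category.assoc, Category.assoc, h]
  obtain ⟨φ, h1, h2⟩ := hf.exists_lift ((ihom K).map q) (MonoidalClosed.curry T) (fun j hj ↦ by
    rw [← MonoidalClosed.curry_natural_left]
    obtain rfl | rfl : j = 1 ∨ j = 2 := by lia
    · exact (MonoidalClosed.curry_natural_right _ _).symm.trans (congrArg _ hG.symm)
    · exact (MonoidalClosed.curry_natural_right _ _).symm.trans (congrArg _ hF.symm))
  let t : K ⊗ Δ[2] ⟶ Z := MonoidalClosed.uncurry φ
  have ht : MonoidalClosed.curry t = φ := MonoidalClosed.curry_uncurry φ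
  have t1 : K ◁ SSet.stdSimplex.δ 1 ≫ t = G := MonoidalClosed.curry_injective (by
    rw [MonoidalClosed.curry_natural_left, ht]
    exact h1 1 (by decide))
  have t2 : K ◁ SSet.stdSimplex.δ 2 ≫ t = F := MonoidalClosed.curry_injective (by
    rw [MonoidalClosed.curry_natural_left, ht]
    exact h1 2 (by decide))
  have tq : t ≫ q = T := MonoidalClosed.curry_injective (by
    rw [MonoidalClosed.curry_natural_right, ht, h2])
  have e0 (H : K ⊗ Δ[1] ⟶ Z) : fst K Δ[0] ≫ SSet.ι₀ ≫ H = K ◁ SSet.stdSimplex.δ 1 ≫ H := by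
    rw [whiskerLeft_δ_one, Category.assoc]
  have e1 (H : K ⊗ Δ[1] ⟶ Z) : fst K Δ[0] ≫ SSet.ι₁ ≫ H = K ◁ SSet.stdSimplex.δ 0 ≫ H := by
    rw [whiskerLeft_δ_zero, Category.assoc]
  refine ⟨K ◁ SSet.stdSimplex.δ 0 ≫ t, fst_injective ?_, fst_injective ?_, by rw [Category.assoc, tq]⟩
  · rw [e0, e1, ← t2, ← MonoidalCategory.whiskerLeft_comp_assoc,
      ← MonoidalCategory.whiskerLeft_comp_assoc]
    congr 2
    exact (SSet.stdSimplex.δ_comp_δ (n := 0) (i := 0) (j := 1) (by decide)).symm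
  · rw [e1, e1, ← t1, ← MonoidalCategory.whiskerLeft_comp_assoc,
      ← MonoidalCategory.whiskerLeft_comp_assoc]
    rfl

/-- Horn filling over the terminal object. With reflexivity, this form gives both symmetry and
transitivity. -/
lemma HomotopyRel.euclidean [SSet.KanComplex X] {f g h : K ⟶ X} (hg : HomotopyRel f g)
    (hh : HomotopyRel f h) : HomotopyRel g h := by
  obtain ⟨F, rfl, rfl⟩ := hg
  obtain ⟨G, h, rfl⟩ := hh
  obtain ⟨H, h0, h1, -⟩ := exists_horn_filler (q := terminal.from X) F G (terminal.from _) h.symm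
    (by subsingleton) (by subsingleton)
  exact ⟨H, h0, h1⟩

lemma HomotopyRel.symm [SSet.KanComplex X] {f g : K ⟶ X} (h : HomotopyRel f g) :
    HomotopyRel g f :=
  h.euclidean (.refl f)

lemma HomotopyRel.trans [SSet.KanComplex X] {f g h : K ⟶ X} (hg : HomotopyRel f g)
    (hh : HomotopyRel g h) : HomotopyRel f h :=
  hg.symm.euclidean hh

lemma HomotopyRel.equivalence (K X : SSet.{u}) [SSet.KanComplex X] :
    Equivalence (HomotopyRel (K := K) (X := X)) :=
  ⟨.refl, .symm, .trans⟩

/-- The relative homotopy lifting property: the pushout-product of `i` with the vertex `0` of `Δ[1]`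
is anodyne. -/
lemma exists_homotopy_lift {q : Z ⟶ Y} [Fibration q] {i : A ⟶ B} [Mono i] (a : A ⊗ Δ[1] ⟶ Z)
    (b : B ⟶ Z) (c : B ⊗ Δ[1] ⟶ Y) (hab : i ≫ b = SSet.ι₀ ≫ a) (ha : a ≫ q = i ▷ _ ≫ c)
    (hb : b ≫ q = SSet.ι₀ ≫ c) :
    ∃ l : B ⊗ Δ[1] ⟶ Z, i ▷ _ ≫ l = a ∧ SSet.ι₀ ≫ l = b ∧ l ≫ q = c := by
  obtain ⟨l, h1, h2, h3⟩ := exists_pushoutProduct_lift (q := q) (i := i)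
    (.inl ⟨inferInstance, anodyne_δ 1⟩) a (fst _ _ ≫ b) c
    (by rw [whiskerLeft_δ_one, whiskerRight_fst_assoc, Category.assoc, hab]) ha
    (by rw [whiskerLeft_δ_one, Category.assoc, Category.assoc, hb])
  refine ⟨l, h1, ?_, h3⟩
  rw [whiskerLeft_δ_one, Category.assoc] at h2
  have : lift (𝟙 B) (SSet.stdSimplex.isTerminalObj₀.from B) ≫ fst B Δ[0] = 𝟙 B := lift_fst _ _
  have h4 := congrArg (lift (𝟙 B) (SSet.stdSimplex.isTerminalObj₀.from B) ≫ ·) h2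
  simpa only [← Category.assoc, this, Category.id_comp] using h4

/-- A Kan fibration with a section and a fibrewise homotopy is a trivial fibration. -/
lemma rlp_of_fiberwise_homotopy {q : Z ⟶ Y} [Fibration q] (s : Y ⟶ Z) (hs : s ≫ q = 𝟙 Y)
    (G : Z ⊗ Δ[1] ⟶ Z) (h0 : SSet.ι₀ ≫ G = q ≫ s) (h1 : SSet.ι₁ ≫ G = 𝟙 Z)
    (hG : G ≫ q = fst _ _ ≫ q) : (MorphismProperty.monomorphisms SSet.{u}).rlp q := by
  intro A B i hi
  have : Mono i := hi
  refine ⟨fun {a b} sq ↦ ?_⟩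
  -- The map `b ≫ s` lies over `b` but does not restrict to `a`. On `A`, the homotopy `G` moves it
  -- to `a` within the fibres; lifting the constant homotopy at `b` extends this motion to `B`, and
  -- its end is the required diagonal.
  obtain ⟨l, hl, hl0, hl1⟩ := exists_homotopy_lift (q := q) (i := i) (a ▷ _ ≫ G) (b ≫ s)
    (fst _ _ ≫ b) (by rw [SSet.ι₀_comp_assoc, h0, reassoc_of% sq.w])
    (by rw [Category.assoc, hG, whiskerRight_fst_assoc, whiskerRight_fst_assoc, sq.w])
    (by simp [hs])
  refine ⟨⟨⟨SSet.ι₁ ≫ l, ?_, ?_⟩⟩⟩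
  · rw [← SSet.ι₁_comp_assoc, hl, SSet.ι₁_comp_assoc, h1, Category.comp_id]
  · rw [Category.assoc, hl1, SSet.ι₁_fst_assoc]

lemma exists_cylinder_lift {q : Z ⟶ Y} [Fibration q] (b : B ⟶ Z) (c : B ⊗ Δ[1] ⟶ Y)
    (hb : b ≫ q = SSet.ι₀ ≫ c) : ∃ l : B ⊗ Δ[1] ⟶ Z, SSet.ι₀ ≫ l = b ∧ l ≫ q = c := by
  have comm : CommSq (fst B Δ[0] ≫ b) (B ◁ SSet.stdSimplex.δ 1) q c := ⟨by
    rw [whiskerLeft_δ_one, Category.assoc, Category.assoc, hb]⟩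
  have := (anodyne_δ 1).whiskerLeft B q (HomotopicalAlgebra.mem_fibrations q)
  refine ⟨comm.lift, fst_injective ?_, comm.fac_right⟩
  refine Eq.trans ?_ comm.fac_left
  rw [← Category.assoc, ← whiskerLeft_δ_one]

/-- A homotopy inverse `s` is first moved to a strict section `s'` by lifting the homotopy `s ≫ q ∼
𝟙`. A homotopy `q ≫ s' ∼ 𝟙` is then corrected to a fibrewise one, so that
`rlp_of_fiberwise_homotopy` applies. -/
lemma rlp_of_homotopyEquiv [SSet.KanComplex Z] {q : Z ⟶ Y} [Fibration q] (s : Y ⟶ Z)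
    (hs : HomotopyRel (s ≫ q) (𝟙 Y)) (hq : HomotopyRel (q ≫ s) (𝟙 Z)) :
    (MorphismProperty.monomorphisms SSet.{u}).rlp q := by
  obtain ⟨M, hM0, hM1⟩ := hs
  obtain ⟨N, hN0, hN1⟩ := exists_cylinder_lift (q := q) s M hM0.symm
  have hs' : (SSet.ι₁ ≫ N) ≫ q = 𝟙 Y := by rw [Category.assoc, hN1, hM1]
  have hss' : HomotopyRel s (SSet.ι₁ ≫ N) := ⟨N, hN0, rfl⟩
  generalize SSet.ι₁ ≫ N = s' at hs' hss'
  obtain ⟨R, hR0, hR1⟩ := (hss'.comp_left q).symm.trans hq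
  -- Both `R ≫ q ≫ s'` and `R` start at `q ≫ s'` and cover `R ≫ q`, because `s'` is a section. Over
  -- the degenerate triangle with faces `1` and `2` equal to `R ≫ q`, the face `0` is constant, so
  -- the third side `G` is fibrewise; it runs from `q ≫ s'` to `𝟙 Z`.
  obtain ⟨G, hG0, hG1, hG⟩ := exists_horn_filler (q := q) (R ≫ q ≫ s') R
    (Z ◁ SSet.stdSimplex.σ 1 ≫ R ≫ q) (by
      rw [reassoc_of% hR0, hR0, reassoc_of% hs'])
    (by
      rw [← MonoidalCategory.whiskerLeft_comp_assoc, Category.assoc, Category.assoc, hs',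
        Category.comp_id]
      have : SSet.stdSimplex.δ 2 ≫ SSet.stdSimplex.σ 1 = 𝟙 (Δ[1] : SSet.{u}) :=
        SSet.stdSimplex.δ_comp_σ_succ (i := (1 : Fin 2))
      rw [this, MonoidalCategory.whiskerLeft_id, Category.id_comp])
    (by
      rw [← MonoidalCategory.whiskerLeft_comp_assoc]
      have : SSet.stdSimplex.δ 1 ≫ SSet.stdSimplex.σ 1 = 𝟙 (Δ[1] : SSet.{u}) :=
        SSet.stdSimplex.δ_comp_σ_self (i := (1 : Fin 2))
      rw [this, MonoidalCategory.whiskerLeft_id, Category.id_comp])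
  refine rlp_of_fiberwise_homotopy s' hs' G ?_ (hG1.trans hR1) ?_
  · rw [hG0, reassoc_of% hR1]
  · have : SSet.stdSimplex.δ (n := 1) 0 ≫ SSet.stdSimplex.σ 1 =
        SSet.stdSimplex.σ (n := 0) 0 ≫ SSet.stdSimplex.δ 0 :=
      SSet.stdSimplex.δ_comp_σ_of_le (n := 0) (i := 0) (j := 0) (by decide)
    rw [hG, ← MonoidalCategory.whiskerLeft_comp_assoc, this, MonoidalCategory.whiskerLeft_comp,
      whiskerLeft_δ_zero, Category.assoc, Category.assoc, whiskerLeft_fst_assoc, reassoc_of% hR1]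

/-- The retraction extends the identity of `X` along `i`. The homotopy is an extension along the
pushout-product of `i` with the inclusion of the two ends in `Δ[1]`, constant on `X`. -/
lemma exists_homotopy_retraction {i : X ⟶ Z} (hi : SSet.anodyneExtensions i) [SSet.KanComplex X]
    [SSet.KanComplex Z] : ∃ r : Z ⟶ X, i ≫ r = 𝟙 X ∧ HomotopyRel (r ≫ i) (𝟙 Z) := by
  have := hi (terminal.from X) (HomotopicalAlgebra.mem_fibrations _)
  have comm : CommSq (𝟙 X) i (terminal.from X) (terminal.from Z) := ⟨by subsingleton⟩
  refine ⟨comm.lift, comm.fac_left, ?_⟩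
  have := twoPoints_mono.{u}
  obtain ⟨l, -, hl⟩ := exists_pushoutProduct_extension (i := i) (j := twoι)
    (.inr ⟨hi, this⟩) (fst _ _ ≫ i) (twoDesc fun b ↦ if b then 𝟙 Z else comm.lift ≫ i) (by
      refine twoPoints_hom_ext fun b ↦ ?_
      have h1 : i ≫ (if b then 𝟙 Z else comm.lift ≫ i) = i := by
        cases b
        · exact (Category.assoc _ _ _).symm.trans
            ((congrArg (· ≫ i) comm.fac_left).trans (Category.id_comp i))
        · exact Category.comp_id i
      exact h1)
  refine ⟨l, ?_, ?_⟩
  · rw [← twoIncl_false_twoι, Category.assoc, hl]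
    rfl
  · rw [← twoIncl_true_twoι, Category.assoc, hl]
    rfl

/-- In a factorization `g = i ≫ q` into an anodyne extension and a Kan fibration, `i` is a homotopy
equivalence of Kan complexes. Hence so is `q`, with inverse `g' ≫ i`, and a Kan fibration of this
kind is trivial. -/
lemma isWeakEquiv_of_homotopyEquiv [SSet.KanComplex X] [SSet.KanComplex Y] (g : X ⟶ Y) (g' : Y ⟶ X)
    (h : HomotopyRel (g' ≫ g) (𝟙 Y)) (h' : HomotopyRel (g ≫ g') (𝟙 X)) : IsWeakEquiv g := by
  obtain ⟨Z, i, q, hi, hq, fac⟩ : ∃ (Z : SSet.{u}) (i : X ⟶ Z) (q : Z ⟶ Y),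
      SSet.anodyneExtensions i ∧ J.{u}.rlp q ∧ i ≫ q = g :=
    let F := MorphismProperty.factorizationData J.{u}.rlp.llp J.{u}.rlp g
    ⟨F.Z, F.i, F.p, F.hi, F.hp, F.fac⟩
  have : Fibration q := (fibration_iff _).2 hq
  have : SSet.KanComplex Z := isFibrant_of_fibration q
  obtain ⟨r, hr, hr'⟩ := exists_homotopy_retraction hi
  refine ⟨Z, i, q, hi, rlp_of_homotopyEquiv (g' ≫ i) (by rwa [Category.assoc, fac]) ?_, fac⟩
  -- With `r` a homotopy inverse of `i`, the chain is `q ≫ g' ≫ i ∼ r ≫ i ≫ q ≫ g' ≫ i = r ≫ g ≫ g'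
  -- ≫ i ∼ r ≫ i ∼ 𝟙`.
  have h1 : HomotopyRel (q ≫ g' ≫ i) ((r ≫ i) ≫ q ≫ g' ≫ i) := by
    have := hr'.symm.comp_right (q ≫ g' ≫ i)
    rwa [Category.id_comp] at this
  have h2 : HomotopyRel ((r ≫ i) ≫ q ≫ g' ≫ i) (r ≫ i) := by
    have := (h'.comp_right i).comp_left r
    rw [Category.assoc, ← fac, Category.id_comp] at this
    simpa only [Category.assoc] using this
  exact (h1.trans h2).trans hr'

end

/-! ### Segal lifting in families, and mapping objects as Kan complexes. -/

section

variable {C : Type u} [SmallCategory C] {S : MorphismProperty (SPsh C)} {W : SPsh (Theta C)}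
  {a : Theta C} {A B K : SSet.{u}}

lemma ofLev_act {p q : SimplexCategoryᵒᵖ} (α : p ⟶ q)
    (h : discreteYoneda.obj a ⊗ (simplex (Theta C)).obj p.unop ⟶ W) :
    toLev (p := q) (discreteYoneda.obj a ◁ (simplex (Theta C)).map α.unop ≫ h) =
      act α (toLev h) := by
  apply ofLev_injective
  rw [ofLev_toLev, ← simplex_map_ofLev, ofLev_toLev]

lemma SpineData.ext_of {p : SimplexCategoryᵒᵖ} {s s' : SpineData W a p} (h : ∀ v, s.v v = s'.v v)
    (h' : ∀ i, s.e i = s'.e i) : s = s' := by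
  obtain ⟨v, e, _, _⟩ := s
  obtain ⟨v', e', _, _⟩ := s'
  obtain rfl : v = v' := funext h
  obtain rfl : e = e' := funext h'
  rfl

/-- A spine in `W` of shape `a`, parametrized by a simplicial set `K`. -/
structure SpineFamily (W : SPsh (Theta C)) (a : Theta C) (K : SSet.{u}) where
  /-- The vertices. -/
  v : Fin (a.len + 1) → (K ⟶ W.obj (op Theta.pt))
  /-- The edges. -/
  e : ∀ i : Fin a.len, K ⟶ W.obj (op (Theta.one (a.obj i)))
  src_e : ∀ i, e i ≫ W.map (Theta.src _).op = v i.castSucc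
  tgt_e : ∀ i, e i ≫ W.map (Theta.tgt _).op = v i.succ

namespace SpineFamily

/-- The spine at a simplex of the parameter space. -/
@[simps]
def at' (s : SpineFamily W a K) {p : SimplexCategoryᵒᵖ} (x : K.obj p) : SpineData W a p where
  v i := (s.v i).app p x
  e i := (s.e i).app p x
  src_e i := ConcreteCategory.congr_hom (congr_app (s.src_e i) p) x
  tgt_e i := ConcreteCategory.congr_hom (congr_app (s.tgt_e i) p) x

lemma at_map (s : SpineFamily W a K) {p q : SimplexCategoryᵒᵖ} (α : p ⟶ q) (x : K.obj p) :
    s.at' (K.map α x) = (s.at' x).map α :=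
  SpineData.ext_of (fun i ↦ NatTrans.naturality_apply (s.v i) α x)
    fun i ↦ NatTrans.naturality_apply (s.e i) α x

/-- Lifting against the Segal map in families. -/
lemma exists_extension (hW : IsFibrant (Se S) W) (i : A ⟶ B) [Mono i] (s : SpineFamily W a B)
    (σ : A ⟶ W.obj (op a)) (hv : ∀ v, σ ≫ W.map (Theta.vertex a v).op = i ≫ s.v v)
    (he : ∀ k, σ ≫ W.map (Theta.edge a k).op = i ≫ s.e k) :
    ∃ τ : B ⟶ W.obj (op a), i ≫ τ = σ ∧ (∀ v, τ ≫ W.map (Theta.vertex a v).op = s.v v) ∧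
      ∀ k, τ ≫ W.map (Theta.edge a k).op = s.e k := by
  -- By adjunction `σ` is a map to `Map(F(a), W)` and `s` a map to `Map(spine, W)`. Restriction
  -- between these two mapping spaces is a trivial fibration, so it lifts against `i`.
  let f : A ⟶ mapSpace (discreteYoneda.obj a) W :=
    { app p := ↾fun x ↦ ofLev (W := W) (a := a) (p := p) (σ.app p x)
      naturality p q α := ConcreteCategory.hom_ext _ _ fun x ↦
        (congrArg ofLev (NatTrans.naturality_apply σ α x)).trans
          (simplex_map_ofLev (W := W) (a := a) α (σ.app p x)).symm }
  let g : B ⟶ mapSpace (spine a) W :=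
    { app p := ↾fun x ↦ (s.at' x).desc
      naturality p q α := ConcreteCategory.hom_ext _ _ fun x ↦
        (congrArg SpineData.desc (s.at_map α x)).trans (SpineData.map_desc α (s.at' x)).symm }
  obtain ⟨l, hl, hl'⟩ := exists_lift_of_mono (segal_rlp hW a) i f g (by
    refine SSet.hom_ext fun p ↦ ConcreteCategory.hom_ext _ _ fun x ↦ ?_
    refine ((s.at' (i.app p x)).isSpineOf_iff (σ.app p x)).1 ⟨fun v ↦ ?_, fun k ↦ ?_⟩
    · exact ConcreteCategory.congr_hom (congr_app (hv v) p) x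
    · exact ConcreteCategory.congr_hom (congr_app (he k) p) x)
  let τ : B ⟶ W.obj (op a) :=
    { app p := ↾fun x ↦ toLev (l.app p x)
      naturality p q α := ConcreteCategory.hom_ext _ _ fun x ↦
        (congrArg toLev (NatTrans.naturality_apply l α x)).trans (ofLev_act (W := W) α _) }
  have hτ {p} (x : B.obj p) : (s.at' x).IsSpineOf (toLev (l.app p x)) :=
    ((s.at' x).isSpineOf_iff _).2 ((congrArg _ (ofLev_toLev _)).trans
      (ConcreteCategory.congr_hom (congr_app hl' p) x))
  refine ⟨τ, ?_, fun v ↦ ?_, fun k ↦ ?_⟩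
  · refine SSet.hom_ext fun p ↦ ConcreteCategory.hom_ext _ _ fun x ↦ ?_
    exact (congrArg toLev (ConcreteCategory.congr_hom (congr_app hl p) x)).trans
      (toLev_ofLev (W := W) (a := a) (σ.app p x))
  · exact SSet.hom_ext fun p ↦ ConcreteCategory.hom_ext _ _ fun x ↦ (hτ x).1 v
  · exact SSet.hom_ext fun p ↦ ConcreteCategory.hom_ext _ _ fun x ↦ (hτ x).2 k

end SpineFamily

/-- The map `F(a) × K ⟶ W` corresponding to `K ⟶ W_a`. -/
def ofFamily (k : K ⟶ W.obj (op a)) : discreteYoneda.obj a ⊗ (constant (Theta C)).obj K ⟶ W where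
  app b :=
    { app q := ↾fun (z : (b.unop ⟶ a) × K.obj q) ↦ (res z.1 (k.app q z.2) : Lev W b.unop q)
      naturality q r α := ConcreteCategory.hom_ext _ _ fun z ↦ by
        obtain ⟨f, x⟩ := (z : (b.unop ⟶ a) × K.obj q)
        exact (congrArg (res (W := W) f) (NatTrans.naturality_apply k α x)).trans
          (res_act (W := W) f α (k.app q x)) }
  naturality b c f := SSet.hom_ext fun q ↦ ConcreteCategory.hom_ext _ _ fun z ↦ by
    obtain ⟨g, x⟩ := (z : (b.unop ⟶ a) × K.obj q)
    exact (res_res (W := W) f.unop g (k.app q x)).symm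

/-- The map `K ⟶ W_a` corresponding to `F(a) × K ⟶ W`. -/
def toFamily (h : discreteYoneda.obj a ⊗ (constant (Theta C)).obj K ⟶ W) : K ⟶ W.obj (op a) where
  app q := ↾fun x ↦ (h.app (op a)).app q ((𝟙 a, x) : (a ⟶ a) × K.obj q)
  naturality q _ α := ConcreteCategory.hom_ext _ _ fun x ↦
    NatTrans.naturality_apply (h.app (op a)) α ((𝟙 a, x) : (a ⟶ a) × K.obj q)

lemma res_toFamily (h : discreteYoneda.obj a ⊗ (constant (Theta C)).obj K ⟶ W) {b : Theta C}
    (f : b ⟶ a) {q : SimplexCategoryᵒᵖ} (x : K.obj q) :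
    res f ((toFamily h).app q x) = (h.app (op b)).app q ((f, x) : (b ⟶ a) × K.obj q) := by
  refine (ConcreteCategory.congr_hom (congr_app (h.naturality f.op) q)
    ((𝟙 a, x) : (a ⟶ a) × K.obj q)).symm.trans ?_
  exact congrArg (fun g : b ⟶ a ↦ (h.app (op b)).app q ((g, x) : (b ⟶ a) × K.obj q))
    (Category.comp_id f)

/-- The inclusion of the two endpoints in `F([1](c))`. -/
def endpointsIncl (c : C) : (constant (Theta C)).obj twoPoints.{u} ⟶
    discreteYoneda.obj (Theta.one c) where
  app b :=
    { app _ := ↾fun (z : ULift.{u} Bool) ↦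
        (toPt b.unop ≫ (if z.down then Theta.tgt c else Theta.src c) : b.unop ⟶ Theta.one c)
      naturality _ _ _ := rfl }
  naturality b d f := SSet.hom_ext fun q ↦ ConcreteCategory.hom_ext _ _ fun z ↦ by
    obtain ⟨z⟩ := (z : ULift.{u} Bool)
    exact (congrArg (· ≫ _) (toPt_unique (toPt d.unop) (f.unop ≫ toPt b.unop))).trans
      (Category.assoc _ _ _)

instance (c : C) : Mono (endpointsIncl c) := by
  have (b : (Theta C)ᵒᵖ) (p : SimplexCategoryᵒᵖ) : Mono (((endpointsIncl c).app b).app p) := (mono_iff_injective _).2 fun z z' h ↦ by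
    obtain ⟨z⟩ := (z : ULift.{u} Bool)
    obtain ⟨z'⟩ := (z' : ULift.{u} Bool)
    have h' := congrArg (fun f : b.unop ⟶ Theta.one c ↦ f.base 0) h
    cases z <;> cases z'
    · rfl
    · exact absurd h' (by change (0 : Fin 2) ≠ 1; decide)
    · exact absurd h' (by change (1 : Fin 2) ≠ 0; decide)
    · rfl
  have (b : (Theta C)ᵒᵖ) : Mono ((endpointsIncl c).app b) := NatTrans.mono_of_mono_app _
  exact NatTrans.mono_of_mono_app _

/-- The map on `F[0] ⨿ F[0]` that is constant at two points. -/
def twoCst (x : Bool → Pt W) (K : SSet.{u}) :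
    (constant (Theta C)).obj twoPoints.{u} ⊗ (constant (Theta C)).obj K ⟶ W where
  app b :=
    { app q := ↾fun (z : ULift.{u} Bool × K.obj q) ↦
        (res (toPt b.unop) (cst (x z.1.down) q) : Lev W b.unop q)
      naturality q r α := ConcreteCategory.hom_ext _ _ fun z ↦ by
        obtain ⟨z, _⟩ := (z : ULift.{u} Bool × K.obj q)
        exact (congrArg (res (W := W) (toPt b.unop)) (act_cst α (x z.down)).symm).trans
          (res_act (W := W) (toPt b.unop) α (cst (x z.down) q)) }
  naturality b d f := SSet.hom_ext fun q ↦ ConcreteCategory.hom_ext _ _ fun z ↦ by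
    obtain ⟨z, _⟩ := (z : ULift.{u} Bool × K.obj q)
    exact (congrArg (fun g ↦ res (W := W) g (cst (x z.down) q)) (toPt_unique _ _)).trans
      (res_res (W := W) f.unop (toPt b.unop) (cst (x z.down) q)).symm

/-- The inclusion of a mapping space. -/
def mapFiberIncl (W : SPsh (Theta C)) (x y : Pt W) (c : C) :
    mapFiber W x y c ⟶ W.obj (op (Theta.one c)) where
  app _ := ↾Subtype.val
  naturality _ _ _ := rfl

lemma mapFiber_hom_ext {x y : Pt W} {c : C} {f g : K ⟶ mapFiber W x y c}
    (h : f ≫ mapFiberIncl W x y c = g ≫ mapFiberIncl W x y c) : f = g :=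
  SSet.hom_ext fun p ↦ ConcreteCategory.hom_ext _ _ fun z ↦
    Subtype.ext (ConcreteCategory.congr_hom (congr_app h p) z)

/-- The map to a mapping space given by a family of edges. -/
def mapFiberLift {x y : Pt W} {c : C} (k : K ⟶ W.obj (op (Theta.one c)))
    (h : ∀ ⦃p⦄ (z : K.obj p), res (W := W) (Theta.src c) (k.app p z) = cst x p ∧
      res (W := W) (Theta.tgt c) (k.app p z) = cst y p) : K ⟶ mapFiber W x y c where
  app p := ↾fun z ↦ (⟨k.app p z, h z⟩ : FiberElt W x y c p)
  naturality _ _ α := ConcreteCategory.hom_ext _ _ fun z ↦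
    Subtype.ext (NatTrans.naturality_apply k α z)

/-- A map from `B` to the mapping space is a map `F([1](c)) × B ⟶ W` that is constant at `x` and `y`
on the two endpoints. Finding it is an extension problem along the pushout-product of the endpoint
inclusion with `i`, which is levelwise anodyne, so injective fibrancy of `W` solves it. -/
lemma exists_mapFiber_extension (hW : IsInjectiveFibrant W) (x y : Pt W) (c : C) {i : A ⟶ B}
    (hi : SSet.anodyneExtensions i) (f : A ⟶ mapFiber W x y c) :
    ∃ g : B ⟶ mapFiber W x y c, i ≫ g = f := by
  obtain ⟨w, hw, hw'⟩ := exists_extension hW (endpointsIncl c) hi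
    (ofFamily (f ≫ mapFiberIncl W x y c)) (twoCst (fun b ↦ if b then y else x) B) (by
      refine NatTrans.ext (funext fun b ↦ SSet.hom_ext fun q ↦
        ConcreteCategory.hom_ext _ _ fun z ↦ ?_)
      obtain ⟨⟨z⟩, k⟩ := (z : ULift.{u} Bool × A.obj q)
      let w : FiberElt W x y c q := f.app q k
      cases z
      · exact (res_res (W := W) (toPt b.unop) (Theta.src c) w.1).symm.trans
          (congrArg (res (W := W) (toPt b.unop)) w.2.1)
      · exact (res_res (W := W) (toPt b.unop) (Theta.tgt c) w.1).symm.trans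
          (congrArg (res (W := W) (toPt b.unop)) w.2.2))
  have key (b : Bool) {p} (z : B.obj p) :
      res (W := W) (if b then Theta.tgt c else Theta.src c) ((toFamily w).app p z) =
        cst (if b then y else x) p := by
    refine (res_toFamily w _ z).trans (Eq.trans ?_
      ((ConcreteCategory.congr_hom (congr_app (congr_app hw' (op Theta.pt)) p)
        ((⟨b⟩, z) : ULift.{u} Bool × B.obj p)).trans ?_))
    · refine congrArg (fun g : Theta.pt ⟶ Theta.one c ↦
        (w.app (op Theta.pt)).app p ((g, z) : (Theta.pt ⟶ Theta.one c) × B.obj p)) ?_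
      exact Theta.pt_hom_ext rfl
    · exact (congrArg (fun g ↦ res (W := W) g (cst (if b then y else x) p))
        (toPt_unique _ (𝟙 _))).trans (res_id _)
  refine ⟨mapFiberLift (toFamily w) fun p z ↦ ⟨key false z, key true z⟩, mapFiber_hom_ext ?_⟩
  refine SSet.hom_ext fun p ↦ ConcreteCategory.hom_ext _ _ fun z ↦ ?_
  exact (ConcreteCategory.congr_hom (congr_app (congr_app hw (op (Theta.one c))) p)
    ((𝟙 _, z) : (Theta.one c ⟶ Theta.one c) × A.obj p)).trans (res_id (W := W) _)

lemma kanComplex_mapFiber (hW : IsInjectiveFibrant W) (x y : Pt W) (c : C) :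
    SSet.KanComplex (mapFiber W x y c) := by
  refine (isFibrant_iff _).2 ⟨?_⟩
  rw [fibrations_eq]
  intro A B i hi
  have hi' : SSet.anodyneExtensions i := by
    rw [SSet.anodyneExtensions_eq_llp_rlp]
    exact MorphismProperty.le_llp_rlp _ _ hi
  refine ⟨fun {f g} sq ↦ ?_⟩
  obtain ⟨l, hl⟩ := exists_mapFiber_extension hW x y c hi' f
  exact ⟨⟨⟨l, hl, by subsingleton⟩⟩⟩

end

/-! ### Nerves of families along the diagonal `[n] ↦ [n](c, …, c)`. -/

section

variable {C : Type u} [SmallCategory C]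

/-- The functor `[n] ↦ [n](c, …, c)`. -/
def diag (c : C) : SimplexCategory ⥤ Theta C where
  obj n := tau c n.len
  map φ :=
    { base := φ.toOrderHom
      comp := fun _ _ _ ↦ 𝟙 c }
  map_id _ := Theta.Hom.ext' rfl fun _ _ _ _ ↦ rfl
  map_comp _ _ := Theta.Hom.ext' rfl fun _ _ _ _ ↦ (Category.comp_id _).symm

/-- The simplicial set of families, parametrized by `K`, of simplices of `W` along `diag c`. -/
def familyNerve (W : SPsh (Theta C)) (c : C) (K : SSet.{u}) : SSet.{u} :=
  (diag c).op ⋙ W ⋙ coyoneda.obj (op K)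

variable {U V W : SPsh (Theta C)} {c : C} {A B K L : SSet.{u}}

/-- A simplex of `familyNerve W c K`, as a map. -/
abbrev toMap {n : ℕ} (σ : familyNerve W c K _⦋n⦌) : K ⟶ W.obj (op (tau c n)) := σ

/-- The restriction along a map of parameter spaces. -/
def familyPre (W : SPsh (Theta C)) (c : C) (k : K ⟶ L) : familyNerve W c L ⟶ familyNerve W c K :=
  Functor.whiskerLeft _ (Functor.whiskerLeft _ (coyoneda.map k.op))

/-- The map induced by a morphism of simplicial presheaves. -/
def familyPost (f : U ⟶ V) (c : C) (K : SSet.{u}) : familyNerve U c K ⟶ familyNerve V c K :=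
  Functor.whiskerLeft _ (Functor.whiskerRight f _)

/-- A constant vertex. -/
def cstVertex (W : SPsh (Theta C)) (c : C) (K : SSet.{u}) (x : Pt W) : familyNerve W c K _⦋0⦌ :=
  ({ app p := ↾fun _ ↦ (res (toPt (tau c 0)) (cst x p) : Lev W (tau c 0) p)
     naturality p _ α := ConcreteCategory.hom_ext _ _ fun _ ↦
      (congrArg (res (W := W) _) (act_cst α x).symm).trans (res_act (W := W) _ α (cst x p)) } :
    K ⟶ W.obj (op (tau c 0)))

lemma familyPost_cstVertex (f : U ⟶ V) (x : Pt U) :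
    (familyPost f c K).app _ (cstVertex U c K x) = cstVertex V c K (on f x) :=
  SSet.hom_ext fun p ↦ ConcreteCategory.hom_ext _ _ fun _ ↦
    (on_res f _ (cst x p)).trans (congrArg (res (W := V) _) (on_cst f x p))

variable (W c K) in
/-- Families of edges between two points. -/
abbrev FamilyEdge (x y : Pt W) : Type u :=
  SSet.Edge (cstVertex W c K x) (cstVertex W c K y)

variable {x y z w : Pt W}

namespace FamilyEdge

/-- The restriction along a map of parameter spaces. -/
def pre (e : FamilyEdge W c L x y) (k : K ⟶ L) : FamilyEdge W c K x y :=
  SSet.Edge.map e (familyPre W c k)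

/-- The image under a morphism of simplicial presheaves. -/
def post {x y : Pt U} (e : FamilyEdge U c K x y) (f : U ⟶ V) :
    FamilyEdge V c K (on f x) (on f y) :=
  (SSet.Edge.map e (familyPost f c K)).ofEq (familyPost_cstVertex f x) (familyPost_cstVertex f y)

/-- The constant family of identity edges. -/
abbrev id (x : Pt W) : FamilyEdge W c K x x := SSet.Edge.id _

/-- Homotopy of families of edges. -/
def Rel (e e' : FamilyEdge W c K x y) : Prop :=
  ∃ E : FamilyEdge W c (K ⊗ Δ[1]) x y, E.pre SSet.ι₀ = e ∧ E.pre SSet.ι₁ = e'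

lemma Rel.refl (e : FamilyEdge W c K x y) : Rel e e :=
  ⟨e.pre (fst _ _), rfl, rfl⟩

end FamilyEdge

/-- The constant map to `W_{[0]}`. -/
def cstMap (K : SSet.{u}) (x : Pt W) : K ⟶ W.obj (op Theta.pt) where
  app p := ↾fun _ ↦ (cst x p : Lev W Theta.pt p)
  naturality _ _ α := ConcreteCategory.hom_ext _ _ fun _ ↦ (act_cst α x).symm

lemma map_map {b d : Theta C} (k : K ⟶ W.obj (op d)) {a : Theta C} (f : a ⟶ b) (g : b ⟶ d) :
    (k ≫ W.map g.op) ≫ W.map f.op = k ≫ W.map (f ≫ g).op := by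
  rw [Category.assoc, ← W.map_comp, ← op_comp]

/-- Both `tau c 0` and `Theta.pt` are `[0]`, with the empty list of labels written in two ways; this
passes from one form to the other. -/
lemma cstVertex_comp (x : Pt W) (f : Theta.pt ⟶ tau c 0) :
    toMap (cstVertex W c K x) ≫ W.map f.op = cstMap K x :=
  SSet.hom_ext fun p ↦ ConcreteCategory.hom_ext _ _ fun _ ↦
    (res_res f (toPt (tau c 0)) (cst x p)).trans
      ((congrArg (fun g ↦ res g (cst x p)) (toPt_unique _ (𝟙 _))).trans (res_id _))

namespace FamilyEdge

lemma comp_src (e : FamilyEdge W c K x y) :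
    toMap e.edge ≫ W.map (Theta.src c).op = cstMap K x := by
  have h : toMap e.edge ≫ W.map ((diag c).map (SimplexCategory.δ 1)).op =
    toMap (cstVertex W c K x) := e.src_eq
  refine Eq.trans ?_ ((map_map _ _ _).symm.trans ((congrArg (· ≫ _) h).trans
    (cstVertex_comp x (Theta.vertex (tau c 0) 0))))
  exact congrArg (fun f ↦ toMap e.edge ≫ W.map (Quiver.Hom.op f)) (Theta.pt_hom_ext rfl)

lemma comp_tgt (e : FamilyEdge W c K x y) :
    toMap e.edge ≫ W.map (Theta.tgt c).op = cstMap K y := by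
  have h : toMap e.edge ≫ W.map ((diag c).map (SimplexCategory.δ 0)).op =
    toMap (cstVertex W c K y) := e.tgt_eq
  refine Eq.trans ?_ ((map_map _ _ _).symm.trans ((congrArg (· ≫ _) h).trans
    (cstVertex_comp y (Theta.vertex (tau c 0) 0))))
  exact congrArg (fun f ↦ toMap e.edge ≫ W.map (Quiver.Hom.op f)) (Theta.pt_hom_ext rfl)

lemma ext_toMap {e e' : FamilyEdge W c K x y} (h : toMap e.edge = toMap e'.edge) : e = e' :=
  SSet.Edge.ext h

end FamilyEdge

lemma diag_map_mkOfSucc {n : ℕ} (i : Fin n) :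
    (diag c).map (SimplexCategory.mkOfSucc i) = Theta.edge (tau c n) i := by
  refine Theta.Hom.ext' (OrderHom.ext _ _ (funext fun k ↦ ?_)) fun _ _ _ _ ↦ rfl
  obtain rfl | rfl := eq_zero_or_one k
  · rfl
  · rfl

/-- The spine given by families of consecutive edges. -/
def spineOfEdges {n : ℕ} (x : Fin (n + 1) → Pt W)
    (e : ∀ i : Fin n, FamilyEdge W c K (x i.castSucc) (x i.succ)) :
    SpineFamily W (tau c n) K where
  v i := cstMap K (x i)
  e i := toMap (e i).edge
  src_e i := (e i).comp_src
  tgt_e i := (e i).comp_tgt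

variable {S : MorphismProperty (SPsh C)}

/-- The lifting property relative to the empty simplicial set, where nothing is prescribed in
advance. -/
lemma exists_simplex_of_edges (hW : IsFibrant (Se S) W) {n : ℕ} (x : Fin (n + 1) → Pt W)
    (e : ∀ i : Fin n, FamilyEdge W c K (x i.castSucc) (x i.succ)) :
    ∃ σ : familyNerve W c K _⦋n⦌, ∀ i,
      (familyNerve W c K).map (SimplexCategory.mkOfSucc i).op σ = (e i).edge := by
  obtain ⟨τ, -, -, h⟩ := (spineOfEdges x e).exists_extension hW (initial.to K)
    (initial.to _) (fun _ ↦ initialIsInitial.hom_ext _ _) (fun _ ↦ initialIsInitial.hom_ext _ _)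
  refine ⟨τ, fun i ↦ Eq.trans ?_ (h i)⟩
  exact congrArg (fun f ↦ τ ≫ W.map (Quiver.Hom.op f)) (diag_map_mkOfSucc i)

/-- The relative form is what makes composition respect homotopies. The length is `n + 1` because
agreement on edges determines the vertices only if there is at least one edge. -/
lemma exists_simplex_extension (hW : IsFibrant (Se S) W) (j : A ⟶ B) [Mono j] {n : ℕ}
    (x : Fin (n + 2) → Pt W)
    (e : ∀ i : Fin (n + 1), FamilyEdge W c B (x i.castSucc) (x i.succ))
    (σ : familyNerve W c A _⦋n + 1⦌) (hσ : ∀ i,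
      (familyNerve W c A).map (SimplexCategory.mkOfSucc i).op σ = ((e i).pre j).edge) :
    ∃ τ : familyNerve W c B _⦋n + 1⦌, (familyPre W c j).app _ τ = σ ∧ ∀ i,
      (familyNerve W c B).map (SimplexCategory.mkOfSucc i).op τ = (e i).edge := by
  have hσ' (i : Fin (n + 1)) : toMap σ ≫ W.map (Theta.edge (tau c (n + 1)) i).op =
      j ≫ toMap (e i).edge :=
    Eq.trans (congrArg (fun f ↦ toMap σ ≫ W.map (Quiver.Hom.op f)) (diag_map_mkOfSucc i).symm)
      (hσ i)
  -- The vertex `0` is the source of the first edge, and every other vertex is the target of the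
  -- edge before it.
  obtain ⟨τ, h1, -, h⟩ := (spineOfEdges x e).exists_extension hW j σ (fun v ↦ by
      induction v using Fin.cases with
      | zero =>
        have h : Theta.vertex (tau c (n + 1)) 0 = Theta.src c ≫ Theta.edge (tau c (n + 1)) 0 :=
          Theta.pt_hom_ext rfl
        refine (congrArg (fun f ↦ toMap σ ≫ W.map (Quiver.Hom.op f)) h).trans
          ((map_map _ _ _).symm.trans ((congrArg (· ≫ _) (hσ' 0)).trans ?_))
        exact (Category.assoc _ _ _).trans (congrArg (j ≫ ·) (e 0).comp_src)
      | succ k =>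
        have h : Theta.vertex (tau c (n + 1)) k.succ =
          Theta.tgt c ≫ Theta.edge (tau c (n + 1)) k := Theta.pt_hom_ext rfl
        refine (congrArg (fun f ↦ toMap σ ≫ W.map (Quiver.Hom.op f)) h).trans
          ((map_map _ _ _).symm.trans ((congrArg (· ≫ _) (hσ' k)).trans ?_))
        exact (Category.assoc _ _ _).trans (congrArg (j ≫ ·) (e k).comp_tgt)) hσ'
  refine ⟨τ, h1, fun i ↦ Eq.trans ?_ (h i)⟩
  exact congrArg (fun f ↦ τ ≫ W.map (Quiver.Hom.op f)) (diag_map_mkOfSucc i)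

end

/-! ### Composition triangles inside a simplex of dimension two or three. -/

section

variable {X : SSet.{u}} {x₀ x₁ x₂ x₃ : X _⦋0⦌}

/-- The composite is the face `1`; the simplicial identities give its end points. -/
lemma exists_compStruct_of_simplex {e : SSet.Edge x₀ x₁} {f : SSet.Edge x₁ x₂} (σ : X _⦋2⦌)
    (h2 : X.δ 2 σ = e.edge) (h0 : X.δ 0 σ = f.edge) :
    ∃ (g : SSet.Edge x₀ x₂) (h : SSet.Edge.CompStruct e f g), h.simplex = σ := by
  refine ⟨SSet.Edge.mk (X.δ 1 σ) ?_ ?_, SSet.Edge.CompStruct.mk σ h2 h0 rfl, rfl⟩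
  · rw [← e.src_eq, ← h2]
    exact (ConcreteCategory.congr_hom (X.δ_comp_δ (n := 0) (i := 1) (j := 1) le_rfl) σ).symm
  · rw [← f.tgt_eq, ← h0]
    exact (ConcreteCategory.congr_hom (X.δ_comp_δ (n := 0) (i := 0) (j := 0) le_rfl) σ)

lemma exists_compStructs_of_simplex {e : SSet.Edge x₀ x₁} {f : SSet.Edge x₁ x₂}
    {g : SSet.Edge x₂ x₃} (σ : X _⦋3⦌) (he : X.δ 2 (X.δ 3 σ) = e.edge)
    (hf : X.δ 0 (X.δ 3 σ) = f.edge) (hg : X.δ 0 (X.δ 0 σ) = g.edge) :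
    ∃ (ef : SSet.Edge x₀ x₂) (fg : SSet.Edge x₁ x₃) (efg : SSet.Edge x₀ x₃),
      Nonempty (SSet.Edge.CompStruct e f ef) ∧ Nonempty (SSet.Edge.CompStruct f g fg) ∧
      Nonempty (SSet.Edge.CompStruct ef g efg) ∧ Nonempty (SSet.Edge.CompStruct e fg efg) := by
  have d {i : Fin 3} {j : Fin 3} (h : i ≤ j) :
      X.δ i (X.δ j.succ σ) = X.δ j (X.δ i.castSucc σ) :=
    ConcreteCategory.congr_hom (X.δ_comp_δ (n := 1) h) σ
  -- The faces `3` and `0` are the triangles `012` and `123`, which produce the two partial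
  -- composites. The faces `1` and `2`, the triangles `023` and `013`, share the edge `03`, and this
  -- is associativity.
  obtain ⟨ef, h1, h1'⟩ := exists_compStruct_of_simplex (X.δ 3 σ) he hf
  obtain ⟨fg, h2, h2'⟩ := exists_compStruct_of_simplex (e := f) (f := g) (X.δ 0 σ)
    ((d (i := 0) (j := 2) (by decide)).symm.trans hf) hg
  obtain ⟨efg, h3, h3'⟩ := exists_compStruct_of_simplex (e := ef) (f := g) (X.δ 1 σ)
    ((d (i := 1) (j := 2) (by decide)).symm.trans ((congrArg (X.δ 1) h1'.symm).trans h1.d₁))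
    ((d (i := 0) (j := 0) (by decide)).trans hg)
  refine ⟨ef, fg, efg, ⟨h1⟩, ⟨h2⟩, ⟨h3⟩, ⟨SSet.Edge.CompStruct.mk (X.δ 2 σ) ?_ ?_ ?_⟩⟩
  · exact (d (i := 2) (j := 2) (by decide)).symm.trans he
  · exact (d (i := 0) (j := 1) (by decide)).trans ((congrArg (X.δ 1) h2'.symm).trans h2.d₁)
  · exact (d (i := 1) (j := 1) (by decide)).trans ((congrArg (X.δ 1) h3'.symm).trans h3.d₁)

end

/-! ### The category of points of `W` and homotopy classes of families of edges. -/

section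

variable {C : Type u} [SmallCategory C] {S : MorphismProperty (SPsh C)}
  {U V W : SPsh (Theta C)} {c : C} {K L : SSet.{u}} {x y z w : Pt W}

namespace FamilyEdge

lemma post_id (f : U ⟶ V) (x : Pt U) : (id (c := c) (K := K) x).post f = id (on f x) :=
  ext_toMap ((congrArg SSet.Edge.edge (SSet.Edge.map_id (cstVertex U c K x) _)).trans
    (congrArg (fun v ↦ (SSet.Edge.id (X := familyNerve V c K) v).edge)
      (familyPost_cstVertex (c := c) (K := K) f x)))

/-- Two composable edges, as a sequence. -/
def pairSeq (e : FamilyEdge W c K x y) (f : FamilyEdge W c K y z) :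
    ∀ i : Fin 2, FamilyEdge W c K (![x, y, z] i.castSucc) (![x, y, z] i.succ) :=
  Fin.cons e (Fin.cons f fun i ↦ i.elim0)

/-- Three composable edges, as a sequence. -/
def tripleSeq (e : FamilyEdge W c K x y) (f : FamilyEdge W c K y z) (g : FamilyEdge W c K z w) :
    ∀ i : Fin 3, FamilyEdge W c K (![x, y, z, w] i.castSucc) (![x, y, z, w] i.succ) :=
  Fin.cons e (Fin.cons f (Fin.cons g fun i ↦ i.elim0))

lemma exists_comp (hW : IsFibrant (Se S) W) (e : FamilyEdge W c K x y)
    (f : FamilyEdge W c K y z) :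
    ∃ g : FamilyEdge W c K x z, Nonempty (SSet.Edge.CompStruct e f g) := by
  obtain ⟨σ, hσ⟩ := exists_simplex_of_edges hW ![x, y, z] (pairSeq e f)
  have h0 := hσ 0
  have h1 := hσ 1
  rw [SimplexCategory.mkOfSucc_zero_eq_δ] at h0
  rw [SimplexCategory.mkOfSucc_one_eq_δ] at h1
  obtain ⟨g, h, -⟩ := exists_compStruct_of_simplex (e := e) (f := f) σ h0 h1
  exact ⟨g, ⟨h⟩⟩

lemma exists_assoc (hW : IsFibrant (Se S) W) (e : FamilyEdge W c K x y)
    (f : FamilyEdge W c K y z) (g : FamilyEdge W c K z w) :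
    ∃ (ef : FamilyEdge W c K x z) (fg : FamilyEdge W c K y w) (efg : FamilyEdge W c K x w),
      Nonempty (SSet.Edge.CompStruct e f ef) ∧ Nonempty (SSet.Edge.CompStruct f g fg) ∧
      Nonempty (SSet.Edge.CompStruct ef g efg) ∧ Nonempty (SSet.Edge.CompStruct e fg efg) := by
  obtain ⟨σ, hσ⟩ := exists_simplex_of_edges hW ![x, y, z, w] (tripleSeq e f g)
  have m0 : SimplexCategory.mkOfSucc (0 : Fin 3) = SimplexCategory.δ 2 ≫ SimplexCategory.δ 3 := by
    decide
  have m1 : SimplexCategory.mkOfSucc (1 : Fin 3) = SimplexCategory.δ 0 ≫ SimplexCategory.δ 3 := by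
    decide
  have m2 : SimplexCategory.mkOfSucc (2 : Fin 3) = SimplexCategory.δ 0 ≫ SimplexCategory.δ 0 := by
    decide
  have h0 := hσ 0
  have h1 := hσ 1
  have h2 := hσ 2
  rw [m0, op_comp, Functor.map_comp] at h0
  rw [m1, op_comp, Functor.map_comp] at h1
  rw [m2, op_comp, Functor.map_comp] at h2
  exact exists_compStructs_of_simplex (e := e) (f := f) (g := g) σ h0 h1 h2

/-- The homotopies form a spine over `K × Δ[1]`, and the given triangles fill it over the two ends.
The relative Segal lifting extends these triangles over the cylinder, and the long edge of the
extension is the homotopy. With constant homotopies it says that composites are unique up to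
homotopy. -/
lemma Rel.comp (hW : IsFibrant (Se S) W) {e e' : FamilyEdge W c K x y}
    {f f' : FamilyEdge W c K y z} {g g' : FamilyEdge W c K x z} (he : Rel e e') (hf : Rel f f')
    (h : SSet.Edge.CompStruct e f g) (h' : SSet.Edge.CompStruct e' f' g') : Rel g g' := by
  obtain ⟨E, rfl, rfl⟩ := he
  obtain ⟨F, rfl, rfl⟩ := hf
  have : Mono (twoι.{u}) := twoPoints_mono
  have : Mono (K ◁ twoι.{u}) := by
    have (p : SimplexCategoryᵒᵖ) : Mono ((K ◁ twoι.{u}).app p) := by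
      have := (mono_iff_injective (twoι.{u}.app p)).1 inferInstance
      rw [mono_iff_injective]
      exact fun a b h ↦ Prod.ext (congrArg (fun z ↦ z.1) h : _) (this (congrArg (fun z ↦ z.2) h))
    exact NatTrans.mono_of_mono_app _
  have edges (σ : familyNerve W c K _⦋2⦌) (k : K ⟶ K ⊗ Δ[1])
      (h0 : (familyNerve W c K).δ 2 σ = (E.pre k).edge)
      (h1 : (familyNerve W c K).δ 0 σ = (F.pre k).edge) (i : Fin 2) :
      toMap ((familyNerve W c K).map (SimplexCategory.mkOfSucc i).op σ) =
        k ≫ toMap (pairSeq E F i).edge := by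
    obtain rfl | rfl := eq_zero_or_one i
    · rw [SimplexCategory.mkOfSucc_zero_eq_δ]
      exact h0
    · rw [SimplexCategory.mkOfSucc_one_eq_δ]
      exact h1
  -- The prescribed part over `K × {0, 1}` is `h.simplex` at the end `0` and `h'.simplex` at the end
  -- `1`.
  obtain ⟨τ, hτ, hτ'⟩ := exists_simplex_extension hW (K ◁ twoι) ![x, y, z] (pairSeq E F)
    (twoDesc (X := W.obj (op (tau c 2))) fun b ↦ if b then h'.simplex else h.simplex) (fun i ↦
      twoPoints_hom_ext fun b ↦ by
      cases b
      · refine (edges h.simplex _ h.d₂ h.d₀ i).trans ?_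
        exact (congrArg (· ≫ toMap (pairSeq E F i).edge) twoIncl_false_twoι).symm.trans
          (Category.assoc _ _ _)
      · refine (edges h'.simplex _ h'.d₂ h'.d₀ i).trans ?_
        exact (congrArg (· ≫ toMap (pairSeq E F i).edge) twoIncl_true_twoι).symm.trans
          (Category.assoc _ _ _))
  have h0 := hτ' 0
  have h1 := hτ' 1
  rw [SimplexCategory.mkOfSucc_zero_eq_δ] at h0
  rw [SimplexCategory.mkOfSucc_one_eq_δ] at h1
  obtain ⟨G, k, hk⟩ := exists_compStruct_of_simplex (e := E) (f := F) τ h0 h1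
  have hG (b : Bool) : twoIncl b ≫ K ◁ twoι ≫ toMap G.edge =
      toMap ((familyNerve W c K).δ 1 (if b then h'.simplex else h.simplex)) := by
    refine Eq.trans ?_ (congrArg (fun σ : familyNerve W c _ _⦋2⦌ ↦
      twoIncl b ≫ toMap ((familyNerve W c _).δ 1 σ)) hτ)
    rw [← hk] at hτ
    exact congrArg (fun σ : familyNerve W c _ _⦋1⦌ ↦ twoIncl b ≫ K ◁ twoι ≫ toMap σ)
      (k.d₁.symm.trans (congrArg _ hk))
  refine ⟨G, ext_toMap ?_, ext_toMap ?_⟩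
  · refine Eq.trans ?_ ((hG false).trans h.d₁)
    exact (congrArg (· ≫ toMap G.edge) twoIncl_false_twoι).symm.trans (Category.assoc _ _ _)
  · refine Eq.trans ?_ ((hG true).trans h'.d₁)
    exact (congrArg (· ≫ toMap G.edge) twoIncl_true_twoι).symm.trans (Category.assoc _ _ _)

end FamilyEdge

/-- The category with objects the points of `W` and morphisms the homotopy classes of maps from `K`
to the values at `c` of the mapping objects. -/
def FamilyHo (_c : C) (_K : SSet.{u}) (_ : IsFibrant (Se S) W) : Type u := Pt W

namespace FamilyHo

variable (hW : IsFibrant (Se S) W)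

/-- Homotopy classes of families of edges. -/
def comp (e : Quot (FamilyEdge.Rel (W := W) (c := c) (K := K) (x := x) (y := y)))
    (f : Quot (FamilyEdge.Rel (W := W) (c := c) (K := K) (x := y) (y := z))) :
    Quot (FamilyEdge.Rel (W := W) (c := c) (K := K) (x := x) (y := z)) :=
  Quot.map₂ (fun e f ↦ (FamilyEdge.exists_comp hW e f).choose)
    (fun e f f' h ↦ FamilyEdge.Rel.comp hW (.refl e) h
      (FamilyEdge.exists_comp hW e f).choose_spec.some
      (FamilyEdge.exists_comp hW e f').choose_spec.some)
    (fun e e' f h ↦ FamilyEdge.Rel.comp hW h (.refl f)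
      (FamilyEdge.exists_comp hW e f).choose_spec.some
      (FamilyEdge.exists_comp hW e' f).choose_spec.some) e f

/-- Any triangle computes the composite, not only the chosen one. The category laws and the
functoriality below need nothing more than triangles. -/
lemma comp_mk {e : FamilyEdge W c K x y} {f : FamilyEdge W c K y z} {g : FamilyEdge W c K x z}
    (h : SSet.Edge.CompStruct e f g) : comp hW (Quot.mk _ e) (Quot.mk _ f) = Quot.mk _ g :=
  Quot.sound (FamilyEdge.Rel.comp hW (.refl e) (.refl f)
    (FamilyEdge.exists_comp hW e f).choose_spec.some h)

instance : SmallCategory (FamilyHo c K hW) where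
  Hom x y := Quot (FamilyEdge.Rel (W := W) (c := c) (K := K) (x := x) (y := y))
  id x := Quot.mk _ (FamilyEdge.id x)
  comp e f := comp hW e f
  id_comp e := by
    obtain ⟨e, rfl⟩ := Quot.exists_rep e
    exact comp_mk hW (SSet.Edge.CompStruct.idComp e)
  comp_id e := by
    obtain ⟨e, rfl⟩ := Quot.exists_rep e
    exact comp_mk hW (SSet.Edge.CompStruct.compId e)
  assoc e f g := by
    obtain ⟨e, rfl⟩ := Quot.exists_rep e
    obtain ⟨f, rfl⟩ := Quot.exists_rep f
    obtain ⟨g, rfl⟩ := Quot.exists_rep g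
    obtain ⟨ef, fg, efg, ⟨h1⟩, ⟨h2⟩, ⟨h3⟩, ⟨h4⟩⟩ := FamilyEdge.exists_assoc hW e f g
    rw [comp_mk hW h1, comp_mk hW h2, comp_mk hW h3, comp_mk hW h4]

variable {hW} in
/-- The point underlying an object. -/
def pt (x : FamilyHo c K hW) : Pt W := x

variable (c K) in
/-- The object given by a point. -/
def of (x : Pt W) : FamilyHo c K hW := x

/-- The class of a family of edges. -/
def homMk (e : FamilyEdge W c K x y) : of c K hW x ⟶ of c K hW y := Quot.mk _ e

lemma homMk_surjective (e : of c K hW x ⟶ of c K hW y) : ∃ e', homMk hW e' = e :=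
  Quot.exists_rep e

lemma homMk_comp {e : FamilyEdge W c K x y} {f : FamilyEdge W c K y z} {g : FamilyEdge W c K x z}
    (h : SSet.Edge.CompStruct e f g) : homMk hW e ≫ homMk hW f = homMk hW g :=
  comp_mk hW h

variable {hU : IsFibrant (Se S) U} {hV : IsFibrant (Se S) V}

variable (hU hV c K) in
/-- The functor induced by a morphism of simplicial presheaves. -/
def map (f : U ⟶ V) : FamilyHo c K hU ⥤ FamilyHo c K hV where
  obj x := of c K hV (on f x.pt)
  map {x y} e := Quot.map (fun e ↦ FamilyEdge.post e f) (by
    rintro _ _ ⟨E, rfl, rfl⟩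
    exact ⟨E.post f, rfl, rfl⟩) e
  map_id x := congrArg (Quot.mk _) (FamilyEdge.post_id f _)
  map_comp {x y z} e e' := by
    obtain ⟨e, rfl⟩ := homMk_surjective hU e
    obtain ⟨e', rfl⟩ := homMk_surjective hU e'
    obtain ⟨g, ⟨h⟩⟩ := FamilyEdge.exists_comp hU e e'
    refine (congrArg (Quot.map _ _) (homMk_comp hU h)).trans ?_
    exact (homMk_comp hV ((h.map (familyPost f c K)).ofEq rfl rfl rfl)).symm

end FamilyHo

end

/-! ### Categorical homotopies and natural isomorphisms. -/

section

section

variable {X Y : SSet.{u}} {x₀ x₁ x₂ : X _⦋0⦌} {y₀ y₁ y₂ : Y _⦋0⦌}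

/-- The edge of a product given by a pair of edges. -/
def edgePair (e : SSet.Edge x₀ x₁) (e' : SSet.Edge y₀ y₁) :
    SSet.Edge (X := X ⊗ Y) (x₀, y₀) (x₁, y₁) :=
  SSet.Edge.mk (X := X ⊗ Y) (e.edge, e'.edge) (Prod.ext e.src_eq e'.src_eq)
    (Prod.ext e.tgt_eq e'.tgt_eq)

/-- The `2`-simplex of a product given by a pair of `2`-simplices. -/
def compStructPair {e : SSet.Edge x₀ x₁} {f : SSet.Edge x₁ x₂} {g : SSet.Edge x₀ x₂}
    {e' : SSet.Edge y₀ y₁} {f' : SSet.Edge y₁ y₂} {g' : SSet.Edge y₀ y₂}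
    (h : SSet.Edge.CompStruct e f g) (h' : SSet.Edge.CompStruct e' f' g') :
    SSet.Edge.CompStruct (edgePair e e') (edgePair f f') (edgePair g g') :=
  SSet.Edge.CompStruct.mk (X := X ⊗ Y) (h.simplex, h'.simplex) (Prod.ext h.d₂ h'.d₂)
    (Prod.ext h.d₀ h'.d₀) (Prod.ext h.d₁ h'.d₁)

end

variable {C : Type u} [SmallCategory C] {S : MorphismProperty (SPsh C)}
  {U V : SPsh (Theta C)} {c : C} {K : SSet.{u}}

/-- The simplex of `U ⊗ piE C` given by a pair. -/
def levPair {a : Theta C} {p : SimplexCategoryᵒᵖ} (w : Lev U a p)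
    (ε : SSet.coherentIso.{u} _⦋a.len⦌) : Lev (U ⊗ piE C) a p :=
  (w, ε)

/-- The action of a categorical homotopy on families of simplices. -/
def homotopyMap (H : U ⊗ piE C ⟶ V) (c : C) (K : SSet.{u}) :
    familyNerve U c K ⊗ SSet.coherentIso ⟶ familyNerve V c K where
  app n := ↾fun s ↦ ({
    app p := ↾fun k ↦ (on H (levPair (a := tau c n.unop.len)
      ((s.1 : K ⟶ U.obj (op (tau c n.unop.len))).app p k) s.2) : Lev V (tau c n.unop.len) p)
    naturality p q α := ConcreteCategory.hom_ext _ _ fun k ↦ by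
      refine Eq.trans ?_ (on_act H α _)
      exact congrArg (fun z ↦ on H (levPair (a := tau c n.unop.len) z s.2))
        (NatTrans.naturality_apply (s.1 : K ⟶ U.obj (op (tau c n.unop.len))) α k) } :
    K ⟶ V.obj (op (tau c n.unop.len)))
  -- Along `diag c` the presheaf `π^* E` is the nerve of `I`, constant in the space direction, so
  -- naturality in `[n]` is that of `H` in `Θ C`.
  naturality n m φ := ConcreteCategory.hom_ext _ _ fun s ↦
    SSet.hom_ext fun p ↦ ConcreteCategory.hom_ext _ _ fun k ↦
      on_res H ((diag c).map φ.unop) (levPair (a := tau c n.unop.len)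
        ((s.1 : K ⟶ U.obj (op (tau c n.unop.len))).app p k) s.2)

section

variable {H : U ⊗ piE C ⟶ V} {f g : U ⟶ V} 

/-- The simplex `ε` is a variable so that vertices and degenerate simplices of `SSet.coherentIso`
can be supplied, each with its own proof of being constant. -/
lemma homotopyMap_zero (hf : CartesianMonoidalCategory.lift (𝟙 U)
      (CartesianMonoidalCategory.toUnit U ≫ piEPoint C WalkingIso.zero) ≫ H = f) {n : ℕ}
      (σ : familyNerve U c K _⦋n⦌) (ε : SSet.coherentIso.{u} _⦋n⦌)
      (hε : ε = (Functor.const _).obj WalkingIso.zero) :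
    (homotopyMap H c K).app (op ⦋n⦌) (σ, ε) = (familyPost f c K).app _ σ := by
  subst hf hε
  rfl

lemma homotopyMap_one (hg : CartesianMonoidalCategory.lift (𝟙 U)
      (CartesianMonoidalCategory.toUnit U ≫ piEPoint C WalkingIso.one) ≫ H = g) {n : ℕ}
      (σ : familyNerve U c K _⦋n⦌) (ε : SSet.coherentIso.{u} _⦋n⦌)
      (hε : ε = (Functor.const _).obj WalkingIso.one) :
    (homotopyMap H c K).app (op ⦋n⦌) (σ, ε) = (familyPost g c K).app _ σ := by
  subst hg hε
  rfl

lemma coherentIso_x₀_eq : SSet.coherentIso.x₀.{u} = (Functor.const _).obj WalkingIso.zero :=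
  ComposableArrows.ext₀ rfl

lemma coherentIso_x₁_eq : SSet.coherentIso.x₁.{u} = (Functor.const _).obj WalkingIso.one :=
  ComposableArrows.ext₀ rfl

lemma coherentIso_id_x₀_eq :
    (SSet.Edge.id SSet.coherentIso.x₀.{u}).edge = (Functor.const _).obj WalkingIso.zero :=
  ComposableArrows.ext₁ rfl rfl rfl

lemma coherentIso_id_x₁_eq :
    (SSet.Edge.id SSet.coherentIso.x₁.{u}).edge = (Functor.const _).obj WalkingIso.one :=
  ComposableArrows.ext₁ rfl rfl rfl

section

variable (hf : CartesianMonoidalCategory.lift (𝟙 U)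
      (CartesianMonoidalCategory.toUnit U ≫ piEPoint C WalkingIso.zero) ≫ H = f)
  (hg : CartesianMonoidalCategory.lift (𝟙 U)
      (CartesianMonoidalCategory.toUnit U ≫ piEPoint C WalkingIso.one) ≫ H = g)
  {x y : Pt U}

lemma homotopyMap_x₀ (hf : CartesianMonoidalCategory.lift (𝟙 U)
      (CartesianMonoidalCategory.toUnit U ≫ piEPoint C WalkingIso.zero) ≫ H = f) (x : Pt U) : (homotopyMap H c K).app (op ⦋0⦌)
    (cstVertex U c K x, SSet.coherentIso.x₀) = cstVertex V c K (on f x) :=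
  (homotopyMap_zero hf _ _ coherentIso_x₀_eq).trans (familyPost_cstVertex f x)

lemma homotopyMap_x₁ (hg : CartesianMonoidalCategory.lift (𝟙 U)
      (CartesianMonoidalCategory.toUnit U ≫ piEPoint C WalkingIso.one) ≫ H = g) (x : Pt U) : (homotopyMap H c K).app (op ⦋0⦌)
    (cstVertex U c K x, SSet.coherentIso.x₁) = cstVertex V c K (on g x) :=
  (homotopyMap_one hg _ _ coherentIso_x₁_eq).trans (familyPost_cstVertex g x)

/-- The diagonal edge of the square which a categorical homotopy associates to a family of edges. -/
def homotopyEdge (e : FamilyEdge U c K x y) : FamilyEdge V c K (on f x) (on g y) :=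
  ((edgePair e SSet.coherentIso.hom).map (homotopyMap H c K)).ofEq (homotopyMap_x₀ hf x)
    (homotopyMap_x₁ hg y)

/-- The inverse of the family of edges which a categorical homotopy associates to a point. -/
def homotopyInv (x : Pt U) : FamilyEdge V c K (on g x) (on f x) :=
  ((edgePair (FamilyEdge.id x) SSet.coherentIso.inv).map (homotopyMap H c K)).ofEq
    (homotopyMap_x₁ hg x) (homotopyMap_x₀ hf x)

/-- The first half of the square associated to a family of edges. -/
def homotopyCompRight (e : FamilyEdge U c K x y) :
    SSet.Edge.CompStruct (e.post f) (homotopyEdge hf hg (FamilyEdge.id y))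
      (homotopyEdge hf hg e) :=
  ((compStructPair (SSet.Edge.CompStruct.compId e)
    (SSet.Edge.CompStruct.idComp SSet.coherentIso.hom)).map (homotopyMap H c K)).ofEq
    (homotopyMap_zero hf _ _ coherentIso_id_x₀_eq) rfl rfl

/-- The second half of the square associated to a family of edges. -/
def homotopyCompLeft (e : FamilyEdge U c K x y) :
    SSet.Edge.CompStruct (homotopyEdge hf hg (FamilyEdge.id x)) (e.post g)
      (homotopyEdge hf hg e) :=
  ((compStructPair (SSet.Edge.CompStruct.idComp e)
    (SSet.Edge.CompStruct.compId SSet.coherentIso.hom)).map (homotopyMap H c K)).ofEq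
    rfl (homotopyMap_one hg _ _ coherentIso_id_x₁_eq) rfl

/-- The inverse is a right inverse. -/
def homotopyHomInv (x : Pt U) :
    SSet.Edge.CompStruct (homotopyEdge (c := c) (K := K) hf hg (FamilyEdge.id x))
      (homotopyInv hf hg x) (FamilyEdge.id (on f x)) :=
  ((compStructPair (SSet.Edge.CompStruct.compId (FamilyEdge.id (c := c) (K := K) x))
    SSet.coherentIso.homInvId).map (homotopyMap H c K)).ofEq rfl rfl
    ((homotopyMap_zero hf _ _ coherentIso_id_x₀_eq).trans
      (congrArg SSet.Edge.edge (FamilyEdge.post_id f x)))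

/-- The inverse is a left inverse. -/
def homotopyInvHom (x : Pt U) :
    SSet.Edge.CompStruct (homotopyInv hf hg x)
      (homotopyEdge (c := c) (K := K) hf hg (FamilyEdge.id x)) (FamilyEdge.id (on g x)) :=
  ((compStructPair (SSet.Edge.CompStruct.compId (FamilyEdge.id (c := c) (K := K) x))
    SSet.coherentIso.invHomId).map (homotopyMap H c K)).ofEq rfl rfl
    ((homotopyMap_one hg _ _ coherentIso_id_x₁_eq).trans
      (congrArg SSet.Edge.edge (FamilyEdge.post_id g x)))

end

namespace FamilyHo

variable (hU : IsFibrant (Se S) U) (hV : IsFibrant (Se S) V)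

variable (c K) in
/-- Categorically homotopic maps induce isomorphic functors. -/
lemma nonempty_map_iso (h : CategoricallyHomotopic f g) :
    Nonempty (map c K hU hV f ≅ map c K hU hV g) := by
  obtain ⟨H, hf, hg⟩ := h
  refine ⟨NatIso.ofComponents (fun x ↦
    { hom := homMk hV (homotopyEdge hf hg (FamilyEdge.id x.pt))
      inv := homMk hV (homotopyInv hf hg x.pt)
      hom_inv_id := homMk_comp hV (homotopyHomInv hf hg x.pt)
      inv_hom_id := homMk_comp hV (homotopyInvHom hf hg x.pt) }) fun {x y} e ↦ ?_⟩
  obtain ⟨e, rfl⟩ := homMk_surjective hU e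
  -- Both ways around the naturality square equal its diagonal, one across each of the two triangles
  -- of the square.
  exact (homMk_comp hV (homotopyCompRight hf hg e)).trans
    (homMk_comp hV (homotopyCompLeft hf hg e)).symm

end FamilyHo

end

end

/-! ### Yoneda argument: mapping objects and levelwise weak equivalences. -/

section

variable {C : Type u} [SmallCategory C] {S : MorphismProperty (SPsh C)}
  {U V W : SPsh (Theta C)} {c : C} {K : SSet.{u}}

namespace FamilyHo

variable (hU : IsFibrant (Se S) U) (hV : IsFibrant (Se S) V) (hW : IsFibrant (Se S) W)

variable (c K) in
lemma map_comp_eq (f : U ⟶ V) (g : V ⟶ W) :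
    map c K hU hW (f ≫ g) = map c K hU hV f ⋙ map c K hV hW g :=
  Functor.hext (fun _ ↦ rfl) fun _ _ e ↦ heq_of_eq <| by
    obtain ⟨e, rfl⟩ := homMk_surjective hU e
    rfl

variable (c K) in
lemma map_id_eq : map c K hU hU (𝟙 U) = 𝟭 _ :=
  Functor.hext (fun _ ↦ rfl) fun _ _ e ↦ heq_of_eq <| by
    obtain ⟨e, rfl⟩ := homMk_surjective hU e
    rfl

variable (c K) in
-- The left inverse `h` and the right inverse `h'` of `f` are different maps, but the functors they
-- induce are isomorphic, through the composite of `h'`, `f` and `h`. So the functor of `h` is a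
-- two-sided inverse.
lemma isEquivalence_map {f : U ⟶ V} (hf : IsCategoricalEquiv f) :
    (map c K hU hV f).IsEquivalence := by
  obtain ⟨h, h', H, H'⟩ := hf
  obtain ⟨i⟩ := nonempty_map_iso c K hU hU H
  obtain ⟨i'⟩ := nonempty_map_iso c K hV hV H'
  rw [map_comp_eq c K hU hV hU, map_id_eq] at i
  rw [map_comp_eq c K hV hU hV, map_id_eq] at i'
  have : map c K hV hU h' ≅ map c K hV hU h :=
    (Functor.rightUnitor _).symm ≪≫ Functor.isoWhiskerLeft _ i.symm ≪≫
      (Functor.associator _ _ _).symm ≪≫ Functor.isoWhiskerRight i' _ ≪≫ Functor.leftUnitor _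
  exact (CategoryTheory.Equivalence.mk _ _ i.symm (Functor.isoWhiskerRight this.symm _ ≪≫ i')).isEquivalence_functor

end FamilyHo

section

variable {x y : Pt W} {k k' : K ⟶ mapFiber W x y c}

namespace FamilyEdge

lemma diag_map_δ_one : (diag c).map (SimplexCategory.δ (n := 0) 1) = toPt _ ≫ Theta.src c :=
  Theta.Hom.ext' (OrderHom.ext _ _ (funext fun i ↦ by
    obtain rfl : i = 0 := Subsingleton.elim (α := Fin 1) _ _
    rfl)) fun i ↦ i.elim0

lemma diag_map_δ_zero : (diag c).map (SimplexCategory.δ (n := 0) 0) = toPt _ ≫ Theta.tgt c :=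
  Theta.Hom.ext' (OrderHom.ext _ _ (funext fun i ↦ by
    obtain rfl : i = 0 := Subsingleton.elim (α := Fin 1) _ _
    rfl)) fun i ↦ i.elim0

/-- The family of edges given by a map to a mapping space. -/
def ofFiber (k : K ⟶ mapFiber W x y c) : FamilyEdge W c K x y :=
  SSet.Edge.mk (X := familyNerve W c K) (k ≫ mapFiberIncl W x y c)
    (SSet.hom_ext fun p ↦ ConcreteCategory.hom_ext _ _ fun z ↦
      (congrArg (fun φ ↦ res φ (k.app p z : FiberElt W x y c p).1) diag_map_δ_one).trans
        ((res_res _ _ _).symm.trans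
          (congrArg (res _) (k.app p z : FiberElt W x y c p).2.1)))
    (SSet.hom_ext fun p ↦ ConcreteCategory.hom_ext _ _ fun z ↦
      (congrArg (fun φ ↦ res φ (k.app p z : FiberElt W x y c p).1) diag_map_δ_zero).trans
        ((res_res _ _ _).symm.trans
          (congrArg (res _) (k.app p z : FiberElt W x y c p).2.2)))

/-- The map to a mapping space given by a family of edges. -/
def toFiber (e : FamilyEdge W c K x y) : K ⟶ mapFiber W x y c :=
  mapFiberLift (toMap e.edge) fun p z ↦
    ⟨ConcreteCategory.congr_hom (congr_app e.comp_src p) z,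
      ConcreteCategory.congr_hom (congr_app e.comp_tgt p) z⟩

/-- Families over `K × Δ[1]` with constant end points are homotopies of maps into the mapping space.
Thus the hom-sets of `FamilyHo` are sets of homotopy classes of maps out of `K`. -/
lemma rel_iff_homotopyRel {e e' : FamilyEdge W c K x y} :
    Rel e e' ↔ HomotopyRel e.toFiber e'.toFiber := by
  constructor
  · rintro ⟨E, rfl, rfl⟩
    exact ⟨E.toFiber, rfl, rfl⟩
  · rintro ⟨E, h, h'⟩
    exact ⟨ofFiber E, (congrArg ofFiber h : _), (congrArg ofFiber h' : _)⟩

/-- The mapping space is a Kan complex, so homotopy is already an equivalence relation. Equal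
classes therefore come from an actual homotopy, not merely a chain of them. -/
lemma equivalence_rel (hW : IsFibrant (Se S) W) :
    Equivalence (Rel (W := W) (c := c) (K := K) (x := x) (y := y)) := by
  have := kanComplex_mapFiber hW.isInjectiveFibrant x y c
  have h : Equivalence (HomotopyRel (K := K) (X := mapFiber W x y c)) :=
    HomotopyRel.equivalence _ _
  exact ⟨fun e ↦ .refl e, fun h1 ↦ rel_iff_homotopyRel.2 (h.symm (rel_iff_homotopyRel.1 h1)),
    fun h1 h2 ↦ rel_iff_homotopyRel.2
      (h.trans (rel_iff_homotopyRel.1 h1) (rel_iff_homotopyRel.1 h2))⟩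

end FamilyEdge

lemma FamilyHo.homMk_eq_iff (hW : IsFibrant (Se S) W) {e e' : FamilyEdge W c K x y} :
    homMk hW e = homMk hW e' ↔ FamilyEdge.Rel e e' :=
  Equivalence.quot_mk_eq_iff (FamilyEdge.equivalence_rel hW) _ _

end

lemma exists_homotopyInverse_mapObjMap (hU : IsFibrant (Se S) U) (hV : IsFibrant (Se S) V)
    {f : U ⟶ V} (hf : IsCategoricalEquiv f) (x y : Pt U) (c : C) :
    ∃ g : mapFiber V (on f x) (on f y) c ⟶ mapFiber U x y c,
      HomotopyRel (g ≫ (mapObjMap f x y).app (op c)) (𝟙 _) ∧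
      HomotopyRel ((mapObjMap f x y).app (op c) ≫ g) (𝟙 (mapFiber U x y c)) := by
  let X := mapFiber U x y c
  let Y := mapFiber V (on f x) (on f y) c
  let g : X ⟶ Y := (mapObjMap f x y).app (op c)
  -- Fullness with parameter space `Y`, applied to the tautological family `𝟙 Y`, yields a right
  -- homotopy inverse.
  have surj : ∃ g' : Y ⟶ X, HomotopyRel (g' ≫ g) (𝟙 Y) := by
    have := FamilyHo.isEquivalence_map c Y hU hV hf
    obtain ⟨e, he⟩ := (FamilyHo.map c Y hU hV f).map_surjective
      (X := FamilyHo.of c Y hU x) (Y := FamilyHo.of c Y hU y)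
      (FamilyHo.homMk hV (FamilyEdge.ofFiber (𝟙 Y)))
    obtain ⟨e, rfl⟩ := FamilyHo.homMk_surjective hU e
    exact ⟨e.toFiber, FamilyEdge.rel_iff_homotopyRel.1 ((FamilyHo.homMk_eq_iff hV).1 he)⟩
  obtain ⟨g', h⟩ := surj
  have := FamilyHo.isEquivalence_map c X hU hV hf
  -- Faithfulness with parameter space `X`: the families `g ≫ g'` and `𝟙 X` have homotopic images,
  -- since `g ≫ g' ≫ g ∼ g`, so they are homotopic.
  refine ⟨g', h, FamilyEdge.rel_iff_homotopyRel.1 ((FamilyHo.homMk_eq_iff hU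
    (e := FamilyEdge.ofFiber (g ≫ g')) (e' := FamilyEdge.ofFiber (𝟙 X))).1
    ((FamilyHo.map c X hU hV f).map_injective
    ((FamilyHo.homMk_eq_iff hV).2 (FamilyEdge.rel_iff_homotopyRel.2 ?_))))⟩
  exact h.comp_left g

theorem isLevelwiseWeakEquiv_mapObjMap (hU : IsFibrant (Se S) U) (hV : IsFibrant (Se S) V)
    {f : U ⟶ V} (hf : IsCategoricalEquiv f) (x y : Pt U) :
    IsLevelwiseWeakEquiv (mapObjMap f x y) := by
  intro d
  have : SSet.KanComplex (mapFiber U x y d.unop) :=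
    kanComplex_mapFiber hU.isInjectiveFibrant x y d.unop
  have : SSet.KanComplex (mapFiber V (on f x) (on f y) d.unop) :=
    kanComplex_mapFiber hV.isInjectiveFibrant _ _ d.unop
  obtain ⟨g, h, h'⟩ := exists_homotopyInverse_mapObjMap hU hV hf x y d.unop
  exact isWeakEquiv_of_homotopyEquiv (X := mapFiber U x y d.unop)
    (Y := mapFiber V (on f x) (on f y) d.unop) ((mapObjMap f x y).app d) g h h'

end

/-! ### The homotopy category. -/

section

lemma HomotopyRel.mapπ₀_eq {K X : SSet.{u}} {f g : K ⟶ X} (h : HomotopyRel f g)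
    (v : SSet.π₀ K) : SSet.mapπ₀ f v = SSet.mapπ₀ g v := by
  obtain ⟨H, rfl, rfl⟩ := h
  obtain ⟨v, rfl⟩ := v.mk_surjective
  -- The path `{v} × Δ[1]` in the cylinder, which `H` carries to a path joining the two images of
  -- `v`.
  have e : SSet.Edge (X := K ⊗ Δ[1]) ((SSet.ι₀ (X := K)).app _ v) ((SSet.ι₁ (X := K)).app _ v) :=
    SSet.Edge.mk (X := K ⊗ Δ[1]) (K.σ 0 v, SSet.stdSimplex.objEquiv.symm (𝟙 ⦋1⦌))
      (Prod.ext (SSet.Edge.id v).src_eq (SSet.stdSimplex.ext _ _ fun i ↦ by fin_cases i; rfl))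
      (Prod.ext (SSet.Edge.id v).tgt_eq (SSet.stdSimplex.ext _ _ fun i ↦ by fin_cases i; rfl))
  exact SSet.π₀.sound (e.map H)

variable {C : Type u} [SmallCategory C] {S : MorphismProperty (SPsh C)}
  {U V W : SPsh (Theta C)} {t : C} {K : SSet.{u}}

namespace FamilyEdge

variable {x y z : Pt W}

/-- A member of a family of edges. -/
def member (e : FamilyEdge W t K x y) (k : K _⦋0⦌) : FiberElt W x y t (op ⦋0⦌) :=
  e.toFiber.app _ k

lemma member_id (x : Pt W) (k : K _⦋0⦌) : (id (c := t) (K := K) x).member k = idEdge t x := by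
  refine Subtype.ext ?_
  exact (res_res _ _ _).trans ((congrArg (fun φ ↦ res φ (cst x _)) (toPt_unique _ _)).trans
    (congrArg (res (toPt (Theta.one t))) (cst_zero x)))

/-- The diagonal uses identities of `t` as components and `toTau` uses maps to the terminal object;
these agree by `tau_hom_ext`, so triangles of families give triangles defining composition in the
homotopy category. -/
lemma isComposite (ht : IsTerminal t) {e : FamilyEdge W t K x y} {f : FamilyEdge W t K y z}
    {g : FamilyEdge W t K x z} (h : SSet.Edge.CompStruct e f g) (k : K _⦋0⦌) :
    IsComposite ht (e.member k).1 (f.member k).1 (g.member k).1 := by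
  refine ⟨(toMap h.simplex).app _ k, ?_, ?_, ?_⟩
  · refine Eq.trans ?_ (ConcreteCategory.congr_hom (congr_app
      (h.d₂ : toMap ((familyNerve W t K).δ 2 h.simplex) = toMap e.edge) (op ⦋0⦌)) k)
    refine congrArg (fun f ↦ res f ((toMap h.simplex).app _ k)) (tau_hom_ext ht
      (OrderHom.ext _ _ (funext fun k ↦ ?_)))
    obtain rfl | rfl : k = (0 : Fin 2) ∨ k = (1 : Fin 2) := eq_zero_or_one k <;> rfl
  · refine Eq.trans ?_ (ConcreteCategory.congr_hom (congr_app
      (h.d₀ : toMap ((familyNerve W t K).δ 0 h.simplex) = toMap f.edge) (op ⦋0⦌)) k)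
    refine congrArg (fun f ↦ res f ((toMap h.simplex).app _ k)) (tau_hom_ext ht
      (OrderHom.ext _ _ (funext fun k ↦ ?_)))
    obtain rfl | rfl : k = (0 : Fin 2) ∨ k = (1 : Fin 2) := eq_zero_or_one k <;> rfl
  · refine Eq.trans ?_ (ConcreteCategory.congr_hom (congr_app
      (h.d₁ : toMap ((familyNerve W t K).δ 1 h.simplex) = toMap g.edge) (op ⦋0⦌)) k)
    refine congrArg (fun f ↦ res f ((toMap h.simplex).app _ k)) (tau_hom_ext ht
      (OrderHom.ext _ _ (funext fun k ↦ ?_)))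
    obtain rfl | rfl : k = (0 : Fin 2) ∨ k = (1 : Fin 2) := eq_zero_or_one k <;> rfl

end FamilyEdge

/-- Categorically homotopic maps agree on points up to isomorphism in the homotopy category. -/
lemma nonempty_ho_iso (ht : IsTerminal t) (hV : IsFibrant (Se S) V) {f g : U ⟶ V}
    (h : CategoricallyHomotopic f g) (x : Pt U) :
    Nonempty ((show Ho ht hV from on f x) ≅ (show Ho ht hV from on g x)) := by
  obtain ⟨H, hf, hg⟩ := h
  -- Families over `Δ[0]`, evaluated at its vertex, are single edges of `W`, so the triangles
  -- exhibiting the inverse hold in the homotopy category.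
  let k : Δ[0] _⦋0⦌ := SSet.stdSimplex.objEquiv.symm (𝟙 _)
  let i := (homotopyEdge (c := t) (K := Δ[0]) hf hg (FamilyEdge.id x)).member k
  let j := (homotopyInv (c := t) (K := Δ[0]) hf hg x).member k
  refine ⟨{ hom := HoHom.mk i, inv := HoHom.mk j, hom_inv_id := ?_, inv_hom_id := ?_ }⟩
  · exact (HoHom.comp_mk ht hV (FamilyEdge.isComposite ht (homotopyHomInv hf hg x) k)).trans
      (congrArg HoHom.mk (FamilyEdge.member_id _ k))
  · exact (HoHom.comp_mk ht hV (FamilyEdge.isComposite ht (homotopyInvHom hf hg x) k)).trans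
      (congrArg HoHom.mk (FamilyEdge.member_id _ k))

/-- On hom-sets the functor is `π₀` of a homotopy equivalence, hence bijective. The object `h' y` is
a preimage of `y` up to isomorphism, by the homotopy from `h' ≫ f` to the identity. -/
lemma isEquivalence_hoMap (ht : IsTerminal t) (hU : IsFibrant (Se S) U) (hV : IsFibrant (Se S) V)
    {f : U ⟶ V} (hf : IsCategoricalEquiv f) : (hoMap ht hU hV f).IsEquivalence where
  faithful := ⟨fun {x y} a b hab ↦ by
    obtain ⟨g, -, h⟩ := exists_homotopyInverse_mapObjMap hU hV hf x y t
    have (a : HoHom U t x y) : SSet.mapπ₀ g ((hoMap ht hU hV f).map a) = a :=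
      (SSet.mapπ₀_comp_apply _ _ _).symm.trans ((h.mapπ₀_eq a).trans (SSet.mapπ₀_id_apply a))
    exact (this a).symm.trans ((congrArg _ hab).trans (this b))⟩
  full := ⟨fun {x y} b ↦ by
    obtain ⟨g, h, -⟩ := exists_homotopyInverse_mapObjMap hU hV hf x y t
    exact ⟨SSet.mapπ₀ g b,
      (SSet.mapπ₀_comp_apply _ _ _).symm.trans ((h.mapπ₀_eq b).trans (SSet.mapπ₀_id_apply b))⟩⟩
  essSurj := ⟨fun y ↦ by
    obtain ⟨-, h', -, H'⟩ := hf
    exact ⟨on h' (show Pt V from y), nonempty_ho_iso ht hV H' y⟩⟩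

end

end SPsh

end

theorem proposition4p15 {C : Type u} [SmallCategory C] {t : C} (ht : IsTerminal t)
    (S : MorphismProperty (SPsh C)) [MorphismProperty.IsSmall.{u} S] (hS : SPsh.IsCartesian S)
    {U V : SPsh (Theta C)} (hU : SPsh.IsFibrant (SPsh.Se S) U)
    (hV : SPsh.IsFibrant (SPsh.Se S) V) (f : U ⟶ V) (hf : SPsh.IsCategoricalEquiv f) :
    SPsh.IsDKEquiv ht hU hV f :=
  ⟨SPsh.isEquivalence_hoMap ht hU hV hf, SPsh.isLevelwiseWeakEquiv_mapObjMap hU hV hf⟩
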